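/- Let $H,V_0>0$, $m,\xi\in\mathbb R$ and let $\eta_0,\eta_1<0$ be conformal times. On the Poincaré patch of de Sitter spacetime, $ds^2=a^2(\eta)(-d\eta^2+d\vec x^2)$, $a(\eta)=-1/(H\eta)$, consider a real scalar field with $(\Box-m^2-\xi R)\Phi=0$ and momentum $\Pi=V_0a^2\Phi'$. Initial data $\gamma=(e,p)$ at a given time are finite superpositions of plane waves $e^{i\vec k\cdot\vec x}$, $\vec k\in\mathbb R^3\setminus\{0\}$, with the product $\langle\gamma,\tilde\gamma\rangle=i\int\frac{d^3x}{V_0}(e^*\tilde p-p^*\tilde e)$, for which the plane waves are orthonormal with respect to the volume average $\int\frac{d^3x}{V_0}$. Let $\mu^2=\frac94-\frac{m^2}{H^2}-12\xi$, with $\mu\ge0$ or $\mu\in i(0,\infty)$, $k=|\vec k|$, and $$\gamma^{\rm BD}_{\vec k}(\eta)=\Big(e_k(\eta)\,e^{i\vec k\cdot\vec x},\;V_0a^2(\eta)\,e_k'(\eta)\,e^{i\vec k\cdot\vec x}\Big),\qquad e_k(\eta)=\sqrt{\tfrac{-\pi\eta}{4V_0a^2(\eta)}}\;e^{-\pi\,{\rm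 Im}\,\mu/2}\,H^{(1)}_\mu(-k\eta).$$ A basis of modes $\{\gamma_{\vec k}\}$ with $\langle\gamma_{\vec k},\gamma_{\vec k'}\rangle=\delta_{\vec k,\vec k'}$ and $\langle\gamma_{\vec k},\gamma_{\vec k'}^*\rangle=0$, such that the $\gamma_{\vec k}$ and $\gamma_{\vec k}^*$ span the complexified phase space, defines a Fock vacuum: the state on the Weyl algebra of the field which is Gaussian with zero mean and covariance $\sigma^{ij}=\sum_{\vec k}\big(\gamma^i_{\vec k}\gamma^{j*}_{\vec k}+\gamma^j_{\vec k}\gamma^{i*}_{\vec k}\big)$. Let $|{\rm BD},\eta\rangle$ be the vacuum of the modes $\gamma^{\rm BD}_{\vec k}(\eta)$. A state is PdS-invariant at $\eta$ if it is invariant under translations, rotations and, for all $\lambda\in\mathbb R$, the transformation of initial data at $\eta$ which evolves them to time $e^{-H\lambda}\eta$ and contracts $\vec x\to e^{-H\lambda}\vec x$ (with the normalization volume transformed accordingly, so that $\langle\cdot,\cdot\rangle$ is preserved). A vacuum with modes $(e_{\vec k},p_{\vec k})e^{i\vec k\cdot\vec x}$ is called Hadamard at $\eta$ if these approach positive-frequency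 modes, $p_{\vec k}/\big({-i}k\,V_0a^2(\eta)\,e_{\vec k}\big)\to1$ as $k\to\infty$. The modes $\gamma^{\rm BD}_{\vec k}(\eta_0)$ do define a Fock vacuum, and $|{\rm BD},\eta_0\rangle$ is PdS-invariant and Hadamard at $\eta_0$. Moreover: 1. If $\eta_1\ne\eta_0$, then $|{\rm BD},\eta_1\rangle\neq|{\rm BD},\eta_0\rangle$. 2. If $\eta_1\ne\eta_0$, then $|{\rm BD},\eta_1\rangle$ is neither PdS-invariant at $\eta_0$ nor Hadamard at $\eta_0$. There are unique coefficients $\alpha_k,\beta_k$ with $$\gamma^{\rm BD}_{\vec k}(\eta_1)=\alpha_k\,\gamma^{\rm BD}_{\vec k}(\eta_0)+\beta_k\,\gamma^{{\rm BD}\,*}_{-\vec k}(\eta_0)\quad\text{for all }\vec k\ne0;$$ they depend only on $k=|\vec k|$ and satisfy $|\alpha_k|^2-|\beta_k|^2=1$; $\beta_k\neq0$ for every $k>0$; $\beta_k$ is not independent of $k$; and, up to the phase $e^{-ik(\eta_0+\eta_1)}$, $\beta_k$ tends to a nonzero constant as $k\to\infty$ (that is, $e^{ik(\eta_0+\eta_1)}\beta_k\to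 b\neq0$, so $|\beta_k|\to|b|>0$). 3. The classical evolution from $\eta_0$ to $\eta_1$ is well posed, and the induced Schrödinger evolution satisfies $\hat U_{\eta_1,\eta_0}|{\rm BD},\eta_0\rangle=|{\rm BD},\eta_1\rangle$. Consequently, with $\hat A^{(\eta)}_{\vec k}$ the annihilation operator of $\gamma^{\rm BD}_{\vec k}(\eta)$, $\hat X^{(\eta)}_{\vec k}=\frac1{\sqrt2}(\hat A^{(\eta)}_{\vec k}+\hat A^{(\eta)\dagger}_{\vec k})$ and $\hat P^{(\eta)}_{\vec k}=\frac{-i}{\sqrt2}(\hat A^{(\eta)}_{\vec k}-\hat A^{(\eta)\dagger}_{\vec k})$, for every $\vec k\neq0$ there is no squeezing (no normalized real linear combination of $\hat X_{\pm\vec k},\hat P_{\pm\vec k}$ has dispersion below $\frac12$) and no entanglement (the reduced two-mode state is a limit of mixtures of product states) between $\vec k$ and $-\vec k$, neither for $|{\rm BD},\eta_0\rangle$ with respect to the quadratures at $\eta_0$ nor for the evolved state $\hat U_{\eta_1,\eta_0}|{\rm BD},\eta_0\rangle$ with respect to the quadratures at $\eta_1$. -/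

import Mathlib

noncomputable section

namespace PdS

open Filter Topology MeasureTheory
open scoped ComplexConjugate

/-! ## Phase space

Fields are finite superpositions of plane waves `e^{i k·x}` with nonzero wave vector `k ∈ ℝ³`.
An element of the complexified phase space is stored through its Fourier coefficients
`k ↦ (e_k, p_k)` (field and conjugate momentum); `toField` is the corresponding pair of functions
of `x`. -/

abbrev Space := EuclideanSpace ℝ (Fin 3)

/-- Nonzero wave vectors. -/
abbrev Wave := {k : Space // k ≠ 0}

/-- `k ↦ -k`. -/
def waveNeg : Wave ≃ Wave :=
  (Equiv.neg Space).subtypeEquiv fun k => by simp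

instance : Neg Wave := ⟨waveNeg⟩

/-- The plane wave `e^{i k·x}`. -/
def planeWave (k : Wave) (x : Space) : ℂ :=
  Complex.exp (Complex.I * ((inner ℝ k.1 x : ℝ) : ℂ))

/-- The complexified phase space `Γ_ℂ`. -/
abbrev PhaseC := Wave →₀ ℂ × ℂ

/-- The pair `(e(x), p(x))` of functions on `ℝ³` described by the Fourier coefficients. -/
def toField (γ : PhaseC) (x : Space) : ℂ × ℂ :=
  γ.sum fun k v => planeWave k x • v

/-- Complex conjugation of fields, see `toField_conjC`. -/
def conjC (γ : PhaseC) : PhaseC :=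
  (Finsupp.equivMapDomain waveNeg γ).mapRange star (star_zero _)

/-- The Hermitian product `⟨γ, δ⟩ = i ∫ d³x/V₀ (e* p̃ - p* ẽ)`; the plane waves are orthonormal
for the volume average `∫ d³x/V₀`. -/
def bracket (γ δ : PhaseC) : ℂ :=
  Complex.I * γ.sum fun k v => conj v.1 * (δ k).2 - conj v.2 * (δ k).1

theorem waveNeg_waveNeg (k : Wave) : waveNeg (waveNeg k) = k := by
  ext; simp [waveNeg]

theorem conjC_apply (γ : PhaseC) (k : Wave) : conjC γ k = star (γ (-k)) := by
  have : waveNeg.symm k = -k := by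
    rw [Equiv.symm_apply_eq]; exact (waveNeg_waveNeg k).symm
  simp [conjC, Finsupp.equivMapDomain_apply, this]

theorem conjC_conjC (γ : PhaseC) : conjC (conjC γ) = γ := by
  ext1 k
  rw [conjC_apply, conjC_apply, star_star]
  exact congrArg γ (waveNeg_waveNeg k)

theorem conjC_add (γ δ : PhaseC) : conjC (γ + δ) = conjC γ + conjC δ := by
  ext1 k; simp [conjC_apply]

/-- The real phase space `Γ`: real fields. -/
def Phase : Submodule ℝ PhaseC where
  carrier := {γ | conjC γ = γ}
  add_mem' {a b} ha hb := by
    simp only [Set.mem_ofPred_eq] at *; rw [conjC_add, ha, hb]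
  zero_mem' := by
    simp only [Set.mem_ofPred_eq]; ext1 k; simp [conjC_apply]
  smul_mem' c a ha := by
    simp only [Set.mem_ofPred_eq] at *
    nth_rewrite 2 [← ha]
    ext1 k; ext <;> simp [conjC_apply]

/-- The real field `z + z*`. -/
def realPart (z : PhaseC) : Phase :=
  ⟨z + conjC z, by
    change conjC (z + conjC z) = z + conjC z
    rw [conjC_add, conjC_conjC, add_comm]⟩

/-- The symplectic form `Ω(f, g) = ∫ d³x/V₀ (f_φ g_π - f_π g_φ)` of real fields, i.e.
`⟨f, g⟩ = i Ω(f, g)`. -/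
def symp (f g : Phase) : ℝ := (-Complex.I * bracket f.1 g.1).re

/-! ### Spatial transformations -/

/-- Translation, `f ↦ f(x + a)`, see `toField_translateC`. -/
def translateC (a : Space) (γ : PhaseC) : PhaseC :=
  Finsupp.onFinset γ.support (fun k => planeWave k a • γ k) fun k hk => by
    rw [Finsupp.mem_support_iff]; intro h; simp [h] at hk

/-- The action of a linear isometry on wave vectors. -/
def waveRot (R : Space ≃ₗᵢ[ℝ] Space) : Wave ≃ Wave :=
  R.toEquiv.subtypeEquiv fun k => by simp

/-- Rotation, `f ↦ f(R x)`, see `toField_rotateC`. -/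
def rotateC (R : Space ≃ₗᵢ[ℝ] Space) (γ : PhaseC) : PhaseC :=
  Finsupp.equivMapDomain (waveRot R.symm) γ

/-- Multiplication of wave vectors by `e^r`. -/
def waveScale (r : ℝ) : Wave ≃ Wave where
  toFun k := ⟨Real.exp r • k.1, smul_ne_zero (Real.exp_ne_zero r) k.2⟩
  invFun k := ⟨Real.exp (-r) • k.1, smul_ne_zero (Real.exp_ne_zero _) k.2⟩
  left_inv k := by ext1; simp [smul_smul, ← Real.exp_add]
  right_inv k := by ext1; simp [smul_smul, ← Real.exp_add]

/-- The contraction `x ↦ s x`, `s = e^r`, on initial data: `(e, p) ↦ (e(s x), s³ p(s x))`, up to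
the overall factor `s^{-3/2}`, which accounts for the change of the normalization volume and makes
the map preserve the product `⟨·, ·⟩`; see `toField_dilateC`. -/
def dilateC (r : ℝ) (γ : PhaseC) : PhaseC :=
  (Finsupp.equivMapDomain (waveScale r) γ).mapRange
    (fun v => ((Real.exp (-(3 / 2) * r) : ℂ) * v.1, (Real.exp (3 / 2 * r) : ℂ) * v.2)) (by simp)

theorem planeWave_neg (k : Wave) (x : Space) : planeWave (-k) x = conj (planeWave k x) := by
  have : (-k : Wave).1 = -k.1 := rfl
  simp [planeWave, this, ← Complex.exp_conj]

theorem planeWave_rot (R : Space ≃ₗᵢ[ℝ] Space) (k : Wave) (x : Space) :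
    planeWave (waveRot R.symm k) x = planeWave k (R x) := by
  have : (waveRot R.symm k).1 = R.symm k.1 := rfl
  rw [planeWave, planeWave, this, ← R.inner_map_map, R.apply_symm_apply]

theorem planeWave_scale (r : ℝ) (k : Wave) (x : Space) :
    planeWave (waveScale r k) x = planeWave k (Real.exp r • x) := by
  have : (waveScale r k).1 = Real.exp r • k.1 := rfl
  rw [planeWave, planeWave, this, real_inner_smul_left, real_inner_smul_right]

theorem planeWave_add (k : Wave) (x a : Space) :
    planeWave k (x + a) = planeWave k x * planeWave k a := by
  simp [planeWave, inner_add_right, mul_add, Complex.exp_add]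

theorem sum_equivMapDomain (e : Wave ≃ Wave) (γ : PhaseC) (g : Wave → ℂ × ℂ → ℂ × ℂ) :
    (Finsupp.equivMapDomain e γ).sum g = γ.sum fun k v => g (e k) v := by
  rw [Finsupp.equivMapDomain_eq_mapDomain, Finsupp.sum_mapDomain_index_inj e.injective]

theorem toField_conjC (γ : PhaseC) (x : Space) : toField (conjC γ) x = star (toField γ x) := by
  rw [toField, conjC, Finsupp.sum_mapRange_index (by simp), sum_equivMapDomain,
    toField, Finsupp.sum, Finsupp.sum, star_sum]
  refine Finset.sum_congr rfl fun k _ => ?_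
  have := planeWave_neg k x
  change planeWave (waveNeg k) x = _ at this
  rw [this]; ext <;> simp

theorem toField_translateC (a : Space) (γ : PhaseC) (x : Space) :
    toField (translateC a γ) x = toField γ (x + a) := by
  rw [toField, translateC, Finsupp.onFinset_sum _ (by simp), toField, Finsupp.sum]
  refine Finset.sum_congr rfl fun k _ => ?_
  rw [planeWave_add, smul_smul]

theorem toField_rotateC (R : Space ≃ₗᵢ[ℝ] Space) (γ : PhaseC) (x : Space) :
    toField (rotateC R γ) x = toField γ (R x) := by
  rw [toField, rotateC, sum_equivMapDomain, toField]
  simp only [planeWave_rot]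

theorem toField_dilateC (r : ℝ) (γ : PhaseC) (x : Space) :
    toField (dilateC r γ) x =
      ((Real.exp (-(3 / 2) * r) : ℂ) * (toField γ (Real.exp r • x)).1,
        (Real.exp (3 / 2 * r) : ℂ) * (toField γ (Real.exp r • x)).2) := by
  rw [toField, dilateC, Finsupp.sum_mapRange_index (by simp), sum_equivMapDomain,
    toField]
  simp only [planeWave_scale, Finsupp.sum]
  ext
  · simp only [Prod.fst_sum, Prod.smul_fst, smul_eq_mul, Finset.mul_sum]
    exact Finset.sum_congr rfl fun k _ => by ring
  · simp only [Prod.snd_sum, Prod.smul_snd, smul_eq_mul, Finset.mul_sum]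
    exact Finset.sum_congr rfl fun k _ => by ring

theorem conjC_translateC (a : Space) (γ : PhaseC) :
    conjC (translateC a γ) = translateC a (conjC γ) := by
  ext1 k
  rw [conjC_apply]
  simp only [translateC, Finsupp.onFinset_apply, conjC_apply, planeWave_neg]
  ext <;> simp

theorem conjC_rotateC (R : Space ≃ₗᵢ[ℝ] Space) (γ : PhaseC) :
    conjC (rotateC R γ) = rotateC R (conjC γ) := by
  ext1 k
  rw [conjC_apply]
  simp only [rotateC, Finsupp.equivMapDomain_apply, conjC_apply]
  congr 2
  rw [Equiv.symm_apply_eq]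
  ext1
  change -k.1 = R.symm (-((waveRot R.symm).symm k).1)
  rw [map_neg]
  congr 1
  exact congrArg Subtype.val ((waveRot R.symm).apply_symm_apply k).symm

theorem conjC_dilateC (r : ℝ) (γ : PhaseC) :
    conjC (dilateC r γ) = dilateC r (conjC γ) := by
  ext1 k
  have h : (waveScale r).symm (-k) = -((waveScale r).symm k) := by
    ext1
    change Real.exp (-r) • (-k.1) = -(Real.exp (-r) • k.1)
    rw [smul_neg]
  rw [conjC_apply]
  simp only [dilateC, Finsupp.mapRange_apply, Finsupp.equivMapDomain_apply, conjC_apply, h]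
  ext <;> simp [-Complex.ofReal_exp]

def translate (a : Space) (f : Phase) : Phase :=
  ⟨translateC a f.1, (conjC_translateC a f.1).trans (congrArg _ f.2)⟩

def rotate (R : Space ≃ₗᵢ[ℝ] Space) (f : Phase) : Phase :=
  ⟨rotateC R f.1, (conjC_rotateC R f.1).trans (congrArg _ f.2)⟩

def dilate (r : ℝ) (f : Phase) : Phase :=
  ⟨dilateC r f.1, (conjC_dilateC r f.1).trans (congrArg _ f.2)⟩

/-! ## Quantum states

A functional `χ` on a real symplectic vector space `(V, Ω)` is the characteristic functional
`χ(f) = ⟨W(f)⟩` of a state on the Weyl (CCR) algebra, where `W(f) = exp(i O_f)`,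
`[O_f, O_g] = i Ω(f, g)`, and thus `W(f) W(g) = exp(-(i/2) Ω(f, g)) W(f + g)`.  It is a state iff
it is normalized and `⟨A† A⟩ ≥ 0` for all `A = ∑ c_j W(f_j)`. -/

/-- `χ` is the characteristic functional of a state on the Weyl algebra over `(V, Ω)`. -/
def IsState {V : Type*} [AddCommGroup V] (Ω : V → V → ℝ) (χ : V → ℂ) : Prop :=
  χ 0 = 1 ∧ ∀ (n : ℕ) (f : Fin n → V) (c : Fin n → ℂ),
    0 ≤ (∑ i, ∑ j, conj (c i) * c j *
          (Complex.exp (Complex.I / 2 * (Ω (f i) (f j) : ℂ)) * χ (f j - f i))).re ∧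
    (∑ i, ∑ j, conj (c i) * c j *
          (Complex.exp (Complex.I / 2 * (Ω (f i) (f j) : ℂ)) * χ (f j - f i))).im = 0

/-- An orthonormal basis `γ_k` of a positive-norm subspace `Γ₊` with `Γ_ℂ = Γ₊ ⊕ Γ₊*`, the two
summands being orthogonal. -/
def IsFockBasis (γ : Wave → PhaseC) : Prop :=
  (∀ k, bracket (γ k) (γ k) = 1) ∧
  (∀ k k', k ≠ k' → bracket (γ k) (γ k') = 0) ∧
  (∀ k k', bracket (γ k) (conjC (γ k')) = 0) ∧
  Submodule.span ℂ (Set.range γ ∪ Set.range fun k => conjC (γ k)) = ⊤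

/-- The Fock vacuum of the modes `γ_k`: the Gaussian state with zero mean and covariance
`σ^{ij}(x, x') = ∑_k γ_k^i(x) γ_k^j(x')* + γ_k^j(x) γ_k^i(x')*`, i.e.
`⟨O_f²⟩ = σ(f, f)/2 = ∑_k |⟨γ_k, f⟩|²` for the observable `O_f = Ω(f, ·)`. -/
def fockVacuum (γ : Wave → PhaseC) (f : Phase) : ℂ :=
  Complex.exp (-((∑ᶠ k, ‖bracket (γ k) f.1‖ ^ 2 : ℝ) : ℂ) / 2)

/-! ## The scalar field on the Poincaré patch of de Sitter spacetime -/

/-- Hubble rate `H`, mass `m`, curvature coupling `ξ` and normalization volume `V₀`. -/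
structure Params where
  H : ℝ
  m : ℝ
  ξ : ℝ
  V₀ : ℝ
  H_pos : 0 < H
  V₀_pos : 0 < V₀

/-- The scale factor `a(η) = -1/(H η)`. -/
def scaleFactor (p : Params) (η : ℝ) : ℝ := -1 / (p.H * η)

/-- The Ricci scalar `R = 6 a''/a³`. -/
def ricci (p : Params) (η : ℝ) : ℝ :=
  6 * deriv (deriv (scaleFactor p)) η / scaleFactor p η ^ 3

/-- Solutions `η ↦ (Φ, Π)(η)`, `η < 0`, of Hamilton's equations `Φ' = Π/(V₀ a²)`,
`Π' = V₀ a² (∇²Φ - a² (m² + ξ R) Φ)`, i.e. of `(□ - m² - ξ R) Φ = 0` in the metric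
`a² (-dη² + dx²)`, in Fourier space. -/
def IsTrajectory (p : Params) (c : ℝ → Phase) : Prop :=
  ∀ η < 0, ∀ k : Wave,
    HasDerivAt (fun t => ((c t).1 k).1)
      (((c η).1 k).2 / ((p.V₀ * scaleFactor p η ^ 2 : ℝ) : ℂ)) η ∧
    HasDerivAt (fun t => ((c t).1 k).2)
      (-((p.V₀ * scaleFactor p η ^ 2 *
          (‖k.1‖ ^ 2 + scaleFactor p η ^ 2 * (p.m ^ 2 + p.ξ * ricci p η)) : ℝ) : ℂ)
        * ((c η).1 k).1) η

/-- The classical dynamics takes the initial data `f` at time `η₀` to `g` at time `η₁`. -/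
def EvolvesTo (p : Params) (η₀ η₁ : ℝ) (f g : Phase) : Prop :=
  ∃ c, IsTrajectory p c ∧ c η₀ = f ∧ c η₁ = g

/-- The classical evolution map `E` from time `η₀` to time `η₁`. -/
def evolve (p : Params) (η₀ η₁ : ℝ) (f : Phase) : Phase :=
  Classical.epsilon (EvolvesTo p η₀ η₁ f)

/-- Schrödinger evolution `U_{η₁,η₀}` of states.  The dynamics is linear, so
`U† R U = E R` for the field operators `R = (Φ, Π)`, hence `U† O_f U = O_{E⁻¹ f}`. -/
def evolveState (p : Params) (η₀ η₁ : ℝ) (χ : Phase → ℂ) : Phase → ℂ :=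
  fun f => χ (evolve p η₁ η₀ f)

/-! ### Bunch–Davies modes and vacua -/

/-- The Hankel function `H^{(1)}_ν(x)`, `x > 0`, `Re ν > -1/2`, by Hankel's integral. -/
def hankel1 (ν : ℂ) (x : ℝ) : ℂ :=
  (Real.sqrt (2 / (Real.pi * x)) : ℂ)
    * Complex.exp (Complex.I * (x - ν * Real.pi / 2 - Real.pi / 4)) / Complex.Gamma (ν + 1 / 2)
    * ∫ t in Set.Ioi (0 : ℝ), Complex.exp (-t) * (t : ℂ) ^ (ν - 1 / 2)
        * (1 + Complex.I * t / (2 * x)) ^ (ν - 1 / 2)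

/-- The index `μ`, `μ² = 9/4 - m²/H² - 12 ξ`, with `μ ≥ 0` or `μ ∈ i (0, ∞)`. -/
def index (p : Params) : ℂ :=
  ((9 / 4 - p.m ^ 2 / p.H ^ 2 - 12 * p.ξ : ℝ) : ℂ) ^ (1 / 2 : ℂ)

/-- The amplitude `e_k^{BD}(η)` for `|k| = κ`.  The factor `exp(-π Im μ / 2)` is `1` for real `μ`
and normalizes the mode for imaginary `μ`. -/
def bdAmp (p : Params) (κ η : ℝ) : ℂ :=
  (Real.sqrt (-(Real.pi * η) / (p.V₀ * 4 * scaleFactor p η ^ 2)) : ℂ)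
    * (Real.exp (-(Real.pi * (index p).im) / 2) : ℂ) * hankel1 (index p) (-(κ * η))

/-- The phase space element `γ_k^{BD}(η)`. -/
def bdMode (p : Params) (η : ℝ) (k : Wave) : PhaseC :=
  Finsupp.single k
    (bdAmp p ‖k.1‖ η, ((p.V₀ * scaleFactor p η ^ 2 : ℝ) : ℂ) * deriv (bdAmp p ‖k.1‖) η)

/-- The Bunch–Davies vacuum `|BD, η⟩`. -/
def BD (p : Params) (η : ℝ) : Phase → ℂ := fockVacuum (bdMode p η)

/-! ### Invariance and the Hadamard condition at a given time -/

/-- The flow, through parameter `l`, of the Killing field `K = -H (η ∂_η + x·∂_x)` started at time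
`η₀`: the time translation `η₀ → e^{-H l} η₀` combined with the contraction `x → e^{-H l} x`. -/
def killingFlow (p : Params) (η₀ l : ℝ) (f : Phase) : Phase :=
  dilate (-(p.H * l)) (evolve p η₀ (Real.exp (-(p.H * l)) * η₀) f)

/-- Invariance at time `η` under translations, rotations and the flow of `K`. -/
def PdSInvariantAt (p : Params) (η : ℝ) (χ : Phase → ℂ) : Prop :=
  (∀ a f, χ (translate a f) = χ f) ∧
  (∀ R : Space ≃ₗᵢ[ℝ] Space, LinearMap.det (R.toLinearEquiv : Space →ₗ[ℝ] Space) = 1 →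
    ∀ f, χ (rotate R f) = χ f) ∧
  (∀ l f, χ (killingFlow p η l f) = χ f)

/-- The Hadamard condition at time `η` on translation invariant Fock vacua: the modes
`(e_k, p_k) e^{i k·x}` that define the vacuum approach positive-frequency modes for `|k| → ∞`,
`e_k' ≃ -i |k| e_k`, where `p_k = V₀ a² e_k'`. -/
def HadamardAt (p : Params) (η : ℝ) (χ : Phase → ℂ) : Prop :=
  ∃ v : Wave → ℂ × ℂ, IsFockBasis (fun k => Finsupp.single k (v k)) ∧
    χ = fockVacuum (fun k => Finsupp.single k (v k)) ∧
    Tendsto (fun k : Wave =>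
        (v k).2 / (-Complex.I * ((‖k.1‖ * (p.V₀ * scaleFactor p η ^ 2) : ℝ) : ℂ) * (v k).1))
      (comap (fun k : Wave => ‖k.1‖) atTop) (𝓝 1)

/-! ### Quadratures, squeezing and entanglement -/

/-- The phase space element `f` with `O_f = X_k^{(η)} = (A_k + A_k†)/√2`, where `A_k = ⟨γ_k, R⟩` is
the annihilation operator of the Bunch–Davies mode `γ_k = γ_k^{BD}(η)`.
Note that `O_f = -i ⟨f, R⟩ = -i (⟨z, R⟩ - ⟨z, R⟩†)` for `f = z + z*`. -/
def quadX (p : Params) (η : ℝ) (k : Wave) : Phase :=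
  realPart ((-Complex.I / (Real.sqrt 2 : ℂ)) • bdMode p η k)

/-- The phase space element `f` with `O_f = P_k^{(η)} = -i (A_k - A_k†)/√2`. -/
def quadP (p : Params) (η : ℝ) (k : Wave) : Phase :=
  realPart ((1 / (Real.sqrt 2 : ℂ)) • bdMode p η k)

/-- The quadrature `a₁ X_k + a₂ P_k`. -/
def quad (p : Params) (η : ℝ) (k : Wave) (a : ℝ × ℝ) : Phase :=
  a.1 • quadX p η k + a.2 • quadP p η k

/-- The mean `⟨O_f⟩`, from `χ(t f) = ⟨exp(i t O_f)⟩`. -/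
def mean (χ : Phase → ℂ) (f : Phase) : ℝ :=
  (-Complex.I * deriv (fun t : ℝ => χ (t • f)) 0).re

/-- The second moment `⟨O_f²⟩`. -/
def secondMoment (χ : Phase → ℂ) (f : Phase) : ℝ :=
  (-iteratedDeriv 2 (fun t : ℝ => χ (t • f)) 0).re

/-- The dispersion `ΔO_f²`. -/
def dispersion (χ : Phase → ℂ) (f : Phase) : ℝ := secondMoment χ f - mean χ f ^ 2

/-- Squeezing relative to the quadrature pairs `(X_k, P_k)` and `(X_{-k}, P_{-k})` at time `η`:
some normalized linear combination of the four quadratures (for instance one of them) has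
dispersion below `1/2`. -/
def TwoModeSqueezed (p : Params) (η : ℝ) (k : Wave) (χ : Phase → ℂ) : Prop :=
  ∃ a b : ℝ × ℝ, a.1 ^ 2 + a.2 ^ 2 + b.1 ^ 2 + b.2 ^ 2 = 1 ∧
    dispersion χ (quad p η k a + quad p η (-k) b) < 1 / 2

/-- The symplectic form of one mode. -/
def oneModeSymp (a b : ℝ × ℝ) : ℝ := a.1 * b.2 - a.2 * b.1

/-- Entanglement between the modes `(X_k, P_k)` and `(X_{-k}, P_{-k})` at time `η`: the reduced
state of the two modes is not a limit of convex combinations of product states. -/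
def Entangled (p : Params) (η : ℝ) (k : Wave) (χ : Phase → ℂ) : Prop :=
  (fun ab : (ℝ × ℝ) × (ℝ × ℝ) => χ (quad p η k ab.1 + quad p η (-k) ab.2)) ∉
    closure (convexHull ℝ {G : (ℝ × ℝ) × (ℝ × ℝ) → ℂ |
      ∃ χA χB : ℝ × ℝ → ℂ, IsState oneModeSymp χA ∧ Continuous χA ∧
        IsState oneModeSymp χB ∧ Continuous χB ∧ G = fun ab => χA ab.1 * χB ab.2})

end PdS

end

/-! All modes come from one function. At wave number κ and time η the Bunch–Davies mode depends, up
to a constant and powers of κ, only on x = -κη: its amplitude is x y(x) and its momentum (x y)'/x²,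
where y = e^{ix} f₀(1/x) solves y'' + (1 + δ/x²) y = 0 with δ = 1/4 - μ². Hankel's integral shows
that f₀ is smooth up to and across w = 1/x = 0 with f₀(0) = 1; the Wronskian and all
short-wavelength limits are read off there (`hankelJost`, `bdAmp_eq`, `bdMom_eq`).

The coefficients ⟨γ_k(η), f⟩ are conserved along classical trajectories, and |BD, η⟩ is the standard
Gaussian in its own coefficients. So evolution maps one vacuum to the other, the Killing flow merely
permutes coefficients (by the dependence on κη), and the state factorizes over k and -k with
dispersion 1/2 in the quadratures of its own time.

The vacua at different times are compared through β_k. The momentum carries the factor a², which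
differs between the two times, so at large k the ratio p/e of the modes at η₁ misses the
positive-frequency value at η₀ by η₀²/η₁²: the Hadamard condition fails. The asymptotic phases
e^{-ik(η₀+η₁)} of β and e^{-2ikη₀} of ᾱβ prevent both from being independent of k; the second
contradicts dilation invariance.

The hard point is β_k ≠ 0 at every k, not just asymptotically. If β_k = 0, then p/e takes the same
value at x₀ and x₁. With N = x²|y|² as a function of s = x², the imaginary part says that N agrees
at the two points, the real part that (dN/ds)/x agrees. If N is strictly convex or strictly concave
in s, Rolle gives dN/ds opposite signs at the two points, a contradiction
(`sq_mul_n_slope_injective`). The sign of d²N/ds² is that of `conv`. This function satisfies the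
third-order equation for products of solutions with an extra term -16 conv/x, and behaves like
3δ(δ+2)/x⁴ at infinity; a comparison with the square of a real solution carries that sign down to
all x > 0 (`conv_sign`). For δ(δ+2) = 0, dN/ds is constantly 1, which also excludes Rolle's zero. -/

noncomputable section

namespace PdS

open Filter Topology MeasureTheory
open scoped ComplexConjugate

/-! ## Hankel's integral -/

/-- The integrand `e^{-t} t^a (1 + i t w / 2)^b` of Hankel's integral. -/
def hankelKernel (a b : ℂ) (w t : ℝ) : ℂ :=
  Complex.exp (-t) * (t : ℂ) ^ a * (1 + Complex.I * t * w / 2) ^ b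

/-- Hankel's integral `∫₀^∞ e^{-t} t^a (1 + i t w / 2)^b dt`. -/
def hankelIntegral (a b : ℂ) (w : ℝ) : ℂ := ∫ t in Set.Ioi (0 : ℝ), hankelKernel a b w t

theorem base_re (t w : ℝ) : (1 + Complex.I * t * w / 2 : ℂ).re = 1 := by
  have : (1 + Complex.I * t * w / 2 : ℂ) = ⟨1, t * w / 2⟩ := by
    apply Complex.ext <;> simp
  rw [this]

theorem base_mem_slitPlane (t w : ℝ) : (1 + Complex.I * t * w / 2 : ℂ) ∈ Complex.slitPlane :=
  Or.inl (by rw [base_re]; exact one_pos)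

theorem base_ne_zero (t w : ℝ) : (1 + Complex.I * t * w / 2 : ℂ) ≠ 0 :=
  Complex.slitPlane_ne_zero (base_mem_slitPlane t w)

theorem one_le_norm_base (t w : ℝ) : 1 ≤ ‖(1 + Complex.I * t * w / 2 : ℂ)‖ := by
  have h := Complex.re_le_norm (1 + Complex.I * t * w / 2 : ℂ)
  rwa [base_re] at h

theorem norm_base_le {t w W : ℝ} (ht : 0 ≤ t) (hw : |w| ≤ W) :
    ‖(1 + Complex.I * t * w / 2 : ℂ)‖ ≤ 1 + W * t := by
  have hW : 0 ≤ W := (abs_nonneg w).trans hw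
  refine (norm_add_le _ _).trans ?_
  simp only [norm_one, norm_div, norm_mul, Complex.norm_I, one_mul, Complex.norm_real,
    Real.norm_eq_abs, Complex.norm_ofNat, abs_of_nonneg ht]
  nlinarith [mul_nonneg hW ht, mul_le_mul_of_nonneg_left hw ht]

/-- The argument of `u` is at most π in modulus, which bounds the contribution of the imaginary
exponent. An integer exponent `m` suffices because `‖u‖ ≥ 1`, and it lets the majorant be expanded
binomially into Gamma integrands. -/
theorem norm_cpow_le_pow {u b : ℂ} {r : ℝ} {m : ℕ} (h1 : 1 ≤ ‖u‖) (hr : ‖u‖ ≤ r)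
    (hm : |b.re| ≤ m) : ‖u ^ b‖ ≤ Real.exp (Real.pi * |b.im|) * r ^ m := by
  refine (Complex.norm_cpow_le u b).trans ?_
  rw [div_eq_inv_mul, ← Real.exp_neg]
  refine mul_le_mul ?_ ?_ (by positivity) (by positivity)
  · refine Real.exp_le_exp.2 ((neg_le_abs _).trans ?_)
    rw [abs_mul]
    exact mul_le_mul_of_nonneg_right (Complex.abs_arg_le_pi u) (abs_nonneg _)
  · calc ‖u‖ ^ b.re ≤ ‖u‖ ^ (m : ℝ) :=
          Real.rpow_le_rpow_of_exponent_le h1 ((le_abs_self _).trans hm)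
      _ = ‖u‖ ^ m := Real.rpow_natCast _ _
      _ ≤ r ^ m := pow_le_pow_left₀ (norm_nonneg _) hr m

theorem norm_hankelKernel_le {a b : ℂ} {t w W : ℝ} {m : ℕ} (ht : 0 < t) (hw : |w| ≤ W)
    (hm : |b.re| ≤ m) :
    ‖hankelKernel a b w t‖ ≤
      Real.exp (Real.pi * |b.im|) * (Real.exp (-t) * t ^ a.re * (1 + W * t) ^ m) := by
  have h := norm_cpow_le_pow (one_le_norm_base t w) (norm_base_le ht.le hw) hm
  rw [hankelKernel, norm_mul, norm_mul, Complex.norm_cpow_eq_rpow_re_of_pos ht,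
    ← Complex.ofReal_neg, ← Complex.ofReal_exp, Complex.norm_real, Real.norm_eq_abs, Real.abs_exp]
  calc _ ≤ Real.exp (-t) * t ^ a.re * (Real.exp (Real.pi * |b.im|) * (1 + W * t) ^ m) :=
        mul_le_mul_of_nonneg_left h (by positivity)
    _ = _ := by ring

theorem integrableOn_exp_rpow_mul_pow (W : ℝ) (m : ℕ) :
    ∀ {s : ℝ}, -1 < s →
      IntegrableOn (fun t : ℝ => Real.exp (-t) * t ^ s * (1 + W * t) ^ m) (Set.Ioi 0) := by
  induction m with
  | zero =>
    intro s hs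
    simpa using Real.GammaIntegral_convergent (s := s + 1) (by linarith)
  | succ m ih =>
    intro s hs
    have h := (ih hs).add ((ih (s := s + 1) (by linarith)).const_mul W)
    refine h.congr_fun (fun t ht => ?_) measurableSet_Ioi
    have ht : 0 < t := ht
    simp only [Pi.add_apply]
    rw [Real.rpow_add_one ht.ne']
    ring

theorem continuousOn_hankelKernel (a b : ℂ) (w : ℝ) :
    ContinuousOn (hankelKernel a b w) (Set.Ioi 0) := by
  intro t ht
  have h1 : ContinuousAt (fun t : ℝ => (t : ℂ) ^ a) t :=
    Complex.continuous_ofReal.continuousAt.cpow continuousAt_const (Or.inl (by simpa using ht))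
  have h2 : ContinuousAt (fun t : ℝ => (1 + Complex.I * t * w / 2 : ℂ) ^ b) t :=
    ContinuousAt.cpow (by fun_prop) continuousAt_const (base_mem_slitPlane t w)
  have h3 : ContinuousAt (fun t : ℝ => Complex.exp (-t)) t := by fun_prop
  exact ((h3.mul h1).mul h2).continuousWithinAt

theorem integrableOn_hankelKernel {a : ℂ} (b : ℂ) (ha : -1 < a.re) (w : ℝ) :
    IntegrableOn (hankelKernel a b w) (Set.Ioi 0) := by
  obtain ⟨m, hm⟩ := exists_nat_ge |b.re|
  refine Integrable.mono' ((integrableOn_exp_rpow_mul_pow |w| m ha).const_mul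
    (Real.exp (Real.pi * |b.im|)))
    ((continuousOn_hankelKernel a b w).aestronglyMeasurable measurableSet_Ioi) ?_
  exact (ae_restrict_iff' measurableSet_Ioi).2 (ae_of_all _ fun t ht =>
    norm_hankelKernel_le ht le_rfl hm)

/-! ### Differentiation of Hankel's integral in w and its differential equation -/

theorem hasDerivAt_base_cpow_w (b : ℂ) (w t : ℝ) :
    HasDerivAt (fun w : ℝ => (1 + Complex.I * t * w / 2 : ℂ) ^ b)
      (b * (1 + Complex.I * t * w / 2 : ℂ) ^ (b - 1) * (Complex.I * t / 2)) w := by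
  have h : HasDerivAt (fun z : ℂ => 1 + Complex.I * t * z / 2) (Complex.I * t / 2) w := by
    simpa using (((hasDerivAt_id (w : ℂ)).const_mul (Complex.I * t)).div_const 2).const_add 1
  exact (h.cpow_const (base_mem_slitPlane t w)).comp_ofReal

theorem hasDerivAt_base_cpow_t (b : ℂ) (w t : ℝ) :
    HasDerivAt (fun t : ℝ => (1 + Complex.I * t * w / 2 : ℂ) ^ b)
      (b * (1 + Complex.I * t * w / 2 : ℂ) ^ (b - 1) * (Complex.I * w / 2)) t := by
  have h := hasDerivAt_base_cpow_w b t w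
  have e : ∀ t : ℝ, (1 + Complex.I * w * t / 2 : ℂ) = 1 + Complex.I * t * w / 2 := fun t => by ring
  simpa only [e] using h

/-- Differentiation under the integral, dominated on the unit ball around `w`. The exponents shift
from (a, b) to (a + 1, b - 1), so the result can be iterated. It holds at every real `w`, in
particular at w = 0, which corresponds to x = ∞. -/
theorem hasDerivAt_hankelIntegral {a : ℂ} (b : ℂ) (ha : -1 < a.re) (w : ℝ) :
    HasDerivAt (hankelIntegral a b)
      (Complex.I * b / 2 * hankelIntegral (a + 1) (b - 1) w) w := by
  obtain ⟨m, hm⟩ := exists_nat_ge |(b - 1).re|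
  have ha1 : -1 < (a + 1).re := by simp; linarith
  have key := (hasDerivAt_integral_of_dominated_loc_of_deriv_le (μ := volume.restrict (Set.Ioi 0))
    (F := fun w t => hankelKernel a b w t)
    (F' := fun w t => Complex.I * b / 2 * hankelKernel (a + 1) (b - 1) w t)
    (x₀ := w) (s := Metric.ball w 1)
    (bound := fun t => ‖Complex.I * b / 2‖ * (Real.exp (Real.pi * |(b - 1).im|) *
      (Real.exp (-t) * t ^ (a + 1).re * (1 + (|w| + 1) * t) ^ m)))
    (Metric.ball_mem_nhds w one_pos)
    (Eventually.of_forall fun v =>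
      (continuousOn_hankelKernel a b v).aestronglyMeasurable measurableSet_Ioi)
    (integrableOn_hankelKernel b ha w)
    ((integrableOn_hankelKernel (b - 1) ha1 w).const_mul _).aestronglyMeasurable
    ((ae_restrict_iff' measurableSet_Ioi).2 (ae_of_all _ fun t ht v hv => by
      rw [norm_mul]
      refine mul_le_mul_of_nonneg_left (norm_hankelKernel_le ht ?_ hm) (norm_nonneg _)
      have h1 : |v - w| < 1 := by simpa [Real.dist_eq] using hv
      have h2 := abs_add_le (v - w) w
      rw [sub_add_cancel] at h2
      linarith))
    (((integrableOn_exp_rpow_mul_pow _ m ha1).const_mul _).const_mul _)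
    ((ae_restrict_iff' measurableSet_Ioi).2 (ae_of_all _ fun t ht v _ => by
      have ht : (t : ℂ) ≠ 0 := by exact_mod_cast (ne_of_gt (show (0 : ℝ) < t from ht))
      have h := (hasDerivAt_base_cpow_w b v t).const_mul (Complex.exp (-t) * (t : ℂ) ^ a)
      refine h.congr_deriv ?_
      simp only [hankelKernel]
      rw [Complex.cpow_add _ _ ht, Complex.cpow_one]
      ring))).2
  rw [integral_const_mul] at key
  exact key

theorem hankelIntegral_zero {a : ℂ} (b : ℂ) (ha : -1 < a.re) :
    hankelIntegral a b 0 = Complex.Gamma (a + 1) := by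
  rw [Complex.Gamma_eq_integral (by simp; linarith), Complex.GammaIntegral, hankelIntegral]
  refine setIntegral_congr_fun measurableSet_Ioi fun t _ => ?_
  simp [hankelKernel]

theorem tendsto_exp_neg_mul_rpow (s : ℝ) (W : ℝ) (m : ℕ) :
    Tendsto (fun t : ℝ => Real.exp (-t) * t ^ s * (1 + W * t) ^ m) atTop (𝓝 0) := by
  induction m generalizing s with
  | zero =>
    have h := tendsto_rpow_mul_exp_neg_mul_atTop_nhds_zero s 1 one_pos
    refine h.congr fun t => ?_
    rw [pow_zero, mul_one, neg_one_mul, mul_comm]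
  | succ m ih =>
    have h := (ih s).add ((ih (s + 1)).const_mul W)
    rw [mul_zero, add_zero] at h
    refine h.congr' ?_
    filter_upwards [eventually_gt_atTop 0] with t ht
    rw [Real.rpow_add_one ht.ne']
    ring

/-- The differential equation of Hankel's integral, in integrated form. -/
theorem hankelIntegral_relation {a : ℂ} (ha : -1 < a.re) (w : ℝ) :
    (w : ℂ) ^ 2 * (-((a - 1) / 4) * hankelIntegral (a + 2) (a - 2) w)
      + (Complex.I * w + 1) * hankelIntegral (a + 1) (a - 1) w
      - (a + 1) * hankelIntegral a a w = 0 := by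
  have ha1 : -1 < (a + 1).re := by simp; linarith
  have ha2 : -1 < (a + 2).re := by simp; linarith
  have i0 := integrableOn_hankelKernel a ha w
  have i1 := integrableOn_hankelKernel (a - 1) ha1 w
  have i2 := integrableOn_hankelKernel (a - 2) ha2 w
  set g : ℝ → ℂ := fun t => (w : ℂ) ^ 2 * (-((a - 1) / 4)) * hankelKernel (a + 2) (a - 2) w t
      + (Complex.I * w + 1) * hankelKernel (a + 1) (a - 1) w t
      - (a + 1) * hankelKernel a a w t with hg
  have ig : IntegrableOn g (Set.Ioi 0) :=
    ((i2.const_mul _).add (i1.const_mul _)).sub (i0.const_mul _)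
  have hint : ∫ t in Set.Ioi (0 : ℝ), g t = (w : ℂ) ^ 2 * (-((a - 1) / 4)) *
      hankelIntegral (a + 2) (a - 2) w + (Complex.I * w + 1) * hankelIntegral (a + 1) (a - 1) w
      - (a + 1) * hankelIntegral a a w := by
    have e := integral_sub ((i2.const_mul ((w : ℂ) ^ 2 * (-((a - 1) / 4)))).add
      (i1.const_mul (Complex.I * w + 1))) (i0.const_mul (a + 1))
    have e' := integral_add (i2.const_mul ((w : ℂ) ^ 2 * (-((a - 1) / 4))))
      (i1.const_mul (Complex.I * w + 1))
    simp only [Pi.add_apply] at e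
    rw [e', integral_const_mul, integral_const_mul, integral_const_mul] at e
    exact e
  have hz : a + 1 ≠ 0 := fun h => by
    have := congrArg Complex.re h
    simp only [Complex.add_re, Complex.one_re, Complex.zero_re] at this
    linarith
  have hcont : ContinuousWithinAt (fun t => -hankelKernel (a + 1) (a - 1) w t) (Set.Ici 0) 0 := by
    have h1 : ContinuousAt (fun t : ℝ => (t : ℂ) ^ (a + 1)) 0 :=
      Complex.continuousAt_ofReal_cpow_const _ _ (Or.inl (by simp; linarith))
    have h2 : ContinuousAt (fun t : ℝ => (1 + Complex.I * t * w / 2 : ℂ) ^ (a - 1)) 0 :=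
      ContinuousAt.cpow (by fun_prop) continuousAt_const (base_mem_slitPlane 0 w)
    have h3 : ContinuousAt (fun t : ℝ => Complex.exp (-t)) 0 := by fun_prop
    exact (((h3.mul h1).mul h2).neg).continuousWithinAt
  -- The integrand `g` is an exact t-derivative. Its primitive vanishes at t = 0 because Re (a + 1)
  -- > 0, and at infinity by exponential decay, so the integral of `g` is zero.
  have hder : ∀ t ∈ Set.Ioi (0 : ℝ),
      HasDerivAt (fun t => -hankelKernel (a + 1) (a - 1) w t) (g t) t := by
    intro t ht
    have ht : 0 < t := ht
    have htc : (t : ℂ) ≠ 0 := by exact_mod_cast ht.ne'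
    have h1 : HasDerivAt (fun t : ℝ => (t : ℂ) ^ (a + 1)) ((a + 1) * (t : ℂ) ^ a) t := by
      have h : HasDerivAt (fun z : ℂ => z ^ (a + 1)) ((a + 1) * (t : ℂ) ^ a) t := by
        simpa using (hasDerivAt_id (t : ℂ)).cpow_const (c := a + 1) (Or.inl (by simpa using ht))
      exact h.comp_ofReal
    have h2 := hasDerivAt_base_cpow_t (a - 1) w t
    have h3 : HasDerivAt (fun t : ℝ => Complex.exp (-t)) (-Complex.exp (-t)) t := by
      have := (Complex.ofRealCLM.hasDerivAt (x := t)).neg.cexp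
      simpa using this
    refine ((h3.mul h1).mul h2).neg.congr_deriv ?_
    have hu := base_ne_zero t w
    simp only [hg, hankelKernel, Pi.mul_apply]
    rw [show a + 2 = a + 1 + 1 by ring, Complex.cpow_add (a + 1) 1 htc,
      Complex.cpow_add a 1 htc, Complex.cpow_one, show a - 1 - 1 = a - 2 by ring]
    have e0 : (1 + Complex.I * t * w / 2 : ℂ) ^ a
        = (1 + Complex.I * t * w / 2 : ℂ) ^ (a - 2) * (1 + Complex.I * t * w / 2 : ℂ) ^ 2 := by
      rw [← Complex.cpow_ofNat, ← Complex.cpow_add _ _ hu]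
      congr 1; ring
    have e1 : (1 + Complex.I * t * w / 2 : ℂ) ^ (a - 1)
        = (1 + Complex.I * t * w / 2 : ℂ) ^ (a - 2) * (1 + Complex.I * t * w / 2 : ℂ) := by
      nth_rewrite 3 [← Complex.cpow_one (1 + Complex.I * t * w / 2 : ℂ)]
      rw [← Complex.cpow_add _ _ hu]
      congr 1; ring
    rw [e0, e1]
    generalize (1 + Complex.I * t * w / 2 : ℂ) ^ (a - 2) = u
    generalize (t : ℂ) ^ a = s
    generalize Complex.exp (-t) = e
    ring_nf
    simp only [Complex.I_sq]
    ring
  have hlim : Tendsto (fun t => -hankelKernel (a + 1) (a - 1) w t) atTop (𝓝 0) := by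
    obtain ⟨m, hm⟩ := exists_nat_ge |(a - 1).re|
    have h := (tendsto_exp_neg_mul_rpow (a + 1).re |w| m).const_mul
      (Real.exp (Real.pi * |(a - 1).im|))
    rw [mul_zero] at h
    refine squeeze_zero_norm' ?_ h
    filter_upwards [eventually_gt_atTop 0] with t ht
    rw [norm_neg]
    exact norm_hankelKernel_le ht le_rfl hm
  have h := integral_Ioi_of_hasDerivAt_of_tendsto hcont hder ig hlim
  rw [hint] at h
  have h0 : hankelKernel (a + 1) (a - 1) w 0 = 0 := by
    simp [hankelKernel, Complex.zero_cpow hz]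
  rw [h0] at h
  simpa [mul_assoc] using h

/-! ## Jost solutions of `y'' + (1 + δ / x²) y = 0` -/

theorem hasDerivAt_re_conj_mul {u v : ℝ → ℂ} {u' v' : ℂ} {x : ℝ} (hu : HasDerivAt u u' x)
    (hv : HasDerivAt v v' x) :
    HasDerivAt (fun t => (conj (u t) * v t).re) ((conj u' * v x + conj (u x) * v').re) x :=
  Complex.reCLM.hasFDerivAt.comp_hasDerivAt x (hu.star.mul hv)

theorem hasDerivAt_im_conj_mul {u v : ℝ → ℂ} {u' v' : ℂ} {x : ℝ} (hu : HasDerivAt u u' x)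
    (hv : HasDerivAt v v' x) :
    HasDerivAt (fun t => (conj (u t) * v t).im) ((conj u' * v x + conj (u x) * v').im) x :=
  Complex.imCLM.hasFDerivAt.comp_hasDerivAt x (hu.star.mul hv)

/-- A solution `y = e^{i x} f₀(1 / x)` of `y'' + (1 + δ / x²) y = 0` whose amplitude `f₀` is smooth
up to `w = 1 / x = 0`, and equal to `1` there. -/
structure JostSolution (δ : ℝ) where
  f₀ : ℝ → ℂ
  f₁ : ℝ → ℂ
  f₂ : ℝ → ℂ
  f₃ : ℝ → ℂ
  deriv₀ : ∀ w, HasDerivAt f₀ (f₁ w) w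
  deriv₁ : ∀ w, HasDerivAt f₁ (f₂ w) w
  deriv₂ : ∀ w, HasDerivAt f₂ (f₃ w) w
  cont₃ : Continuous f₃
  init : f₀ 0 = 1
  ode : ∀ w : ℝ, (w : ℂ) ^ 2 * f₂ w + (2 * w - 2 * Complex.I) * f₁ w + δ * f₀ w = 0
  degenerate : δ * (δ + 2) = 0 → ∀ w, f₂ w = 0 ∧ f₃ w = 0

namespace JostSolution

variable {δ : ℝ} (J : JostSolution δ)

/-- The derivative of `ode`. Since the leading coefficient w² vanishes at w = 0, each
differentiation of the equation determines one further Taylor coefficient of `f₀` there. -/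
theorem ode' (w : ℝ) :
    (w : ℂ) ^ 2 * J.f₃ w + (4 * w - 2 * Complex.I) * J.f₂ w + (2 + δ) * J.f₁ w = 0 := by
  have hw : HasDerivAt (fun w : ℝ => (w : ℂ)) 1 w := by
    simpa using (hasDerivAt_id (w : ℂ)).comp_ofReal
  have h := (((hw.pow 2).mul (J.deriv₂ w)).add
    (((hw.const_mul 2).sub_const (2 * Complex.I)).mul (J.deriv₁ w))).add
    ((J.deriv₀ w).const_mul (δ : ℂ))
  have h0 : HasDerivAt (fun _ : ℝ => (0 : ℂ)) 0 w := hasDerivAt_const w 0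
  have := (h.congr_of_eventuallyEq (f₁ := fun _ => (0 : ℂ))
    (Eventually.of_forall fun v => (J.ode v).symm)).unique h0
  rw [← this]
  simp
  ring

theorem ode_re (w : ℝ) : w ^ 2 * (J.f₂ w).re + 2 * w * (J.f₁ w).re + 2 * (J.f₁ w).im
    + δ * (J.f₀ w).re = 0 := by
  have h := congrArg Complex.re (J.ode w)
  simp [pow_two] at h
  linear_combination h

theorem ode_im (w : ℝ) : w ^ 2 * (J.f₂ w).im + 2 * w * (J.f₁ w).im - 2 * (J.f₁ w).re
    + δ * (J.f₀ w).im = 0 := by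
  have h := congrArg Complex.im (J.ode w)
  simp [pow_two] at h
  linear_combination h

theorem ode'_re (w : ℝ) : w ^ 2 * (J.f₃ w).re + 4 * w * (J.f₂ w).re + 2 * (J.f₂ w).im
    + (2 + δ) * (J.f₁ w).re = 0 := by
  have h := congrArg Complex.re (J.ode' w)
  simp [pow_two] at h
  linear_combination h

theorem ode'_im (w : ℝ) : w ^ 2 * (J.f₃ w).im + 4 * w * (J.f₂ w).im - 2 * (J.f₂ w).re
    + (2 + δ) * (J.f₁ w).im = 0 := by
  have h := congrArg Complex.im (J.ode' w)
  simp [pow_two] at h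
  linear_combination h

/-- The solution. -/
def y (x : ℝ) : ℂ := Complex.exp (Complex.I * x) * J.f₀ x⁻¹

/-- Its derivative. -/
def dy (x : ℝ) : ℂ :=
  Complex.exp (Complex.I * x) * (Complex.I * J.f₀ x⁻¹ - ((x⁻¹ ^ 2 : ℝ) : ℂ) * J.f₁ x⁻¹)

/-- The potential `1 + δ / x²`. -/
def potential (δ x : ℝ) : ℝ := 1 + δ * x⁻¹ ^ 2

theorem hasDerivAt_inv_sq {x : ℝ} (hx : x ≠ 0) :
    HasDerivAt (fun x : ℝ => x⁻¹ ^ 2) (-2 * x⁻¹ ^ 3) x := by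
  refine ((hasDerivAt_inv hx).pow 2).congr_deriv ?_
  simp only [inv_pow]
  field_simp
  norm_num [mul_comm]

theorem hasDerivAt_expI (x : ℝ) : HasDerivAt (fun x : ℝ => Complex.exp (Complex.I * x))
    (Complex.I * Complex.exp (Complex.I * x)) x := by
  have h : HasDerivAt (fun z : ℂ => Complex.exp (Complex.I * z))
      (Complex.I * Complex.exp (Complex.I * x)) x := by
    simpa [mul_comm] using ((hasDerivAt_id (x : ℂ)).const_mul Complex.I).cexp
  exact h.comp_ofReal

theorem hasDerivAt_comp_inv {f : ℝ → ℂ} {f' : ℂ} {x : ℝ} (hx : x ≠ 0)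
    (h : HasDerivAt f f' x⁻¹) :
    HasDerivAt (fun x => f x⁻¹) (-((x⁻¹ ^ 2 : ℝ) : ℂ) * f') x := by
  have := h.scomp x (hasDerivAt_inv hx)
  refine this.congr_deriv ?_
  simp

theorem hasDerivAt_y {x : ℝ} (hx : 0 < x) : HasDerivAt J.y (J.dy x) x := by
  refine ((hasDerivAt_expI x).mul (hasDerivAt_comp_inv hx.ne' (J.deriv₀ x⁻¹))).congr_deriv ?_
  simp only [dy]
  ring

theorem hasDerivAt_dy {x : ℝ} (hx : 0 < x) :
    HasDerivAt J.dy (-(potential δ x : ℂ) * J.y x) x := by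
  have h0 := hasDerivAt_comp_inv hx.ne' (J.deriv₀ x⁻¹)
  have h1 := hasDerivAt_comp_inv hx.ne' (J.deriv₁ x⁻¹)
  have h2 := (hasDerivAt_inv_sq hx.ne').ofReal_comp
  refine ((hasDerivAt_expI x).mul ((h0.const_mul Complex.I).sub (h2.mul h1))).congr_deriv ?_
  have ho := J.ode x⁻¹
  simp only [y, potential, Pi.sub_apply, Pi.mul_apply]
  push_cast at ho ⊢
  linear_combination (Complex.exp (Complex.I * x) * (x : ℂ)⁻¹ ^ 2) * ho +
    Complex.exp (Complex.I * x) * J.f₀ x⁻¹ * Complex.I_sq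

theorem conj_expI_mul (x : ℝ) :
    conj (Complex.exp (Complex.I * x)) * Complex.exp (Complex.I * x) = 1 := by
  rw [← Complex.exp_conj, ← Complex.exp_add]
  simp

/-- `|y|²` -/
def n (x : ℝ) : ℝ := (conj (J.y x) * J.y x).re

/-- `Re (ȳ y')` -/
def b (x : ℝ) : ℝ := (conj (J.y x) * J.dy x).re

/-- `|y'|²` -/
def v (x : ℝ) : ℝ := (conj (J.dy x) * J.dy x).re

theorem n_eq (x : ℝ) : J.n x = (J.f₀ x⁻¹).re ^ 2 + (J.f₀ x⁻¹).im ^ 2 := by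
  have : conj (J.y x) * J.y x = conj (J.f₀ x⁻¹) * J.f₀ x⁻¹ := by
    simp only [y, map_mul]
    linear_combination (conj (J.f₀ x⁻¹) * J.f₀ x⁻¹) * conj_expI_mul x
  rw [n, this]
  simp
  ring

theorem conj_y_mul_dy (x : ℝ) : conj (J.y x) * J.dy x =
    conj (J.f₀ x⁻¹) * (Complex.I * J.f₀ x⁻¹ - ((x⁻¹ ^ 2 : ℝ) : ℂ) * J.f₁ x⁻¹) := by
  simp only [y, dy, map_mul]
  linear_combination (conj (J.f₀ x⁻¹) *
    (Complex.I * J.f₀ x⁻¹ - ((x⁻¹ ^ 2 : ℝ) : ℂ) * J.f₁ x⁻¹)) * conj_expI_mul x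

theorem b_eq (x : ℝ) : J.b x =
    -(x⁻¹ ^ 2 * ((J.f₀ x⁻¹).re * (J.f₁ x⁻¹).re + (J.f₀ x⁻¹).im * (J.f₁ x⁻¹).im)) := by
  rw [b, conj_y_mul_dy]
  simp only [Complex.mul_re, Complex.sub_re, Complex.sub_im, Complex.mul_im, Complex.conj_re,
    Complex.conj_im, Complex.I_re, Complex.I_im, Complex.ofReal_re, Complex.ofReal_im]
  ring

theorem wronskian_eq (x : ℝ) : (conj (J.y x) * J.dy x).im = (J.f₀ x⁻¹).re ^ 2 +
    (J.f₀ x⁻¹).im ^ 2 -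
    x⁻¹ ^ 2 * ((J.f₀ x⁻¹).re * (J.f₁ x⁻¹).im - (J.f₀ x⁻¹).im * (J.f₁ x⁻¹).re) := by
  rw [conj_y_mul_dy]
  simp only [Complex.mul_re, Complex.sub_re, Complex.sub_im, Complex.mul_im, Complex.conj_re,
    Complex.conj_im, Complex.I_re, Complex.I_im, Complex.ofReal_re, Complex.ofReal_im]
  ring

theorem v_eq (x : ℝ) : J.v x = (J.f₀ x⁻¹).re ^ 2 + (J.f₀ x⁻¹).im ^ 2 -
    2 * x⁻¹ ^ 2 * ((J.f₀ x⁻¹).re * (J.f₁ x⁻¹).im - (J.f₀ x⁻¹).im * (J.f₁ x⁻¹).re) +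
    x⁻¹ ^ 4 * ((J.f₁ x⁻¹).re ^ 2 + (J.f₁ x⁻¹).im ^ 2) := by
  have : conj (J.dy x) * J.dy x =
      conj (Complex.I * J.f₀ x⁻¹ - ((x⁻¹ ^ 2 : ℝ) : ℂ) * J.f₁ x⁻¹) *
        (Complex.I * J.f₀ x⁻¹ - ((x⁻¹ ^ 2 : ℝ) : ℂ) * J.f₁ x⁻¹) := by
    simp only [dy, map_mul]
    linear_combination (conj (Complex.I * J.f₀ x⁻¹ - ((x⁻¹ ^ 2 : ℝ) : ℂ) * J.f₁ x⁻¹) *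
      (Complex.I * J.f₀ x⁻¹ - ((x⁻¹ ^ 2 : ℝ) : ℂ) * J.f₁ x⁻¹)) * conj_expI_mul x
  rw [v, this]
  simp only [Complex.mul_re, Complex.sub_re, Complex.sub_im, Complex.mul_im, Complex.conj_re,
    Complex.conj_im, Complex.I_re, Complex.I_im, Complex.ofReal_re, Complex.ofReal_im]
  ring

theorem hasDerivAt_n {x : ℝ} (hx : 0 < x) : HasDerivAt J.n (2 * J.b x) x := by
  refine (hasDerivAt_re_conj_mul (J.hasDerivAt_y hx) (J.hasDerivAt_y hx)).congr_deriv ?_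
  simp [b]
  ring

theorem hasDerivAt_b {x : ℝ} (hx : 0 < x) :
    HasDerivAt J.b (J.v x - potential δ x * J.n x) x := by
  refine (hasDerivAt_re_conj_mul (J.hasDerivAt_y hx) (J.hasDerivAt_dy hx)).congr_deriv ?_
  simp [n, v]
  ring

theorem hasDerivAt_v {x : ℝ} (hx : 0 < x) :
    HasDerivAt J.v (-2 * potential δ x * J.b x) x := by
  refine (hasDerivAt_re_conj_mul (J.hasDerivAt_dy hx) (J.hasDerivAt_dy hx)).congr_deriv ?_
  simp [b]
  ring

/-- The Wronskian is normalized. -/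
theorem wronskian (x : ℝ) : (conj (J.y x) * J.dy x).im = 1 := by
  have h0 : ∀ w, HasDerivAt (fun w => (conj (J.f₀ w) * J.f₀ w).re) _ w := fun w =>
    hasDerivAt_re_conj_mul (J.deriv₀ w) (J.deriv₀ w)
  have h1 : ∀ w, HasDerivAt (fun w => (conj (J.f₀ w) * J.f₁ w).im) _ w := fun w =>
    hasDerivAt_im_conj_mul (J.deriv₀ w) (J.deriv₁ w)
  -- In the variable w the Wronskian is |f₀|² - w² Im (f̄₀ f₁). It is constant on the whole line,
  -- across the singular point w = 0, where `init` gives the value 1. The convention 0⁻¹ = 0 covers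
  -- x = 0.
  have h : ∀ w : ℝ, HasDerivAt (fun w => (conj (J.f₀ w) * J.f₀ w).re -
      w ^ 2 * (conj (J.f₀ w) * J.f₁ w).im) 0 w := fun w => by
    refine ((h0 w).sub (((hasDerivAt_id w).pow 2).mul (h1 w))).congr_deriv ?_
    simp
    linear_combination (J.f₀ w).im * J.ode_re w - (J.f₀ w).re * J.ode_im w
  have hc := is_const_of_deriv_eq_zero (fun w => (h w).differentiableAt) (fun w => (h w).deriv)
    x⁻¹ 0
  simp [J.init] at hc
  rw [wronskian_eq]
  linear_combination hc

theorem n_pos (x : ℝ) : 0 < J.n x := by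
  have h := J.wronskian x
  have hy : J.y x ≠ 0 := fun h0 => by simp [h0] at h
  have : J.n x = Complex.normSq (J.y x) := by
    rw [n, ← Complex.normSq_eq_conj_mul_self, Complex.ofReal_re]
  rw [this]
  exact Complex.normSq_pos.2 hy

/-! ### Convexity of `x² |y|²` in `x²` -/

/-- Up to a positive factor the second derivative of `x² |y|²` with respect to `x²`. -/
def conv (x : ℝ) : ℝ := 2 * x ^ 2 * (J.v x - potential δ x * J.n x) + 6 * x * J.b x

/-- The derivative of `conv`. -/
def conv₁ (x : ℝ) : ℝ :=
  10 * x * (J.v x - potential δ x * J.n x) + 6 * J.b x - 8 * (x ^ 2 + δ) * J.b x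
    + 4 * δ * x⁻¹ * J.n x

/-- The second derivative of `conv`. -/
def conv₂ (x : ℝ) : ℝ :=
  (16 - 8 * δ - 8 * x ^ 2) * (J.v x - potential δ x * J.n x) - (56 * x + 32 * δ * x⁻¹) * J.b x
    + 16 * δ * x⁻¹ ^ 2 * J.n x

theorem hasDerivAt_potential {x : ℝ} (hx : x ≠ 0) :
    HasDerivAt (potential δ) (-2 * δ * x⁻¹ ^ 3) x :=
  (((hasDerivAt_inv_sq hx).const_mul δ).const_add 1).congr_deriv (by ring)

theorem hasDerivAt_conv {x : ℝ} (hx : 0 < x) : HasDerivAt J.conv (J.conv₁ x) x := by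
  have hq := (J.hasDerivAt_v hx).sub ((hasDerivAt_potential (δ := δ) hx.ne').mul (J.hasDerivAt_n hx))
  refine (((((hasDerivAt_id x).pow 2).const_mul 2).mul hq).add
    (((hasDerivAt_id x).const_mul 6).mul (J.hasDerivAt_b hx))).congr_deriv ?_
  have := hx.ne'
  simp [conv₁, potential]
  field_simp
  ring

theorem hasDerivAt_conv₁ {x : ℝ} (hx : 0 < x) : HasDerivAt J.conv₁ (J.conv₂ x) x := by
  have hq := (J.hasDerivAt_v hx).sub ((hasDerivAt_potential (δ := δ) hx.ne').mul (J.hasDerivAt_n hx))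
  have hb := J.hasDerivAt_b hx
  refine (((((hasDerivAt_id x).const_mul 10).mul hq).add (hb.const_mul 6)).sub
    (((((hasDerivAt_id x).pow 2).add_const δ).const_mul 8).mul hb)).add
    (((hasDerivAt_inv hx.ne').const_mul (4 * δ)).mul (J.hasDerivAt_n hx)) |>.congr_deriv ?_
  have := hx.ne'
  simp [conv₂, potential]
  field_simp
  ring

/-- With V the potential this reads conv''' + 4V conv' + 2V' conv = -(16/x) conv. The left side is
the operator that annihilates products of two solutions of y'' + V y = 0; the right side has the
sign opposite to `conv`, which drives the comparison argument. -/
theorem hasDerivAt_conv₂ {x : ℝ} (hx : 0 < x) :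
    HasDerivAt J.conv₂ (-4 * potential δ x * J.conv₁ x + 4 * δ * x⁻¹ ^ 3 * J.conv x
      - 16 * x⁻¹ * J.conv x) x := by
  have hq := (J.hasDerivAt_v hx).sub ((hasDerivAt_potential (δ := δ) hx.ne').mul (J.hasDerivAt_n hx))
  have hb := J.hasDerivAt_b hx
  refine ((((((hasDerivAt_id x).pow 2).const_mul 8).const_sub (16 - 8 * δ)).mul hq).sub
    ((((hasDerivAt_id x).const_mul 56).add ((hasDerivAt_inv hx.ne').const_mul (32 * δ))).mul
      hb)).add (((hasDerivAt_inv_sq hx.ne').const_mul (16 * δ)).mul (J.hasDerivAt_n hx))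
      |>.congr_deriv ?_
  have := hx.ne'
  simp [conv, conv₁, potential]
  field_simp
  ring

/-- `Im (f̄₀ f₂)`, the derivative of `Im (f̄₀ f₁)`. -/
def s₁ (w : ℝ) : ℝ := (conj (J.f₀ w) * J.f₂ w).im

/-- The derivative of `s₁`. -/
def s₂ (w : ℝ) : ℝ := (conj (J.f₁ w) * J.f₂ w + conj (J.f₀ w) * J.f₃ w).im

/-- By the Wronskian, x²|y|² = x² + Im (f̄₀ f₁) at w = 1/x. Its derivative in x² is therefore 1 - w³
s₁/2, and one more derivative in x yields the right side over 2x. The variable w makes the behaviour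
at infinity visible. -/
theorem conv_eq {x : ℝ} (hx : 0 < x) :
    J.conv x = 3 * x⁻¹ ^ 3 * J.s₁ x⁻¹ + x⁻¹ ^ 4 * J.s₂ x⁻¹ := by
  obtain ⟨w, rfl⟩ : ∃ w, x = w⁻¹ := ⟨x⁻¹, (inv_inv x).symm⟩
  have hw : w ≠ 0 := fun h => by simp [h] at hx
  have h1 := J.ode_re w
  have h2 := J.ode_im w
  have h3 := J.ode'_re w
  have h4 := J.ode'_im w
  rw [conv, potential, n_eq, b_eq, v_eq]
  simp only [s₁, s₂, Complex.add_im, Complex.mul_im, Complex.conj_re, Complex.conj_im, inv_inv]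
  generalize (J.f₀ w).re = a0 at *
  generalize (J.f₀ w).im = b0 at *
  generalize (J.f₁ w).re = a1 at *
  generalize (J.f₁ w).im = b1 at *
  generalize (J.f₂ w).re = a2 at *
  generalize (J.f₂ w).im = b2 at *
  generalize (J.f₃ w).re = a3 at *
  generalize (J.f₃ w).im = b3 at *
  field_simp
  linear_combination w ^ 2 * ((-2 * a0 - w * b0 + w ^ 2 * b1) * h1
    + (-2 * b0 + w * a0 - w ^ 2 * a1) * h2 + w ^ 2 * b0 * h3 - w ^ 2 * a0 * h4)

/-! ### Behaviour at infinity -/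

/-- At the singular point the second-order term drops out of `ode`, so the value `f₀ 0 = 1` already
fixes the derivative. -/
theorem f₁_zero : J.f₁ 0 = -Complex.I * δ / 2 := by
  have h := J.ode 0
  simp [J.init] at h
  linear_combination (Complex.I / 2) * h + J.f₁ 0 * Complex.I_sq

theorem f₂_zero : J.f₂ 0 = -(δ * (δ + 2) / 4 : ℝ) := by
  have h := J.ode' 0
  simp [J.f₁_zero] at h
  push_cast
  linear_combination (Complex.I / 2) * h + (J.f₂ 0 + δ * (δ + 2) / 4) * Complex.I_sq

theorem cont₀ : Continuous J.f₀ :=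
  continuous_iff_continuousAt.2 fun w => (J.deriv₀ w).continuousAt

theorem cont₁ : Continuous J.f₁ :=
  continuous_iff_continuousAt.2 fun w => (J.deriv₁ w).continuousAt

theorem cont₂ : Continuous J.f₂ :=
  continuous_iff_continuousAt.2 fun w => (J.deriv₂ w).continuousAt

/-- The relation obtained by differentiating `ode'`, at `w = 0`. -/
theorem f₃_zero : J.f₃ 0 = Complex.I * (δ * (δ + 2) * (δ + 6) / 8 : ℝ) := by
  have hw : HasDerivAt (fun w : ℝ => (w : ℂ)) 1 0 := by
    simpa using (hasDerivAt_id ((0 : ℝ) : ℂ)).comp_ofReal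
  -- `f₃` is only known to be continuous, so the product rule is not available; the difference
  -- quotient at 0 is w f₃(w), which tends to 0.
  have h3 : HasDerivAt (fun w : ℝ => (w : ℂ) ^ 2 * J.f₃ w) 0 0 := by
    rw [hasDerivAt_iff_tendsto_slope_zero]
    have hc : Tendsto (fun w : ℝ => (w : ℂ) * J.f₃ w) (𝓝[≠] 0) (𝓝 0) := by
      have : Continuous fun w : ℝ => (w : ℂ) * J.f₃ w := Complex.continuous_ofReal.mul J.cont₃
      simpa using (this.tendsto 0).mono_left nhdsWithin_le_nhds
    refine hc.congr' ?_
    filter_upwards [self_mem_nhdsWithin] with w hw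
    have hw : (w : ℂ) ≠ 0 := by exact_mod_cast hw
    simp
    field_simp
  have h := (h3.add (((hw.const_mul 4).sub_const (2 * Complex.I)).mul (J.deriv₂ 0))).add
    ((J.deriv₁ 0).const_mul (2 + δ : ℂ))
  have h0 : HasDerivAt (fun _ : ℝ => (0 : ℂ)) 0 0 := hasDerivAt_const 0 0
  have := (h.congr_of_eventuallyEq (f₁ := fun _ => (0 : ℂ))
    (Eventually.of_forall fun v => (J.ode' v).symm)).unique h0
  simp [f₂_zero] at this
  push_cast
  linear_combination (Complex.I / 2) * this + J.f₃ 0 * Complex.I_sq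

theorem s₁_zero : J.s₁ 0 = 0 := by
  simp [s₁, J.init, J.f₂_zero, -Complex.ofReal_div, -Complex.ofReal_mul]

theorem s₂_zero : J.s₂ 0 = 3 * δ * (δ + 2) / 4 := by
  rw [s₂, J.init, J.f₁_zero, J.f₂_zero, J.f₃_zero]
  simp only [Complex.add_im, Complex.mul_im, Complex.conj_re, Complex.conj_im, Complex.neg_re,
    Complex.neg_im, Complex.mul_re, Complex.I_re, Complex.I_im, Complex.ofReal_re,
    Complex.ofReal_im, Complex.one_re, Complex.one_im, Complex.div_ofNat_re, Complex.div_ofNat_im]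
  ring

theorem hasDerivAt_s₁ (w : ℝ) : HasDerivAt J.s₁ (J.s₂ w) w :=
  hasDerivAt_im_conj_mul (J.deriv₀ w) (J.deriv₂ w)

theorem continuous_s₂ : Continuous J.s₂ :=
  Complex.continuous_im.comp ((J.cont₁.star.mul J.cont₂).add (J.cont₀.star.mul J.cont₃))

/-- As s₁(0) = 0, both terms of `conv_eq` are of order w⁴ and together give 4 s₂(0). This fixes the
sign of `conv` near infinity. -/
theorem tendsto_pow_four_mul_conv :
    Tendsto (fun x => x ^ 4 * J.conv x) atTop (𝓝 (3 * δ * (δ + 2))) := by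
  have h1 := (hasDerivAt_iff_tendsto_slope_zero.1 (J.hasDerivAt_s₁ 0))
  have h2 : Tendsto J.s₂ (𝓝[≠] 0) (𝓝 (J.s₂ 0)) :=
    (J.continuous_s₂.tendsto 0).mono_left nhdsWithin_le_nhds
  have hinv : Tendsto (fun x : ℝ => x⁻¹) atTop (𝓝[≠] 0) :=
    tendsto_inv_atTop_nhdsGT_zero.mono_right
      (nhdsWithin_mono _ fun x (hx : (0 : ℝ) < x) => hx.ne')
  have h := ((h1.const_mul 3).add h2).comp hinv
  rw [s₂_zero, show 3 * (3 * δ * (δ + 2) / 4) + 3 * δ * (δ + 2) / 4 = 3 * δ * (δ + 2) by ring] at h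
  refine h.congr' ?_
  filter_upwards [eventually_gt_atTop 0] with x hx
  rw [J.conv_eq hx]
  simp [s₁_zero]
  field_simp

theorem tendsto_comp_inv {X : Type*} [TopologicalSpace X] {g : ℝ → X} (hg : Continuous g) :
    Tendsto (fun x => g x⁻¹) atTop (𝓝 (g 0)) :=
  (hg.tendsto 0).comp tendsto_inv_atTop_zero

theorem cont_re {f : ℝ → ℂ} (hf : Continuous f) : Continuous fun w => (f w).re :=
  Complex.continuous_re.comp hf

theorem cont_im {f : ℝ → ℂ} (hf : Continuous f) : Continuous fun w => (f w).im :=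
  Complex.continuous_im.comp hf

theorem tendsto_n : Tendsto J.n atTop (𝓝 1) := by
  have := cont_re J.cont₀
  have := cont_im J.cont₀
  have h := tendsto_comp_inv (g := fun w => (J.f₀ w).re ^ 2 + (J.f₀ w).im ^ 2) (by fun_prop)
  simp only [J.init] at h
  simpa [← n_eq] using h

theorem tendsto_v : Tendsto J.v atTop (𝓝 1) := by
  have := cont_re J.cont₀
  have := cont_im J.cont₀
  have := cont_re J.cont₁
  have := cont_im J.cont₁
  have h := tendsto_comp_inv (g := fun w => (J.f₀ w).re ^ 2 + (J.f₀ w).im ^ 2 -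
    2 * w ^ 2 * ((J.f₀ w).re * (J.f₁ w).im - (J.f₀ w).im * (J.f₁ w).re) +
    w ^ 4 * ((J.f₁ w).re ^ 2 + (J.f₁ w).im ^ 2)) (by fun_prop)
  simp only [J.init, Complex.one_re, Complex.one_im, ne_eq, OfNat.ofNat_ne_zero,
    not_false_eq_true, zero_pow, one_pow, mul_zero, zero_mul, add_zero, sub_zero] at h
  exact h.congr fun x => (J.v_eq x).symm

theorem tendsto_sq_mul_b : Tendsto (fun x => x ^ 2 * J.b x) atTop (𝓝 0) := by
  have := cont_re J.cont₀
  have := cont_im J.cont₀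
  have := cont_re J.cont₁
  have := cont_im J.cont₁
  have h := tendsto_comp_inv (g := fun w =>
    -((J.f₀ w).re * (J.f₁ w).re + (J.f₀ w).im * (J.f₁ w).im)) (by fun_prop)
  simp [J.init, J.f₁_zero] at h
  refine h.congr' ?_
  filter_upwards [eventually_gt_atTop 0] with x hx
  rw [b_eq]
  field_simp
  ring

theorem tendsto_sq_mul_acc :
    Tendsto (fun x => x ^ 2 * (J.v x - potential δ x * J.n x)) atTop (𝓝 0) := by
  have := cont_re J.cont₀
  have := cont_im J.cont₀
  have := cont_re J.cont₁
  have := cont_im J.cont₁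
  have h := tendsto_comp_inv (g := fun w =>
    - 2 * ((J.f₀ w).re * (J.f₁ w).im - (J.f₀ w).im * (J.f₁ w).re) +
    w ^ 2 * ((J.f₁ w).re ^ 2 + (J.f₁ w).im ^ 2) - δ * ((J.f₀ w).re ^ 2 + (J.f₀ w).im ^ 2))
    (by fun_prop)
  have e : - 2 * ((J.f₀ 0).re * (J.f₁ 0).im - (J.f₀ 0).im * (J.f₁ 0).re) +
    0 ^ 2 * ((J.f₁ 0).re ^ 2 + (J.f₁ 0).im ^ 2) - δ * ((J.f₀ 0).re ^ 2 + (J.f₀ 0).im ^ 2) = 0 := by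
    simp [J.init, J.f₁_zero]
    ring
  rw [e] at h
  refine h.congr' ?_
  filter_upwards [eventually_gt_atTop 0] with x hx
  rw [v_eq, n_eq, potential]
  field_simp
  ring

theorem tendsto_potential : Tendsto (potential δ) atTop (𝓝 1) := by
  have h := tendsto_comp_inv (g := fun w : ℝ => 1 + δ * w ^ 2) (by fun_prop)
  simp only [ne_eq, OfNat.ofNat_ne_zero, not_false_eq_true, zero_pow, mul_zero, add_zero] at h
  exact h

theorem tendsto_b : Tendsto J.b atTop (𝓝 0) := by
  have h := J.tendsto_sq_mul_b.mul (tendsto_inv_atTop_zero.pow 2)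
  rw [zero_mul] at h
  refine h.congr' ?_
  filter_upwards [eventually_gt_atTop 0] with x hx
  field_simp

theorem tendsto_mul_b : Tendsto (fun x => x * J.b x) atTop (𝓝 0) := by
  have h := J.tendsto_sq_mul_b.mul tendsto_inv_atTop_zero
  rw [zero_mul] at h
  refine h.congr' ?_
  filter_upwards [eventually_gt_atTop 0] with x hx
  field_simp

theorem tendsto_mul_acc : Tendsto (fun x => x * (J.v x - potential δ x * J.n x)) atTop (𝓝 0) := by
  have h := J.tendsto_sq_mul_acc.mul tendsto_inv_atTop_zero
  rw [zero_mul] at h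
  refine h.congr' ?_
  filter_upwards [eventually_gt_atTop 0] with x hx
  field_simp

theorem tendsto_acc : Tendsto (fun x => J.v x - potential δ x * J.n x) atTop (𝓝 0) := by
  simpa using J.tendsto_v.sub (tendsto_potential.mul J.tendsto_n)

theorem tendsto_conv : Tendsto J.conv atTop (𝓝 0) := by
  have h := (J.tendsto_sq_mul_acc.const_mul 2).add (J.tendsto_mul_b.const_mul 6)
  simp only [mul_zero, add_zero] at h
  refine h.congr fun x => ?_
  rw [conv]
  ring

theorem tendsto_conv₁ : Tendsto J.conv₁ atTop (𝓝 0) := by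
  have h := (((J.tendsto_mul_acc.const_mul 10).add (J.tendsto_b.const_mul (6 - 8 * δ))).sub
    (J.tendsto_sq_mul_b.const_mul 8)).add ((tendsto_inv_atTop_zero.mul J.tendsto_n).const_mul
    (4 * δ))
  simp only [mul_zero, add_zero, zero_mul, sub_zero] at h
  refine h.congr fun x => ?_
  rw [conv₁]
  ring

theorem tendsto_conv₂ : Tendsto J.conv₂ atTop (𝓝 0) := by
  have h := ((((J.tendsto_acc.const_mul (16 - 8 * δ)).sub (J.tendsto_sq_mul_acc.const_mul 8)).sub
    (J.tendsto_mul_b.const_mul 56)).sub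
    ((tendsto_inv_atTop_zero.mul J.tendsto_b).const_mul (32 * δ))).add
    (((tendsto_inv_atTop_zero.pow 2).mul J.tendsto_n).const_mul (16 * δ))
  simp only [mul_zero, add_zero, zero_mul, sub_zero, ne_eq, OfNat.ofNat_ne_zero, not_false_eq_true,
    zero_pow] at h
  refine h.congr fun x => ?_
  rw [conv₂]
  ring

end JostSolution

namespace JostSolution

variable {δ : ℝ} (J : JostSolution δ)

/-! ### The sign of `conv` -/

/-- The real solution that vanishes at `x₀`. -/
def zeroSol (x₀ x : ℝ) : ℝ := (conj (J.y x₀) * J.y x).im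

/-- Its derivative. -/
def dzeroSol (x₀ x : ℝ) : ℝ := (conj (J.y x₀) * J.dy x).im

theorem hasDerivAt_zeroSol (x₀ : ℝ) {x : ℝ} (hx : 0 < x) :
    HasDerivAt (J.zeroSol x₀) (J.dzeroSol x₀ x) x := by
  refine (hasDerivAt_im_conj_mul (hasDerivAt_const x (J.y x₀)) (J.hasDerivAt_y hx)).congr_deriv ?_
  simp [dzeroSol]

theorem hasDerivAt_dzeroSol (x₀ : ℝ) {x : ℝ} (hx : 0 < x) :
    HasDerivAt (J.dzeroSol x₀) (-potential δ x * J.zeroSol x₀ x) x := by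
  refine (hasDerivAt_im_conj_mul (hasDerivAt_const x (J.y x₀))
    (J.hasDerivAt_dy hx)).congr_deriv ?_
  simp [zeroSol]
  ring

theorem zeroSol_self (x₀ : ℝ) : J.zeroSol x₀ x₀ = 0 := by
  simp [zeroSol]
  ring

theorem dzeroSol_self (x₀ : ℝ) : J.dzeroSol x₀ x₀ = 1 := J.wronskian x₀

/-- The bilinear concomitant of `conv` and `zeroSol²`. -/
def concomitant (x₀ x : ℝ) : ℝ :=
  J.conv x * (2 * J.dzeroSol x₀ x ^ 2 + 2 * potential δ x * J.zeroSol x₀ x ^ 2)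
    - 2 * J.conv₁ x * (J.zeroSol x₀ x * J.dzeroSol x₀ x) + J.conv₂ x * J.zeroSol x₀ x ^ 2

/-- The operator u''' + 4V u' + 2V' u is formally anti-self-adjoint and annihilates `zeroSol`². Only
the term -(16/x) conv in the equation of `conv` survives in the derivative. -/
theorem hasDerivAt_concomitant (x₀ : ℝ) {x : ℝ} (hx : 0 < x) :
    HasDerivAt (J.concomitant x₀) (-16 * x⁻¹ * J.conv x * J.zeroSol x₀ x ^ 2) x := by
  have hz := J.hasDerivAt_zeroSol x₀ hx
  have hd := J.hasDerivAt_dzeroSol x₀ hx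
  have hp := hasDerivAt_potential (δ := δ) hx.ne'
  refine ((((J.hasDerivAt_conv hx).mul (((hd.pow 2).const_mul 2).add
    ((hp.const_mul 2).mul (hz.pow 2)))).sub (((J.hasDerivAt_conv₁ hx).const_mul 2).mul
    (hz.mul hd))).add ((J.hasDerivAt_conv₂ hx).mul (hz.pow 2))).congr_deriv ?_
  simp
  ring

theorem concomitant_self (x₀ : ℝ) : J.concomitant x₀ x₀ = 2 * J.conv x₀ := by
  simp [concomitant, zeroSol_self, dzeroSol_self]
  ring

theorem norm_sq_y (x : ℝ) : ‖J.y x‖ ^ 2 = J.n x := by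
  rw [n, ← Complex.normSq_eq_conj_mul_self, Complex.ofReal_re, Complex.normSq_eq_norm_sq]

theorem norm_sq_dy (x : ℝ) : ‖J.dy x‖ ^ 2 = J.v x := by
  rw [v, ← Complex.normSq_eq_conj_mul_self, Complex.ofReal_re, Complex.normSq_eq_norm_sq]

theorem abs_im_conj_mul_le (u z : ℂ) : |(conj u * z).im| ≤ ‖u‖ * ‖z‖ := by
  simpa using Complex.abs_im_le_norm (conj u * z)

theorem tendsto_concomitant (x₀ : ℝ) : Tendsto (J.concomitant x₀) atTop (𝓝 0) := by
  -- Both |y|² and |y'|² tend to 1, so eventually |y|, |y'| ≤ 2, and K bounds `zeroSol` and its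
  -- derivative.
  set K := ‖J.y x₀‖ * 2 with hK
  have hlim : Tendsto (fun x => |J.conv x| * (6 * K ^ 2) + 2 * |J.conv₁ x| * K ^ 2
      + |J.conv₂ x| * K ^ 2) atTop (𝓝 0) := by
    have h := ((J.tendsto_conv.abs.mul_const (6 * K ^ 2)).add
      ((J.tendsto_conv₁.abs.const_mul 2).mul_const (K ^ 2))).add
      (J.tendsto_conv₂.abs.mul_const (K ^ 2))
    simpa using h
  refine squeeze_zero_norm' ?_ hlim
  filter_upwards [J.tendsto_n.eventually_lt_const (show (1 : ℝ) < 4 by norm_num),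
    J.tendsto_v.eventually_lt_const (show (1 : ℝ) < 4 by norm_num),
    (tendsto_potential (δ := δ)).abs.eventually_lt_const (show |(1 : ℝ)| < 2 by norm_num)]
    with x hn hv hp
  have hy : ‖J.y x‖ ≤ 2 := by
    rw [← norm_sq_y] at hn; nlinarith [norm_nonneg (J.y x)]
  have hdy : ‖J.dy x‖ ≤ 2 := by
    rw [← norm_sq_dy] at hv; nlinarith [norm_nonneg (J.dy x)]
  have hz : |J.zeroSol x₀ x| ≤ K :=
    (abs_im_conj_mul_le _ _).trans (mul_le_mul_of_nonneg_left hy (norm_nonneg _))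
  have hd : |J.dzeroSol x₀ x| ≤ K :=
    (abs_im_conj_mul_le _ _).trans (mul_le_mul_of_nonneg_left hdy (norm_nonneg _))
  have hK0 : 0 ≤ K := (abs_nonneg _).trans hz
  have hz2 : J.zeroSol x₀ x ^ 2 ≤ K ^ 2 := sq_le_sq' (neg_le_of_abs_le hz) (le_of_abs_le hz)
  have hd2 : J.dzeroSol x₀ x ^ 2 ≤ K ^ 2 := sq_le_sq' (neg_le_of_abs_le hd) (le_of_abs_le hd)
  have hzd : |J.zeroSol x₀ x * J.dzeroSol x₀ x| ≤ K ^ 2 := by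
    rw [abs_mul, pow_two]
    exact mul_le_mul hz hd (abs_nonneg _) hK0
  have h1 : |2 * J.dzeroSol x₀ x ^ 2 + 2 * potential δ x * J.zeroSol x₀ x ^ 2| ≤ 6 * K ^ 2 := by
    refine (abs_add_le _ _).trans ?_
    rw [abs_mul, abs_mul, abs_mul, abs_two, abs_sq, abs_sq]
    nlinarith [mul_le_mul hp.le hz2 (sq_nonneg _) zero_le_two]
  rw [Real.norm_eq_abs, concomitant]
  refine (abs_add_le _ _).trans (add_le_add ((abs_sub _ _).trans (add_le_add ?_ ?_)) ?_)
  · rw [abs_mul]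
    exact mul_le_mul_of_nonneg_left h1 (abs_nonneg _)
  · rw [abs_mul, abs_mul, abs_two]
    exact mul_le_mul_of_nonneg_left hzd (by positivity)
  · rw [abs_mul, abs_sq]
    exact mul_le_mul_of_nonneg_left hz2 (abs_nonneg _)

theorem continuousOn_conv : ContinuousOn J.conv (Set.Ioi 0) := fun _ hx =>
  (J.hasDerivAt_conv hx).continuousAt.continuousWithinAt

/-- `conv` has no zeros unless it vanishes identically. -/
theorem conv_sign (hδ : δ * (δ + 2) ≠ 0) {x : ℝ} (hx : 0 < x) :
    0 < δ * (δ + 2) * J.conv x := by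
  set σ := δ * (δ + 2) with hσ
  have hlim : Tendsto (fun x => σ * (x ^ 4 * J.conv x)) atTop (𝓝 (σ * (3 * δ * (δ + 2)))) :=
    J.tendsto_pow_four_mul_conv.const_mul σ
  have hpos : 0 < σ * (3 * δ * (δ + 2)) := by
    rw [show σ * (3 * δ * (δ + 2)) = 3 * σ ^ 2 by rw [hσ]; ring]
    -- Near infinity σ · conv is positive, so any violation of the sign has a last point x₀.
    positivity
  obtain ⟨X, hX⟩ := eventually_atTop.1 (hlim.eventually_const_lt hpos)
  by_contra hneg
  push Not at hneg
  -- the last point where the sign is wrong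
  obtain ⟨x₀, hx₀, hle, hgt⟩ : ∃ x₀, 0 < x₀ ∧ σ * J.conv x₀ ≤ 0 ∧
      ∀ z, x₀ < z → 0 < σ * J.conv z := by
    set S := {z | z ∈ Set.Icc x (max X x) ∧ σ * J.conv z ≤ 0} with hS
    have hsub : Set.Icc x (max X x) ⊆ Set.Ioi 0 := fun z hz => hx.trans_le hz.1
    have hcl : IsClosed S := by
      have := (continuousOn_const (c := σ)).mul (J.continuousOn_conv.mono hsub)
      exact this.preimage_isClosed_of_isClosed isClosed_Icc isClosed_Iic
    have hc : IsCompact S := isCompact_Icc.of_isClosed_subset hcl fun z hz => hz.1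
    obtain ⟨x₀, hmem, hmax⟩ := hc.exists_isGreatest ⟨x, ⟨le_rfl, le_max_right _ _⟩, hneg⟩
    refine ⟨x₀, hsub hmem.1, hmem.2, fun z hz => ?_⟩
    by_contra hcon
    push Not at hcon
    have hz0 : 0 < z := (hsub hmem.1).trans hz
    by_cases hzX : z ≤ max X x
    · exact absurd (hmax ⟨⟨hmem.1.1.trans hz.le, hzX⟩, hcon⟩) (not_le.2 hz)
    · have h1 := hX z ((le_max_left _ _).trans (not_le.1 hzX).le)
      have h2 : 0 ≤ z ^ 4 := by positivity
      nlinarith [mul_nonneg h2 (neg_nonneg.2 hcon)]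
  have hder : ∀ z ∈ Set.Ici x₀, HasDerivAt (fun z => σ * J.concomitant x₀ z)
      (σ * (-16 * z⁻¹ * J.conv z * J.zeroSol x₀ z ^ 2)) z := fun z hz =>
    (J.hasDerivAt_concomitant x₀ (hx₀.trans_le hz)).const_mul σ
  have hnonpos : ∀ z, x₀ < z → σ * (-16 * z⁻¹ * J.conv z * J.zeroSol x₀ z ^ 2) ≤ 0 := by
    intro z hz
    have h1 := hgt z hz
    have h2 : 0 < z⁻¹ := inv_pos.2 (hx₀.trans hz)
    have h3 := mul_nonneg (mul_nonneg h1.le h2.le) (sq_nonneg (J.zeroSol x₀ z))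
    linarith
  have hanti : AntitoneOn (fun z => σ * J.concomitant x₀ z) (Set.Ici x₀) := by
    refine antitoneOn_of_deriv_nonpos (convex_Ici _)
      (fun z hz => (hder z hz).continuousAt.continuousWithinAt)
      (fun z hz => (hder z (interior_subset hz)).differentiableAt.differentiableWithinAt) ?_
    intro z hz
    rw [interior_Ici] at hz
    rw [(hder z (Set.mem_Ici_of_Ioi hz)).deriv]
    exact hnonpos z hz
  have hlim0 : Tendsto (fun z => σ * J.concomitant x₀ z) atTop (𝓝 0) := by
    simpa using (J.tendsto_concomitant x₀).const_mul σ
  have hge : ∀ z ∈ Set.Ici x₀, 0 ≤ σ * J.concomitant x₀ z := fun z hz =>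
    le_of_tendsto hlim0 (eventually_atTop.2 ⟨z, fun t ht =>
      hanti hz (Set.mem_Ici.2 (le_trans hz ht)) ht⟩)
  -- At x₀ the concomitant is 2 conv(x₀), of the wrong sign; but beyond x₀ it decreases to 0, hence
  -- is nonnegative after multiplication by σ. It must vanish identically on [x₀, ∞).
  have hle0 : σ * J.concomitant x₀ x₀ ≤ 0 := by
    rw [concomitant_self]; linarith
  have hzero : ∀ z ∈ Set.Ici x₀, σ * J.concomitant x₀ z = 0 := fun z hz =>
    le_antisymm ((hanti Set.self_mem_Ici hz hz).trans hle0) (hge z hz)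
  -- Its derivative then vanishes as well. Since `conv` does not vanish beyond x₀, `zeroSol` does,
  -- which contradicts its slope 1 at x₀.
  have hsol : ∀ z, x₀ < z → J.zeroSol x₀ z = 0 := by
    intro z hz
    have hev : (fun z => σ * J.concomitant x₀ z) =ᶠ[𝓝 z] fun _ => 0 := by
      filter_upwards [Ioi_mem_nhds hz] with t ht using hzero t (Set.mem_Ici_of_Ioi ht)
    have h := (hder z (le_of_lt hz)).deriv
    rw [hev.deriv_eq, deriv_const] at h
    have h1 := hgt z hz
    have h2 : 0 < z⁻¹ := inv_pos.2 (hx₀.trans hz)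
    have h3 : (σ * J.conv z * z⁻¹) * J.zeroSol x₀ z ^ 2 = 0 := by linarith
    simpa [(mul_pos h1 h2).ne'] using h3
  have hdsol : ∀ z, x₀ < z → J.dzeroSol x₀ z = 0 := by
    intro z hz
    have hev : J.zeroSol x₀ =ᶠ[𝓝 z] fun _ => 0 := by
      filter_upwards [Ioi_mem_nhds hz] with t ht using hsol t ht
    have h := (J.hasDerivAt_zeroSol x₀ (hx₀.trans hz)).deriv
    rw [hev.deriv_eq, deriv_const] at h
    exact h.symm
  have hcont : Tendsto (J.dzeroSol x₀) (𝓝[>] x₀) (𝓝 1) := by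
    rw [← J.dzeroSol_self x₀]
    exact (J.hasDerivAt_dzeroSol x₀ hx₀).continuousAt.tendsto.mono_left nhdsWithin_le_nhds
  have hcont' : Tendsto (J.dzeroSol x₀) (𝓝[>] x₀) (𝓝 0) :=
    tendsto_const_nhds.congr' (by
      filter_upwards [self_mem_nhdsWithin] with t ht using (hdsol t ht).symm)
  exact one_ne_zero (tendsto_nhds_unique hcont hcont')

/-- In this case the amplitude `f₀` is affine in w, and x²|y|² is affine in x². -/
theorem conv_eq_zero (hδ : δ * (δ + 2) = 0) {x : ℝ} (hx : 0 < x) : J.conv x = 0 := by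
  obtain ⟨h2, h3⟩ := J.degenerate hδ x⁻¹
  rw [conv_eq J hx]
  simp [s₁, s₂, h2, h3]

/-! ### Solutions at different times -/

/-- The derivative of `x² |y|²` with respect to `x²`. -/
def slope (x : ℝ) : ℝ := J.n x + x * J.b x

theorem hasDerivAt_slope {x : ℝ} (hx : 0 < x) :
    HasDerivAt J.slope (J.conv x / (2 * x)) x := by
  refine ((J.hasDerivAt_n hx).add ((hasDerivAt_id x).mul (J.hasDerivAt_b hx))).congr_deriv ?_
  have := hx.ne'
  simp [conv]
  field_simp
  ring

theorem hasDerivAt_sq_mul_n {x : ℝ} (hx : 0 < x) :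
    HasDerivAt (fun x => x ^ 2 * J.n x) (2 * x * J.slope x) x := by
  refine (((hasDerivAt_id x).pow 2).mul (J.hasDerivAt_n hx)).congr_deriv ?_
  simp [slope]
  ring

theorem tendsto_slope : Tendsto J.slope atTop (𝓝 1) := by
  have h := J.tendsto_n.add J.tendsto_mul_b
  rw [add_zero] at h
  exact h

/-- Rolle's theorem gives a zero of `slope` between the two points. Strict monotonicity of `slope`,
with the sign from `conv_sign`, makes it take opposite signs at x₀ and x₁, whereas equality of
slope/x requires equal signs. In the degenerate case `slope` is constant and equals its limit 1, so
it has no zero. -/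
theorem sq_mul_n_slope_injective {x₀ x₁ : ℝ} (h0 : 0 < x₀) (h01 : x₀ < x₁)
    (hn : x₀ ^ 2 * J.n x₀ = x₁ ^ 2 * J.n x₁) (hs : J.slope x₀ / x₀ = J.slope x₁ / x₁) : False := by
  have h1 : 0 < x₁ := h0.trans h01
  obtain ⟨c, hc, hc0⟩ := exists_hasDerivAt_eq_zero h01
    (fun x hx => (J.hasDerivAt_sq_mul_n (h0.trans_le hx.1)).continuousAt.continuousWithinAt) hn
    (fun x hx => J.hasDerivAt_sq_mul_n (h0.trans hx.1))
  have hcp : 0 < c := h0.trans hc.1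
  have hc0 : J.slope c = 0 := by simpa [hcp.ne'] using hc0
  by_cases hδ : δ * (δ + 2) = 0
  · have hev : ∀ x ∈ Set.Ioi (0 : ℝ), J.slope x = J.slope c := by
      intro x hx
      refine (isOpen_Ioi.is_const_of_deriv_eq_zero isPreconnected_Ioi
        (fun x hx => (J.hasDerivAt_slope hx).differentiableAt.differentiableWithinAt) ?_ hx hcp)
      intro z hz
      rw [(J.hasDerivAt_slope hz).deriv, J.conv_eq_zero hδ hz]
      simp
    have : Tendsto J.slope atTop (𝓝 0) := tendsto_const_nhds.congr' (by
      filter_upwards [eventually_gt_atTop 0] with x hx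
      rw [hev x hx, hc0])
    exact one_ne_zero (tendsto_nhds_unique J.tendsto_slope this)
  · set σ := δ * (δ + 2) with hσ
    have hmono : StrictMonoOn (fun x => σ * J.slope x) (Set.Ioi 0) := by
      refine strictMonoOn_of_deriv_pos (convex_Ioi _) (fun x hx =>
        ((J.hasDerivAt_slope hx).const_mul σ).continuousAt.continuousWithinAt) ?_
      intro x hx
      rw [interior_Ioi] at hx
      have hx : 0 < x := hx
      rw [((J.hasDerivAt_slope hx).const_mul σ).deriv, ← mul_div_assoc]
      exact div_pos (J.conv_sign hδ hx) (by positivity)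
    have ha : σ * J.slope x₀ < 0 := by
      have := hmono h0 hcp hc.1
      simpa [hc0] using this
    have hb : 0 < σ * J.slope x₁ := by
      have := hmono hcp h1 hc.2
      simpa [hc0] using this
    have e : σ * J.slope x₀ / x₀ = σ * J.slope x₁ / x₁ := by
      rw [mul_div_assoc, hs, mul_div_assoc]
    have h2 : σ * J.slope x₀ / x₀ < 0 := div_neg_of_neg_of_pos ha h0
    have h3 : 0 < σ * J.slope x₁ / x₁ := div_pos hb h1
    linarith

/-- The mode function `x y`. -/
def mode (x : ℝ) : ℂ := x * J.y x

/-- Its derivative. -/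
def dmode (x : ℝ) : ℂ := J.y x + x * J.dy x

theorem hasDerivAt_mode {x : ℝ} (hx : 0 < x) : HasDerivAt J.mode (J.dmode x) x := by
  have hid : HasDerivAt (fun x : ℝ => (x : ℂ)) 1 x := by
    simpa using (hasDerivAt_id (x : ℂ)).comp_ofReal
  refine (hid.mul (J.hasDerivAt_y hx)).congr_deriv ?_
  simp [dmode]

theorem hasDerivAt_dmode {x : ℝ} (hx : 0 < x) :
    HasDerivAt J.dmode (2 / x * J.dmode x - (1 + (δ + 2) / x ^ 2) * J.mode x) x := by
  have hid : HasDerivAt (fun x : ℝ => (x : ℂ)) 1 x := by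
    simpa using (hasDerivAt_id (x : ℂ)).comp_ofReal
  refine ((J.hasDerivAt_y hx).add (hid.mul (J.hasDerivAt_dy hx))).congr_deriv ?_
  have : (x : ℂ) ≠ 0 := by exact_mod_cast hx.ne'
  simp [dmode, mode, potential]
  field_simp
  ring

theorem conj_mode_mul_dmode (x : ℝ) :
    conj (J.mode x) * J.dmode x = (x * J.slope x : ℝ) + Complex.I * (x ^ 2 : ℝ) := by
  have h1 : conj (J.y x) * J.y x = (J.n x : ℂ) := by
    rw [Complex.conj_mul', ← J.norm_sq_y]; push_cast; rfl
  have h2 : conj (J.y x) * J.dy x = (J.b x : ℂ) + Complex.I := by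
    apply Complex.ext
    · simp [b]
    · rw [J.wronskian]; simp
  simp only [mode, dmode, map_mul, Complex.conj_ofReal, slope]
  push_cast
  linear_combination (x : ℂ) * h1 + (x : ℂ) ^ 2 * h2

theorem conj_mode_mul_mode (x : ℝ) : conj (J.mode x) * J.mode x = (x ^ 2 * J.n x : ℝ) := by
  rw [Complex.conj_mul', mode, norm_mul, ← J.norm_sq_y, Complex.norm_real, Real.norm_eq_abs,
    ← sq_abs x]
  push_cast
  ring

theorem mode_ne_zero {x : ℝ} (hx : 0 < x) : J.mode x ≠ 0 := by
  intro h
  have := J.conj_mode_mul_mode x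
  rw [h, mul_zero] at this
  have h2 : x ^ 2 * J.n x = 0 := by exact_mod_cast this.symm
  exact (mul_pos (pow_pos hx 2) (J.n_pos x)).ne' h2

/-- No solution returns to its initial ray. -/
theorem mode_mul_dmode_ne {x₀ x₁ : ℝ} (h0 : 0 < x₀) (h1 : 0 < x₁) (hne : x₀ ≠ x₁) :
    J.mode x₀ * (J.dmode x₁ / (x₁ ^ 2 : ℝ)) ≠ J.mode x₁ * (J.dmode x₀ / (x₀ ^ 2 : ℝ)) := by
  intro h
  -- The ratio of momentum to amplitude is computed by multiplying with the conjugate amplitude. Its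
  -- imaginary part determines x²|y|², and its real part then determines slope/x.
  have hr : ∀ {x : ℝ}, 0 < x → J.dmode x / (x ^ 2 : ℝ) =
      J.mode x * ((J.slope x / (x ^ 3 * J.n x) : ℝ) + Complex.I * (1 / (x ^ 2 * J.n x) : ℝ)) := by
    intro x hx
    have hm : conj (J.mode x) ≠ 0 := by simpa using J.mode_ne_zero hx
    have hx' : (x : ℂ) ≠ 0 := by exact_mod_cast hx.ne'
    have hn : (J.n x : ℂ) ≠ 0 := by exact_mod_cast (J.n_pos x).ne'
    apply mul_left_cancel₀ hm
    rw [← mul_div_assoc, ← mul_assoc, conj_mode_mul_dmode, conj_mode_mul_mode]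
    push_cast
    field_simp
  rw [hr h0, hr h1, mul_left_comm] at h
  have h := mul_left_cancel₀ (J.mode_ne_zero h1) h
  have h := mul_left_cancel₀ (J.mode_ne_zero h0) h
  have hre := congrArg Complex.re h
  have him := congrArg Complex.im h
  simp only [Complex.add_re, Complex.add_im, Complex.ofReal_re, Complex.ofReal_im, Complex.mul_re,
    Complex.mul_im, Complex.I_re, Complex.I_im, zero_mul, one_mul, mul_zero, sub_zero, zero_add,
    add_zero] at hre him
  have hN : x₁ ^ 2 * J.n x₁ = x₀ ^ 2 * J.n x₀ := by
    simpa only [one_div, inv_inj] using him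
  have hN0 : x₀ ^ 2 * J.n x₀ ≠ 0 := (mul_pos (pow_pos h0 2) (J.n_pos x₀)).ne'
  have hS : J.slope x₁ / x₁ = J.slope x₀ / x₀ := by
    have e : ∀ x : ℝ, J.slope x / (x ^ 3 * J.n x) = J.slope x / x / (x ^ 2 * J.n x) := fun x => by
      rw [div_div]; ring_nf
    rw [e, e, hN] at hre
    exact (div_left_inj' hN0).1 hre
  rcases lt_or_gt_of_ne hne with hlt | hlt
  · exact J.sq_mul_n_slope_injective h0 hlt hN.symm hS.symm
  · exact J.sq_mul_n_slope_injective h1 hlt hN hS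

end JostSolution

/-! ## The Bunch–Davies amplitude -/

theorem index_sq (p : Params) :
    index p ^ 2 = ((9 / 4 - p.m ^ 2 / p.H ^ 2 - 12 * p.ξ : ℝ) : ℂ) := by
  rw [index, one_div]
  exact Complex.cpow_ofNat_inv_pow _ 2

theorem index_re_nonneg (p : Params) : 0 ≤ (index p).re := by
  rw [index]
  generalize ((9 / 4 - p.m ^ 2 / p.H ^ 2 - 12 * p.ξ : ℝ) : ℂ) = r
  by_cases hr : r = 0
  · simp [hr]
  rw [Complex.cpow_def_of_ne_zero hr, Complex.exp_re]
  refine mul_nonneg (Real.exp_pos _).le ?_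
  have h : (Complex.log r * (1 / 2)).im = Complex.arg r / 2 := by
    simp [Complex.log_im]
    ring
  rw [h]
  exact Real.cos_nonneg_of_neg_pi_div_two_le_of_le
    (by linarith [Complex.neg_pi_lt_arg r]) (by linarith [Complex.arg_le_pi r])

/-- The coefficient `1/4 - μ²` in the Jost equation. -/
def jostCoeff (p : Params) : ℝ := p.m ^ 2 / p.H ^ 2 + 12 * p.ξ - 2

theorem index_mul (p : Params) :
    (index p - 1 / 2) * (index p - 1 / 2 + 1) = -(jostCoeff p : ℂ) := by
  have h := index_sq p
  rw [jostCoeff]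
  push_cast at h ⊢
  linear_combination h

theorem index_sub_half_re (p : Params) : -1 < (index p - 1 / 2).re := by
  have := index_re_nonneg p
  simp only [Complex.sub_re, Complex.div_ofNat_re, Complex.one_re]
  linarith

/-- The Jost solution given by the Hankel function. -/
def hankelJost (p : Params) : JostSolution (jostCoeff p) where
  f₀ w := hankelIntegral (index p - 1 / 2) (index p - 1 / 2) w /
    Complex.Gamma (index p - 1 / 2 + 1)
  f₁ w := Complex.I * (index p - 1 / 2) / 2 *
    hankelIntegral (index p - 1 / 2 + 1) (index p - 1 / 2 - 1) w /
    Complex.Gamma (index p - 1 / 2 + 1)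
  f₂ w := Complex.I * (index p - 1 / 2) / 2 * (Complex.I * (index p - 1 / 2 - 1) / 2 *
    hankelIntegral (index p - 1 / 2 + 1 + 1) (index p - 1 / 2 - 1 - 1) w) /
    Complex.Gamma (index p - 1 / 2 + 1)
  f₃ w := Complex.I * (index p - 1 / 2) / 2 * (Complex.I * (index p - 1 / 2 - 1) / 2 *
    (Complex.I * (index p - 1 / 2 - 1 - 1) / 2 *
    hankelIntegral (index p - 1 / 2 + 1 + 1 + 1) (index p - 1 / 2 - 1 - 1 - 1) w)) /
    Complex.Gamma (index p - 1 / 2 + 1)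
  deriv₀ w := (hasDerivAt_hankelIntegral _ (index_sub_half_re p) w).div_const _
  deriv₁ w := ((hasDerivAt_hankelIntegral _ (by
    have := index_sub_half_re p
    rw [Complex.add_re, Complex.one_re]; linarith) w).const_mul _).div_const _
  deriv₂ w := (((hasDerivAt_hankelIntegral _ (by
    have := index_sub_half_re p
    rw [Complex.add_re, Complex.add_re, Complex.one_re]; linarith) w).const_mul _).const_mul
      _).div_const _
  cont₃ := by
    have : Continuous
        (hankelIntegral (index p - 1 / 2 + 1 + 1 + 1) (index p - 1 / 2 - 1 - 1 - 1)) :=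
      continuous_iff_continuousAt.2 fun w => (hasDerivAt_hankelIntegral _ (by
        have := index_sub_half_re p
        rw [Complex.add_re, Complex.add_re, Complex.add_re, Complex.one_re]; linarith)
        w).continuousAt
    exact ((((this.const_mul _).const_mul _).const_mul _).div_const _)
  init := by
    rw [hankelIntegral_zero _ (index_sub_half_re p)]
    refine div_self (Complex.Gamma_ne_zero_of_re_pos ?_)
    have := index_sub_half_re p
    rw [Complex.add_re, Complex.one_re]
    linarith
  ode w := by
    have h := hankelIntegral_relation (index_sub_half_re p) w
    have hm := index_mul p
    generalize index p - 1 / 2 = a at *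
    have e : (jostCoeff p : ℂ) = -(a * (a + 1)) := by rw [hm, neg_neg]
    rw [e, show a + 1 + 1 = a + 2 by ring, show a - 1 - 1 = a - 2 by ring]
    generalize Complex.Gamma (a + 1) = G
    linear_combination (a / G) * h + ((w : ℂ) ^ 2 * a * (a - 1) / 4 *
      hankelIntegral (a + 2) (a - 2) w / G - a * hankelIntegral (a + 1) (a - 1) w / G) *
      Complex.I_sq
  -- With a = μ - 1/2, δ(δ+2) = (a-1) a (a+1) (a+2). The last two factors are nonzero because Re a >
  -- -1, so a (a-1) = 0, and this product is a common factor of `f₂` and `f₃`.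
  degenerate hδ w := by
    have hm := index_mul p
    have hre := index_sub_half_re p
    generalize index p - 1 / 2 = a at *
    have hne : ∀ c : ℝ, 1 ≤ c → a + c ≠ 0 := fun c hc h0 => by
      have := congrArg Complex.re h0
      rw [Complex.add_re, Complex.ofReal_re, Complex.zero_re] at this
      linarith
    have h1 := hne 1 le_rfl
    have h2 := hne 2 one_le_two
    have h : (a * (a - 1)) * ((a + (1 : ℝ)) * (a + (2 : ℝ))) = 0 := by
      have : (jostCoeff p : ℂ) * (jostCoeff p + 2) = 0 := by exact_mod_cast hδ
      push_cast
      rw [show (jostCoeff p : ℂ) = -(a * (a + 1)) by rw [hm, neg_neg]] at this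
      linear_combination this
    have h := (mul_eq_zero.1 h).resolve_right (mul_ne_zero h1 h2)
    constructor
    · linear_combination (Complex.I * Complex.I / 4 *
        hankelIntegral (a + 1 + 1) (a - 1 - 1) w / Complex.Gamma (a + 1)) * h
    · linear_combination (Complex.I * Complex.I / 4 * (Complex.I * (a - 1 - 1) / 2 *
        hankelIntegral (a + 1 + 1 + 1) (a - 1 - 1 - 1) w) / Complex.Gamma (a + 1)) * h

/-! ### Amplitude and momentum of the modes in terms of the Jost solution -/

theorem hankel1_eq (p : Params) (x : ℝ) :
    hankel1 (index p) x = (Real.sqrt (2 / (Real.pi * x)) : ℂ) *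
      Complex.exp (-Complex.I * (index p * Real.pi / 2 + Real.pi / 4)) * (hankelJost p).y x := by
  have hi : (∫ t in Set.Ioi (0 : ℝ), Complex.exp (-t) * (t : ℂ) ^ (index p - 1 / 2)
        * (1 + Complex.I * t / (2 * x)) ^ (index p - 1 / 2)) =
      hankelIntegral (index p - 1 / 2) (index p - 1 / 2) x⁻¹ := by
    refine integral_congr_ae (ae_of_all _ fun t => ?_)
    simp only [hankelKernel]
    congr 3
    push_cast
    field_simp
  rw [hankel1, hi, JostSolution.y, hankelJost,
    show Complex.I * (x - index p * Real.pi / 2 - Real.pi / 4) =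
      -Complex.I * (index p * Real.pi / 2 + Real.pi / 4) + Complex.I * x by ring,
    Complex.exp_add, show index p + 1 / 2 = index p - 1 / 2 + 1 by ring]
  ring

/-- The constant prefactor of the Bunch–Davies amplitudes. -/
def bdConst (p : Params) : ℂ :=
  (p.H / Real.sqrt (2 * p.V₀) : ℝ) *
    (Complex.exp (-Complex.I * (index p * Real.pi / 2 + Real.pi / 4)) *
      (Real.exp (-(Real.pi * (index p).im) / 2) : ℂ))

/-- The modulus of e^{-iπμ/2} is e^{π Im μ/2}, which the normalization factor of the modes cancels;
this is where imaginary μ is brought on a par with real μ. -/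
theorem conj_bdConst_mul (p : Params) :
    conj (bdConst p) * bdConst p = (p.H ^ 2 / (2 * p.V₀) : ℝ) := by
  have hV := p.V₀_pos
  have h1 : ‖Complex.exp (-Complex.I * (index p * Real.pi / 2 + Real.pi / 4)) *
      (Real.exp (-(Real.pi * (index p).im) / 2) : ℂ)‖ = 1 := by
    rw [norm_mul, Complex.norm_exp, Complex.norm_real, Real.norm_eq_abs, Real.abs_exp,
      ← Real.exp_add, Real.exp_eq_one_iff]
    simp
    ring
  rw [Complex.conj_mul', bdConst, norm_mul, h1, mul_one, Complex.norm_real, Real.norm_eq_abs,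
    ← Complex.ofReal_pow, sq_abs, div_pow, Real.sq_sqrt (by positivity)]

theorem bdConst_ne_zero (p : Params) : bdConst p ≠ 0 := by
  intro h
  have h1 := conj_bdConst_mul p
  rw [h, mul_zero] at h1
  have h2 : p.H ^ 2 / (2 * p.V₀) = 0 := by exact_mod_cast h1.symm
  have := p.H_pos
  have := p.V₀_pos
  exact (show p.H ^ 2 / (2 * p.V₀) ≠ 0 by positivity) h2

/-- The square roots from the scale factor and from the Hankel function combine to κ^{-3/2} times x
= -κη. Time enters only through x, which is the source of both the dilation covariance and the
reduction of all wave numbers to one function. -/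
theorem bdAmp_eq (p : Params) {κ η : ℝ} (hκ : 0 < κ) (hη : η < 0) :
    bdAmp p κ η = bdConst p * ((Real.sqrt κ)⁻¹ ^ 3 : ℝ) * (hankelJost p).mode (-(κ * η)) := by
  have hH := p.H_pos
  have hV := p.V₀_pos
  have hx : 0 < -(κ * η) := by nlinarith
  have hs : Real.sqrt (-(Real.pi * η) / (p.V₀ * 4 * scaleFactor p η ^ 2)) *
      Real.sqrt (2 / (Real.pi * -(κ * η))) =
      p.H / Real.sqrt (2 * p.V₀) * (Real.sqrt κ)⁻¹ ^ 3 * (-(κ * η)) := by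
    have hpi := Real.pi_pos
    have hη' : η ≠ 0 := hη.ne
    have e1 : -(Real.pi * η) / (p.V₀ * 4 * scaleFactor p η ^ 2) * (2 / (Real.pi * -(κ * η))) =
        (p.H * (-η)) ^ 2 / (2 * p.V₀ * κ) := by
      rw [scaleFactor]
      field_simp
      ring
    have hneg : 0 < -η := by linarith
    have hnn : 0 ≤ -(Real.pi * η) / (p.V₀ * 4 * scaleFactor p η ^ 2) :=
      div_nonneg (by nlinarith) (by positivity)
    rw [← Real.sqrt_mul hnn, e1, Real.sqrt_div (sq_nonneg _), Real.sqrt_sq (by positivity),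
      Real.sqrt_mul (by positivity)]
    have hk : Real.sqrt κ ^ 2 = κ := Real.sq_sqrt hκ.le
    have hk0 : Real.sqrt κ ≠ 0 := (Real.sqrt_pos.2 hκ).ne'
    have hv0 : Real.sqrt (2 * p.V₀) ≠ 0 := (Real.sqrt_pos.2 (by positivity)).ne'
    field_simp
    rw [hk]
  have hs' : (Real.sqrt (-(Real.pi * η) / (p.V₀ * 4 * scaleFactor p η ^ 2)) : ℂ) *
      (Real.sqrt (2 / (Real.pi * -(κ * η))) : ℂ) =
      ((p.H / Real.sqrt (2 * p.V₀) * (Real.sqrt κ)⁻¹ ^ 3 * (-(κ * η)) : ℝ) : ℂ) := by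
    rw [← hs]; push_cast; rfl
  rw [bdAmp, hankel1_eq, bdConst, JostSolution.mode]
  generalize (hankelJost p).y (-(κ * η)) = y
  generalize Complex.exp (-Complex.I * (index p * Real.pi / 2 + Real.pi / 4)) = u
  generalize (Real.exp (-(Real.pi * (index p).im) / 2) : ℂ) = r
  rw [Complex.ofReal_mul, Complex.ofReal_mul] at hs'
  linear_combination (r * u * y) * hs'

/-- The momentum amplitude of the Bunch–Davies modes. -/
def bdMom (p : Params) (κ η : ℝ) : ℂ :=
  ((p.V₀ * scaleFactor p η ^ 2 : ℝ) : ℂ) * deriv (bdAmp p κ) η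

theorem hasDerivAt_neg_mul (κ η : ℝ) : HasDerivAt (fun η => -(κ * η)) (-κ) η := by
  exact (((hasDerivAt_id η).const_mul κ).neg).congr_deriv (by simp)

theorem hasDerivAt_bdAmp' (p : Params) {κ η : ℝ} (hκ : 0 < κ) (hη : η < 0) :
    HasDerivAt (bdAmp p κ) (-(κ : ℂ) * (bdConst p * ((Real.sqrt κ)⁻¹ ^ 3 : ℝ) *
      (hankelJost p).dmode (-(κ * η)))) η := by
  have hx : 0 < -(κ * η) := by nlinarith
  have h := (((hankelJost p).hasDerivAt_mode hx).scomp η (hasDerivAt_neg_mul κ η)).const_mul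
    (bdConst p * ((Real.sqrt κ)⁻¹ ^ 3 : ℝ))
  refine (h.congr_of_eventuallyEq ?_).congr_deriv ?_
  · filter_upwards [Iio_mem_nhds hη] with t ht using bdAmp_eq p hκ ht
  · simp
    ring

theorem bdMom_eq (p : Params) {κ η : ℝ} (hκ : 0 < κ) (hη : η < 0) :
    bdMom p κ η = -((p.V₀ / p.H ^ 2 : ℝ) : ℂ) * bdConst p * ((Real.sqrt κ) ^ 3 : ℝ) *
      ((hankelJost p).dmode (-(κ * η)) / ((-(κ * η)) ^ 2 : ℝ)) := by
  have hH := p.H_pos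
  have hk : (Real.sqrt κ : ℂ) ^ 2 = κ := by exact_mod_cast Real.sq_sqrt hκ.le
  have hk0 : (Real.sqrt κ : ℂ) ≠ 0 := by exact_mod_cast (Real.sqrt_pos.2 hκ).ne'
  have hη' : (η : ℂ) ≠ 0 := by exact_mod_cast hη.ne
  have hH' : (p.H : ℂ) ≠ 0 := by exact_mod_cast hH.ne'
  rw [bdMom, (hasDerivAt_bdAmp' p hκ hη).deriv, scaleFactor]
  generalize (hankelJost p).dmode (-(κ * η)) = y
  push_cast
  rw [← hk]
  field_simp

theorem hasDerivAt_bdAmp (p : Params) {κ η : ℝ} (hκ : 0 < κ) (hη : η < 0) :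
    HasDerivAt (bdAmp p κ) (bdMom p κ η / ((p.V₀ * scaleFactor p η ^ 2 : ℝ) : ℂ)) η := by
  have h := hasDerivAt_bdAmp' p hκ hη
  have h0 : ((p.V₀ * scaleFactor p η ^ 2 : ℝ) : ℂ) ≠ 0 := by
    have := p.V₀_pos
    have := p.H_pos
    have := hη.ne
    rw [scaleFactor]
    exact_mod_cast (show p.V₀ * (-1 / (p.H * η)) ^ 2 ≠ 0 by
      refine mul_ne_zero p.V₀_pos.ne' (pow_ne_zero _ (div_ne_zero (by norm_num) ?_))
      exact mul_ne_zero p.H_pos.ne' hη.ne)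
  rw [bdMom, h.deriv, mul_div_cancel_left₀ _ h0]
  exact h

theorem ricci_eq (p : Params) {η : ℝ} (hη : η < 0) : ricci p η = 12 * p.H ^ 2 := by
  have hH := p.H_pos.ne'
  have h1 : ∀ t : ℝ, t ≠ 0 → HasDerivAt (scaleFactor p) (p.H⁻¹ * t⁻¹ ^ 2) t := by
    intro t ht
    have h := (hasDerivAt_inv ht).const_mul (-p.H⁻¹)
    refine (h.congr_of_eventuallyEq (Eventually.of_forall fun s => ?_)).congr_deriv ?_
    · simp only [scaleFactor]
      rw [neg_div, one_div, mul_inv]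
      ring
    · field_simp
  have h2 : HasDerivAt (deriv (scaleFactor p)) (p.H⁻¹ * (-2 * η⁻¹ ^ 3)) η := by
    refine ((JostSolution.hasDerivAt_inv_sq hη.ne).const_mul p.H⁻¹).congr_of_eventuallyEq ?_
    filter_upwards [Iio_mem_nhds hη] with t ht using (h1 t (ne_of_lt ht)).deriv
  have := hη.ne
  rw [ricci, h2.deriv, scaleFactor]
  field_simp
  norm_num

theorem hasDerivAt_bdMom (p : Params) {κ η : ℝ} (hκ : 0 < κ) (hη : η < 0) :
    HasDerivAt (bdMom p κ) (-((p.V₀ * scaleFactor p η ^ 2 *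
          (κ ^ 2 + scaleFactor p η ^ 2 * (p.m ^ 2 + p.ξ * ricci p η)) : ℝ) : ℂ)
        * bdAmp p κ η) η := by
  have hx : 0 < -(κ * η) := by nlinarith
  have hid : HasDerivAt (fun x : ℝ => ((x ^ 2 : ℝ) : ℂ)) ((2 * -(κ * η) : ℝ) : ℂ) (-(κ * η)) := by
    have h : HasDerivAt (fun x : ℝ => x ^ 2) (2 * -(κ * η)) (-(κ * η)) := by
      simpa using hasDerivAt_pow 2 (-(κ * η))
    exact h.ofReal_comp
  have hx2 : (((-(κ * η)) ^ 2 : ℝ) : ℂ) ≠ 0 := by exact_mod_cast (pow_pos hx 2).ne'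
  have h := ((((hankelJost p).hasDerivAt_dmode hx).div hid hx2).scomp η
    (hasDerivAt_neg_mul κ η)).const_mul
    (-((p.V₀ / p.H ^ 2 : ℝ) : ℂ) * bdConst p * ((Real.sqrt κ) ^ 3 : ℝ))
  refine (h.congr_of_eventuallyEq ?_).congr_deriv ?_
  · filter_upwards [Iio_mem_nhds hη] with t ht using bdMom_eq p hκ ht
  · have hk : (Real.sqrt κ : ℂ) ^ 2 = κ := by exact_mod_cast Real.sq_sqrt hκ.le
    have hk0 : (Real.sqrt κ : ℂ) ≠ 0 := by exact_mod_cast (Real.sqrt_pos.2 hκ).ne'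
    have hη' : (η : ℂ) ≠ 0 := by exact_mod_cast hη.ne
    have hH' : (p.H : ℂ) ≠ 0 := by exact_mod_cast p.H_pos.ne'
    rw [ricci_eq p hη, bdAmp_eq p hκ hη, scaleFactor]
    generalize (hankelJost p).mode (-(κ * η)) = y
    generalize (hankelJost p).dmode (-(κ * η)) = z
    rw [jostCoeff]
    simp only [Complex.real_smul]
    push_cast
    rw [← hk]
    field_simp
    ring

/-- Normalization of the Bunch–Davies modes. -/
theorem bd_wronskian (p : Params) {κ η : ℝ} (hκ : 0 < κ) (hη : η < 0) :
    Complex.I * (conj (bdAmp p κ η) * bdMom p κ η - conj (bdMom p κ η) * bdAmp p κ η) = 1 := by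
  have hx : 0 < -(κ * η) := by nlinarith
  have hV : (p.V₀ : ℂ) ≠ 0 := by exact_mod_cast p.V₀_pos.ne'
  have hH' : (p.H : ℂ) ≠ 0 := by exact_mod_cast p.H_pos.ne'
  have hk0 : (Real.sqrt κ : ℂ) ≠ 0 := by exact_mod_cast (Real.sqrt_pos.2 hκ).ne'
  have hx0 : ((-(κ * η) : ℝ) : ℂ) ≠ 0 := by exact_mod_cast hx.ne'
  rw [bdAmp_eq p hκ hη, bdMom_eq p hκ hη]
  have h1 := (hankelJost p).conj_mode_mul_dmode (-(κ * η))
  have h2 := congrArg conj h1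
  generalize -(κ * η) = x at *
  simp only [map_mul, map_neg, map_add, map_div₀, Complex.conj_ofReal, Complex.conj_conj,
    Complex.conj_I] at h2 ⊢
  have hc := conj_bdConst_mul p
  have e : Complex.I * (conj (bdConst p) * ((Real.sqrt κ)⁻¹ ^ 3 : ℝ) *
      conj ((hankelJost p).mode x) * (-((p.V₀ / p.H ^ 2 : ℝ) : ℂ) * bdConst p *
        ((Real.sqrt κ) ^ 3 : ℝ) * ((hankelJost p).dmode x / (x ^ 2 : ℝ))) -
      -((p.V₀ / p.H ^ 2 : ℝ) : ℂ) * conj (bdConst p) * ((Real.sqrt κ) ^ 3 : ℝ) *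
        (conj ((hankelJost p).dmode x) / (x ^ 2 : ℝ)) *
        (bdConst p * ((Real.sqrt κ)⁻¹ ^ 3 : ℝ) * (hankelJost p).mode x)) =
      -Complex.I * ((p.V₀ / p.H ^ 2 : ℝ) : ℂ) * (conj (bdConst p) * bdConst p) *
        ((((Real.sqrt κ)⁻¹ ^ 3 : ℝ) : ℂ) * ((Real.sqrt κ) ^ 3 : ℝ)) *
        ((conj ((hankelJost p).mode x) * (hankelJost p).dmode x -
          (hankelJost p).mode x * conj ((hankelJost p).dmode x)) / (x ^ 2 : ℝ)) := by
    ring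
  rw [e, hc, h1, h2]
  push_cast
  field_simp
  ring_nf
  simp [Complex.I_sq]

/-- Scaling of the Bunch–Davies amplitudes. -/
theorem bdAmp_scale (p : Params) {κ η : ℝ} (hκ : 0 < κ) (hη : η < 0) (r : ℝ) :
    bdAmp p (Real.exp (-r) * κ) (Real.exp r * η) = (Real.exp (3 / 2 * r) : ℂ) * bdAmp p κ η := by
  have hr := Real.exp_pos r
  have hr' := Real.exp_pos (-r)
  rw [bdAmp_eq p (by positivity) (by nlinarith), bdAmp_eq p hκ hη,
    show -(Real.exp (-r) * κ * (Real.exp r * η)) = -(κ * η) by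
      rw [Real.exp_neg]; field_simp]
  have hs : (Real.sqrt (Real.exp (-r) * κ))⁻¹ ^ 3 =
      Real.exp (3 / 2 * r) * (Real.sqrt κ)⁻¹ ^ 3 := by
    rw [Real.sqrt_mul hr'.le, ← Real.exp_half, mul_inv, ← Real.exp_neg, mul_pow,
      ← Real.exp_nat_mul]
    congr 2
    push_cast
    ring
  rw [hs]
  push_cast
  ring

theorem bdMom_scale (p : Params) {κ η : ℝ} (hκ : 0 < κ) (hη : η < 0) (r : ℝ) :
    bdMom p (Real.exp (-r) * κ) (Real.exp r * η) =
      (Real.exp (-(3 / 2) * r) : ℂ) * bdMom p κ η := by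
  have hr := Real.exp_pos r
  have hr' := Real.exp_pos (-r)
  rw [bdMom_eq p (by positivity) (by nlinarith), bdMom_eq p hκ hη,
    show -(Real.exp (-r) * κ * (Real.exp r * η)) = -(κ * η) by
      rw [Real.exp_neg]; field_simp]
  have hs : (Real.sqrt (Real.exp (-r) * κ)) ^ 3 =
      Real.exp (-(3 / 2) * r) * (Real.sqrt κ) ^ 3 := by
    rw [Real.sqrt_mul hr'.le, ← Real.exp_half, mul_pow, ← Real.exp_nat_mul]
    congr 2
    push_cast
    ring
  rw [hs]
  push_cast
  ring

/-- The Bunch–Davies amplitude never returns to its initial ray. -/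
theorem bdAmp_mul_bdMom_ne (p : Params) {κ η₀ η₁ : ℝ} (hκ : 0 < κ) (h₀ : η₀ < 0) (h₁ : η₁ < 0)
    (hne : η₁ ≠ η₀) : bdAmp p κ η₀ * bdMom p κ η₁ - bdMom p κ η₀ * bdAmp p κ η₁ ≠ 0 := by
  intro h
  have hx0 : 0 < -(κ * η₀) := by nlinarith
  have hx1 : 0 < -(κ * η₁) := by nlinarith
  have hne' : -(κ * η₀) ≠ -(κ * η₁) := fun h => hne (by
    have := mul_left_cancel₀ hκ.ne' (neg_injective h)
    exact this.symm)
  refine (hankelJost p).mode_mul_dmode_ne hx0 hx1 hne' ?_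
  rw [bdAmp_eq p hκ h₀, bdAmp_eq p hκ h₁, bdMom_eq p hκ h₀, bdMom_eq p hκ h₁] at h
  have hc : ((p.V₀ / p.H ^ 2 : ℝ) : ℂ) * bdConst p ^ 2 ≠ 0 := by
    refine mul_ne_zero ?_ (pow_ne_zero _ (bdConst_ne_zero p))
    exact_mod_cast (div_pos p.V₀_pos (pow_pos p.H_pos 2)).ne'
  have hk : (((Real.sqrt κ)⁻¹ ^ 3 : ℝ) : ℂ) * ((Real.sqrt κ) ^ 3 : ℝ) = 1 := by
    have hk0 : (Real.sqrt κ) ≠ 0 := (Real.sqrt_pos.2 hκ).ne'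
    norm_cast
    field_simp
  apply mul_left_cancel₀ hc
  generalize (hankelJost p).dmode (-(κ * η₀)) / ((-(κ * η₀)) ^ 2 : ℝ) = d0 at *
  generalize (hankelJost p).dmode (-(κ * η₁)) / ((-(κ * η₁)) ^ 2 : ℝ) = d1 at *
  generalize (hankelJost p).mode (-(κ * η₀)) = m0 at *
  generalize (hankelJost p).mode (-(κ * η₁)) = m1 at *
  generalize (((Real.sqrt κ)⁻¹ ^ 3 : ℝ) : ℂ) = s at *
  generalize (((Real.sqrt κ) ^ 3 : ℝ) : ℂ) = t at *
  generalize ((p.V₀ / p.H ^ 2 : ℝ) : ℂ) = q at *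
  linear_combination -h - q * bdConst p ^ 2 * (m0 * d1 - m1 * d0) * hk

/-! ## Bogoliubov coefficients and asymptotics -/

theorem tendsto_expI_mul_mode {δ : ℝ} (J : JostSolution δ) :
    Tendsto (fun x : ℝ => Complex.exp (-(Complex.I * x)) * (J.mode x / x)) atTop (𝓝 1) := by
  have h := JostSolution.tendsto_comp_inv J.cont₀
  rw [J.init] at h
  refine h.congr' ?_
  filter_upwards [eventually_gt_atTop 0] with x hx
  have hx' : (x : ℂ) ≠ 0 := by exact_mod_cast hx.ne'
  rw [JostSolution.mode, mul_div_cancel_left₀ _ hx', JostSolution.y, ← mul_assoc,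
    ← Complex.exp_add, neg_add_cancel, Complex.exp_zero, one_mul]

theorem tendsto_expI_mul_dmode {δ : ℝ} (J : JostSolution δ) :
    Tendsto (fun x : ℝ => Complex.exp (-(Complex.I * x)) * (J.dmode x / x)) atTop
      (𝓝 Complex.I) := by
  have hc0 := J.cont₀
  have hc1 := J.cont₁
  have h := JostSolution.tendsto_comp_inv (g := fun w : ℝ =>
    (w : ℂ) * J.f₀ w + (Complex.I * J.f₀ w - ((w ^ 2 : ℝ) : ℂ) * J.f₁ w)) (by fun_prop)
  simp only [Complex.ofReal_zero, zero_mul, J.init, mul_one, zero_add, ne_eq, OfNat.ofNat_ne_zero,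
    not_false_eq_true, zero_pow, sub_zero] at h
  refine h.congr' ?_
  filter_upwards [eventually_gt_atTop 0] with x hx
  have hx' : (x : ℂ) ≠ 0 := by exact_mod_cast hx.ne'
  have he : Complex.exp (-(Complex.I * x)) * Complex.exp (Complex.I * x) = 1 := by
    rw [← Complex.exp_add, neg_add_cancel, Complex.exp_zero]
  rw [JostSolution.dmode, JostSolution.y, JostSolution.dy, add_div, mul_div_cancel_left₀ _ hx']
  push_cast
  linear_combination (-((x : ℂ)⁻¹ * J.f₀ x⁻¹ + (Complex.I * J.f₀ x⁻¹ -
    ((x : ℂ)⁻¹ ^ 2) * J.f₁ x⁻¹))) * he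

theorem tendsto_dmode_div_mode {δ : ℝ} (J : JostSolution δ) :
    Tendsto (fun x : ℝ => J.dmode x / (Complex.I * J.mode x)) atTop (𝓝 1) := by
  have h := (tendsto_expI_mul_dmode J).div ((tendsto_expI_mul_mode J).const_mul Complex.I)
    (by simp)
  rw [mul_one, div_self Complex.I_ne_zero] at h
  refine h.congr' ?_
  filter_upwards [eventually_gt_atTop 0] with x hx
  have hx' : (x : ℂ) ≠ 0 := by exact_mod_cast hx.ne'
  have he := Complex.exp_ne_zero (-(Complex.I * x))
  have := J.mode_ne_zero hx
  simp only [Pi.div_apply]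
  field_simp

/-- The Bunch–Davies modes approach positive-frequency modes at short wavelengths. -/
theorem tendsto_bdMom_div (p : Params) {η : ℝ} (hη : η < 0) (η' : ℝ) (hη' : η' < 0) :
    Tendsto (fun κ : ℝ => bdMom p κ η /
      (-Complex.I * ((κ * (p.V₀ * scaleFactor p η' ^ 2) : ℝ) : ℂ) * bdAmp p κ η)) atTop
      (𝓝 ((η' ^ 2 / η ^ 2 : ℝ) : ℂ)) := by
  have hlin : Tendsto (fun κ : ℝ => -(κ * η)) atTop atTop := by
    have := tendsto_id.atTop_mul_const (show 0 < -η by linarith)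
    simpa using this
  -- The mode at η is compared with the frequency scale of another time η': the limit is
  -- a²(η)/a²(η') = η'²/η², which equals 1 when the two times agree.
  have h := ((tendsto_dmode_div_mode (hankelJost p)).comp hlin).const_mul
    ((η' ^ 2 / η ^ 2 : ℝ) : ℂ)
  rw [mul_one] at h
  refine h.congr' ?_
  filter_upwards [eventually_gt_atTop 0] with κ hκ
  have hx : 0 < -(κ * η) := by nlinarith
  have hm := (hankelJost p).mode_ne_zero hx
  have hk : (Real.sqrt κ : ℂ) ^ 2 = κ := by exact_mod_cast Real.sq_sqrt hκ.le
  have hk0 : (Real.sqrt κ : ℂ) ≠ 0 := by exact_mod_cast (Real.sqrt_pos.2 hκ).ne'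
  have hc := bdConst_ne_zero p
  have h1 : (η : ℂ) ≠ 0 := by exact_mod_cast hη.ne
  have h2 : (η' : ℂ) ≠ 0 := by exact_mod_cast hη'.ne
  have hH : (p.H : ℂ) ≠ 0 := by exact_mod_cast p.H_pos.ne'
  have hV : (p.V₀ : ℂ) ≠ 0 := by exact_mod_cast p.V₀_pos.ne'
  rw [bdMom_eq p hκ hη, bdAmp_eq p hκ hη, scaleFactor]
  simp only [Function.comp_apply]
  generalize (hankelJost p).mode (-(κ * η)) = y at *
  generalize (hankelJost p).dmode (-(κ * η)) = z at *
  push_cast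
  rw [← hk]
  have := Complex.I_ne_zero
  field_simp

/-- The Bogoliubov coefficient `α`. -/
def bdAlpha (p : Params) (η₀ η₁ κ : ℝ) : ℂ :=
  Complex.I * (conj (bdAmp p κ η₀) * bdMom p κ η₁ - conj (bdMom p κ η₀) * bdAmp p κ η₁)

/-- The Bogoliubov coefficient `β`. -/
def bdBeta (p : Params) (η₀ η₁ κ : ℝ) : ℂ :=
  -Complex.I * (bdAmp p κ η₀ * bdMom p κ η₁ - bdMom p κ η₀ * bdAmp p κ η₁)

theorem bdBeta_ne_zero (p : Params) {κ η₀ η₁ : ℝ} (hκ : 0 < κ) (h₀ : η₀ < 0) (h₁ : η₁ < 0)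
    (hne : η₁ ≠ η₀) : bdBeta p η₀ η₁ κ ≠ 0 :=
  mul_ne_zero (neg_ne_zero.2 Complex.I_ne_zero) (bdAmp_mul_bdMom_ne p hκ h₀ h₁ hne)

theorem bdAlpha_sq_sub_bdBeta_sq (p : Params) {κ η₀ η₁ : ℝ} (hκ : 0 < κ) (h₀ : η₀ < 0)
    (h₁ : η₁ < 0) : ‖bdAlpha p η₀ η₁ κ‖ ^ 2 - ‖bdBeta p η₀ η₁ κ‖ ^ 2 = 1 := by
  have w0 := bd_wronskian p hκ h₀
  have w1 := bd_wronskian p hκ h₁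
  have h : (((‖bdAlpha p η₀ η₁ κ‖ ^ 2 - ‖bdBeta p η₀ η₁ κ‖ ^ 2 : ℝ)) : ℂ) = 1 := by
    push_cast
    rw [← Complex.conj_mul', ← Complex.conj_mul', bdAlpha, bdBeta]
    simp only [map_mul, map_sub, map_neg, Complex.conj_I, Complex.conj_conj]
    generalize bdAmp p κ η₀ = a at *
    generalize bdMom p κ η₀ = b at *
    generalize bdAmp p κ η₁ = c at *
    generalize bdMom p κ η₁ = d at *
    linear_combination (Complex.I * (conj c * d - conj d * c)) * w0 + w1
  exact_mod_cast h

/-- Asymptotics of `β`. -/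
theorem tendsto_bdBeta (p : Params) {η₀ η₁ : ℝ} (h₀ : η₀ < 0) (h₁ : η₁ < 0) :
    Tendsto (fun κ : ℝ => Complex.exp (Complex.I * (κ * (η₀ + η₁))) * bdBeta p η₀ η₁ κ) atTop
      (𝓝 (-((p.V₀ / p.H ^ 2 : ℝ) : ℂ) * bdConst p ^ 2 * ((η₀ / η₁ - η₁ / η₀ : ℝ) : ℂ))) := by
  have hlin : ∀ {η : ℝ}, η < 0 → Tendsto (fun κ : ℝ => -(κ * η)) atTop atTop := fun hη => by
    have := tendsto_id.atTop_mul_const (neg_pos.2 hη)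
    simpa using this
  have m0 := (tendsto_expI_mul_mode (hankelJost p)).comp (hlin h₀)
  have m1 := (tendsto_expI_mul_mode (hankelJost p)).comp (hlin h₁)
  have d0 := (tendsto_expI_mul_dmode (hankelJost p)).comp (hlin h₀)
  have d1 := (tendsto_expI_mul_dmode (hankelJost p)).comp (hlin h₁)
  have h := (((m0.mul d1).mul_const ((η₀ / η₁ : ℝ) : ℂ)).sub
    ((m1.mul d0).mul_const ((η₁ / η₀ : ℝ) : ℂ))).const_mul
    (Complex.I * ((p.V₀ / p.H ^ 2 : ℝ) : ℂ) * bdConst p ^ 2)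
  have e : Complex.I * ((p.V₀ / p.H ^ 2 : ℝ) : ℂ) * bdConst p ^ 2 *
      (1 * Complex.I * ((η₀ / η₁ : ℝ) : ℂ) - 1 * Complex.I * ((η₁ / η₀ : ℝ) : ℂ)) =
      -((p.V₀ / p.H ^ 2 : ℝ) : ℂ) * bdConst p ^ 2 * ((η₀ / η₁ - η₁ / η₀ : ℝ) : ℂ) := by
    push_cast
    linear_combination (((p.V₀ / p.H ^ 2 : ℂ)) * bdConst p ^ 2 * (η₀ / η₁ - η₁ / η₀)) *
      Complex.I_sq
  rw [e] at h
  refine h.congr' ?_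
  filter_upwards [eventually_gt_atTop 0] with κ hκ
  have hk0 : (Real.sqrt κ : ℂ) ≠ 0 := by exact_mod_cast (Real.sqrt_pos.2 hκ).ne'
  have hκ' : (κ : ℂ) ≠ 0 := by exact_mod_cast hκ.ne'
  have g0 : (η₀ : ℂ) ≠ 0 := by exact_mod_cast h₀.ne
  have g1 : (η₁ : ℂ) ≠ 0 := by exact_mod_cast h₁.ne
  have hexp : Complex.exp (Complex.I * (κ * (η₀ + η₁))) =
      Complex.exp (-(Complex.I * (-(κ * η₀) : ℝ))) *
        Complex.exp (-(Complex.I * (-(κ * η₁) : ℝ))) := by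
    rw [← Complex.exp_add]
    congr 1
    push_cast
    ring
  rw [bdBeta, bdMom_eq p hκ h₀, bdAmp_eq p hκ h₀, bdMom_eq p hκ h₁, bdAmp_eq p hκ h₁, hexp]
  simp only [Function.comp_apply]
  generalize Complex.exp (-(Complex.I * (-(κ * η₀) : ℝ))) = E0
  generalize Complex.exp (-(Complex.I * (-(κ * η₁) : ℝ))) = E1
  generalize (hankelJost p).mode (-(κ * η₀)) = y0
  generalize (hankelJost p).dmode (-(κ * η₀)) = z0
  generalize (hankelJost p).mode (-(κ * η₁)) = y1
  generalize (hankelJost p).dmode (-(κ * η₁)) = z1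
  push_cast
  field_simp
  ring

/-- Asymptotics of `α`. -/
theorem tendsto_bdAlpha (p : Params) {η₀ η₁ : ℝ} (h₀ : η₀ < 0) (h₁ : η₁ < 0) :
    Tendsto (fun κ : ℝ => Complex.exp (Complex.I * (κ * (η₁ - η₀))) * bdAlpha p η₀ η₁ κ) atTop
      (𝓝 ((1 / 2 : ℂ) * ((η₀ / η₁ + η₁ / η₀ : ℝ) : ℂ))) := by
  have hlin : ∀ {η : ℝ}, η < 0 → Tendsto (fun κ : ℝ => -(κ * η)) atTop atTop := fun hη => by
    have := tendsto_id.atTop_mul_const (neg_pos.2 hη)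
    simpa using this
  have hstar : Continuous (fun z : ℂ => conj z) := Complex.continuous_conj
  have m0 := (hstar.tendsto _).comp ((tendsto_expI_mul_mode (hankelJost p)).comp (hlin h₀))
  have m1 := (tendsto_expI_mul_mode (hankelJost p)).comp (hlin h₁)
  have d0 := (hstar.tendsto _).comp ((tendsto_expI_mul_dmode (hankelJost p)).comp (hlin h₀))
  have d1 := (tendsto_expI_mul_dmode (hankelJost p)).comp (hlin h₁)
  have h := (((m0.mul d1).mul_const ((η₀ / η₁ : ℝ) : ℂ)).sub
    ((m1.mul d0).mul_const ((η₁ / η₀ : ℝ) : ℂ))).const_mul (-Complex.I / 2)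
  have e : -Complex.I / 2 * (conj 1 * Complex.I * ((η₀ / η₁ : ℝ) : ℂ) -
      1 * conj Complex.I * ((η₁ / η₀ : ℝ) : ℂ)) =
      (1 / 2 : ℂ) * ((η₀ / η₁ + η₁ / η₀ : ℝ) : ℂ) := by
    rw [map_one, Complex.conj_I]
    push_cast
    linear_combination (-(1 / 2 : ℂ) * (η₀ / η₁ + η₁ / η₀)) * Complex.I_sq
  rw [e] at h
  refine h.congr' ?_
  filter_upwards [eventually_gt_atTop 0] with κ hκ
  have hk0 : (Real.sqrt κ : ℂ) ≠ 0 := by exact_mod_cast (Real.sqrt_pos.2 hκ).ne'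
  have hκ' : (κ : ℂ) ≠ 0 := by exact_mod_cast hκ.ne'
  have g0 : (η₀ : ℂ) ≠ 0 := by exact_mod_cast h₀.ne
  have g1 : (η₁ : ℂ) ≠ 0 := by exact_mod_cast h₁.ne
  have hH : (p.H : ℂ) ≠ 0 := by exact_mod_cast p.H_pos.ne'
  have hV : (p.V₀ : ℂ) ≠ 0 := by exact_mod_cast p.V₀_pos.ne'
  have hexp : Complex.exp (Complex.I * (κ * (η₁ - η₀))) =
      conj (Complex.exp (-(Complex.I * (-(κ * η₀) : ℝ)))) *
        Complex.exp (-(Complex.I * (-(κ * η₁) : ℝ))) := by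
    rw [← Complex.exp_conj, ← Complex.exp_add]
    congr 1
    simp only [map_neg, map_mul, Complex.conj_I, Complex.conj_ofReal]
    push_cast
    ring
  have hc := conj_bdConst_mul p
  have hc' : (p.V₀ : ℂ) / p.H ^ 2 * (conj (bdConst p) * bdConst p) = 1 / 2 := by
    rw [hc]
    push_cast
    field_simp
  have hs : ((Real.sqrt κ : ℂ)⁻¹) ^ 3 * (Real.sqrt κ : ℂ) ^ 3 = 1 := by
    field_simp
  rw [bdAlpha, bdMom_eq p hκ h₀, bdAmp_eq p hκ h₀, bdMom_eq p hκ h₁, bdAmp_eq p hκ h₁, hexp]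
  simp only [Function.comp_apply]
  generalize Complex.exp (-(Complex.I * (-(κ * η₀) : ℝ))) = E0
  generalize Complex.exp (-(Complex.I * (-(κ * η₁) : ℝ))) = E1
  generalize (hankelJost p).mode (-(κ * η₀)) = y0
  generalize (hankelJost p).dmode (-(κ * η₀)) = z0
  generalize (hankelJost p).mode (-(κ * η₁)) = y1
  generalize (hankelJost p).dmode (-(κ * η₁)) = z1
  simp only [map_mul, map_div₀, map_neg, Complex.conj_ofReal]
  push_cast
  generalize conj (bdConst p) = cc at *
  generalize bdConst p = c at *
  -- The weights η₀/η₁ and η₁/η₀ turn the factor 1/(x₀x₁) of the two limits into the 1/x₁² and 1/x₀²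
  -- carried by the momenta.
  have t1 : conj E0 * (conj y0 / -(κ * η₀)) * (E1 * (z1 / -(κ * η₁))) * ((η₀ : ℂ) / η₁) =
      conj E0 * E1 * conj y0 * z1 / (-(κ * η₁)) ^ 2 := by
    field_simp
  have t2 : E1 * (y1 / -(κ * η₁)) * (conj E0 * (conj z0 / -(κ * η₀))) * ((η₁ : ℂ) / η₀) =
      conj E0 * E1 * y1 * conj z0 / (-(κ * η₀)) ^ 2 := by
    field_simp
  rw [t1, t2]
  generalize ((Real.sqrt κ : ℂ)⁻¹) ^ 3 = s at *
  generalize (Real.sqrt κ : ℂ) ^ 3 = t at *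
  linear_combination (Complex.I * (conj E0 * E1 * conj y0 * z1 / (-(κ * η₁)) ^ 2 -
    conj E0 * E1 * y1 * conj z0 / (-(κ * η₀)) ^ 2)) * (hc' + (p.V₀ : ℂ) / p.H ^ 2 * (cc * c) * hs)

/-! ## Expansion of fields in Bunch–Davies modes -/

/-- The product of the amplitudes of two plane waves with the same wave vector. -/
def waveBracket (v u : ℂ × ℂ) : ℂ := Complex.I * (conj v.1 * u.2 - conj v.2 * u.1)

theorem bracket_single (k : Wave) (v : ℂ × ℂ) (f : PhaseC) :
    bracket (Finsupp.single k v) f = waveBracket v (f k) := by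
  rw [bracket, Finsupp.sum_single_index (by simp), waveBracket]

theorem waveBracket_add (v u w : ℂ × ℂ) :
    waveBracket v (u + w) = waveBracket v u + waveBracket v w := by
  simp only [waveBracket, Prod.fst_add, Prod.snd_add]
  ring

theorem waveBracket_smul (v u : ℂ × ℂ) (z : ℂ) :
    waveBracket v (z • u) = z * waveBracket v u := by
  simp only [waveBracket, Prod.smul_fst, Prod.smul_snd, smul_eq_mul]
  ring

theorem waveBracket_smul_left (v u : ℂ × ℂ) (z : ℂ) :
    waveBracket (z • v) u = conj z * waveBracket v u := by
  simp only [waveBracket, Prod.smul_fst, Prod.smul_snd, smul_eq_mul, map_mul]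
  ring

theorem waveBracket_add_left (v u w : ℂ × ℂ) :
    waveBracket (v + u) w = waveBracket v w + waveBracket u w := by
  simp only [waveBracket, Prod.fst_add, Prod.snd_add, map_add]
  ring

theorem star_fst (v : ℂ × ℂ) : (star v).1 = conj v.1 := rfl

theorem star_snd (v : ℂ × ℂ) : (star v).2 = conj v.2 := rfl

theorem waveBracket_star_right_self (v : ℂ × ℂ) : waveBracket v (star v) = 0 := by
  simp only [waveBracket, star_fst, star_snd]
  ring

theorem waveBracket_star_left_self (v : ℂ × ℂ) : waveBracket (star v) v = 0 := by
  simp only [waveBracket, star_fst, star_snd, Complex.conj_conj]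
  ring

theorem waveBracket_star_star (v u : ℂ × ℂ) :
    waveBracket (star v) (star u) = -conj (waveBracket v u) := by
  simp only [waveBracket, star_fst, star_snd, Complex.conj_conj,
    map_mul, map_sub, Complex.conj_I]
  ring

theorem conj_waveBracket (v u : ℂ × ℂ) : conj (waveBracket v u) = waveBracket u v := by
  simp only [waveBracket, Complex.conj_conj, map_mul, map_sub, Complex.conj_I]
  ring

/-- Expansion of an amplitude in a normalized one and its conjugate. -/
theorem eq_smul_add_smul_star {v : ℂ × ℂ} (hv : waveBracket v v = 1) (u : ℂ × ℂ) :
    u = waveBracket v u • v + (-waveBracket (star v) u) • star v := by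
  obtain ⟨a, b⟩ := v
  obtain ⟨c, d⟩ := u
  simp only [waveBracket] at hv
  ext
  · simp only [waveBracket, star_fst, star_snd, Complex.conj_conj,
      Prod.fst_add, Prod.smul_fst, smul_eq_mul]
    linear_combination (-c) * hv
  · simp only [waveBracket, star_fst, star_snd, Complex.conj_conj,
      Prod.snd_add, Prod.smul_snd, smul_eq_mul]
    linear_combination (-d) * hv

theorem wave_neg_neg (k : Wave) : - -k = k := waveNeg_waveNeg k

theorem wave_neg_eq_iff (k k' : Wave) : -k = k' ↔ k = -k' :=
  ⟨fun h => by rw [← h, wave_neg_neg], fun h => by rw [h, wave_neg_neg]⟩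

theorem wave_neg_ne (k : Wave) : -k ≠ k := fun h => k.2 (by
  have h : -k.1 = k.1 := congrArg Subtype.val h
  have h2 : (2 : ℝ) • k.1 = 0 := by
    rw [two_smul]
    nth_rewrite 1 [← h]
    exact neg_add_cancel k.1
  exact (smul_eq_zero.1 h2).resolve_left two_ne_zero)

theorem norm_wave_neg (k : Wave) : ‖(-k : Wave).1‖ = ‖k.1‖ := norm_neg k.1

theorem norm_wave_pos (k : Wave) : 0 < ‖k.1‖ := norm_pos_iff.2 k.2

theorem conjC_single (k : Wave) (v : ℂ × ℂ) :
    conjC (Finsupp.single k v) = Finsupp.single (-k) (star v) := by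
  ext1 k'
  rw [conjC_apply, Finsupp.single_apply, Finsupp.single_apply]
  by_cases h : k = -k'
  · rw [if_pos h, if_pos ((wave_neg_eq_iff k k').2 h)]
  · rw [if_neg h, if_neg fun h' => h ((wave_neg_eq_iff k k').1 h'), star_zero]

theorem phase_neg (f : Phase) (k : Wave) : f.1 (-k) = star (f.1 k) := by
  have h : conjC f.1 = f.1 := f.2
  have h' := conjC_apply f.1 (-k)
  rwa [h, wave_neg_neg] at h'

/-- The amplitudes of the Bunch–Davies mode with wave number `κ`. -/
def bdVec (p : Params) (κ η : ℝ) : ℂ × ℂ := (bdAmp p κ η, bdMom p κ η)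

theorem bdMode_eq_single (p : Params) (η : ℝ) (k : Wave) :
    bdMode p η k = Finsupp.single k (bdVec p ‖k.1‖ η) := rfl

theorem waveBracket_bdVec (p : Params) {κ η : ℝ} (hκ : 0 < κ) (hη : η < 0) :
    waveBracket (bdVec p κ η) (bdVec p κ η) = 1 := bd_wronskian p hκ hη

theorem isFockBasis_bdMode (p : Params) {η : ℝ} (hη : η < 0) : IsFockBasis (bdMode p η) := by
  have hn : ∀ k : Wave, waveBracket (bdVec p ‖k.1‖ η) (bdVec p ‖k.1‖ η) = 1 := fun k =>
    waveBracket_bdVec p (norm_wave_pos k) hη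
  refine ⟨fun k => ?_, fun k k' hk => ?_, fun k k' => ?_, ?_⟩
  · rw [bdMode_eq_single, bracket_single, Finsupp.single_eq_same, hn]
  · rw [bdMode_eq_single, bracket_single, bdMode_eq_single, Finsupp.single_eq_of_ne hk]
    simp [waveBracket]
  · rw [bdMode_eq_single, bracket_single, bdMode_eq_single, conjC_single]
    by_cases h : k = -k'
    · rw [h, Finsupp.single_eq_same, norm_wave_neg, waveBracket_star_right_self]
    · rw [Finsupp.single_eq_of_ne h]
      simp [waveBracket]
  -- On the plane wave k the vectors γ_k and the conjugate of γ_{-k} form a basis of ℂ², since both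
  -- modes have the same amplitudes.
  · rw [eq_top_iff]
    rintro γ -
    induction γ using Finsupp.induction_linear with
    | zero => exact Submodule.zero_mem _
    | add f g hf hg => exact Submodule.add_mem _ hf hg
    | single k u =>
      rw [eq_smul_add_smul_star (hn k) u, Finsupp.single_add, ← Finsupp.smul_single,
        ← Finsupp.smul_single]
      refine Submodule.add_mem _ (Submodule.smul_mem _ _ (Submodule.subset_span (Or.inl ⟨k, rfl⟩)))
        (Submodule.smul_mem _ _ (Submodule.subset_span (Or.inr ⟨-k, ?_⟩)))
      simp only [bdMode_eq_single, conjC_single, wave_neg_neg, norm_wave_neg]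

/-- The real field `∑ c_k γ_k + c.c.` with Bunch–Davies coefficients `c` at time `η`. -/
def synth (p : Params) (η : ℝ) (c : Wave →₀ ℂ) : Phase :=
  realPart (Finsupp.onFinset c.support (fun k => c k • bdVec p ‖k.1‖ η) fun k hk => by
    rw [Finsupp.mem_support_iff]; intro h; simp [h] at hk)

theorem synth_apply (p : Params) (η : ℝ) (c : Wave →₀ ℂ) (k : Wave) :
    (synth p η c).1 k = c k • bdVec p ‖k.1‖ η + conj (c (-k)) • star (bdVec p ‖k.1‖ η) := by
  simp only [synth, realPart, Finsupp.add_apply, conjC_apply, Finsupp.onFinset_apply,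
    norm_wave_neg, star_smul]
  rfl

theorem phase_ext {f g : Phase} (h : ∀ k, f.1 k = g.1 k) : f = g := Subtype.ext (Finsupp.ext h)

/-- The Bunch–Davies coefficients `⟨γ_k, f⟩` of a field at time `η`. -/
def coeff (p : Params) (η : ℝ) (f : Phase) : Wave →₀ ℂ :=
  Finsupp.onFinset f.1.support (fun k => waveBracket (bdVec p ‖k.1‖ η) (f.1 k)) fun k hk => by
    rw [Finsupp.mem_support_iff]; intro h; simp [h, waveBracket] at hk

theorem coeff_apply (p : Params) (η : ℝ) (f : Phase) (k : Wave) :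
    coeff p η f k = waveBracket (bdVec p ‖k.1‖ η) (f.1 k) := rfl

theorem synth_coeff (p : Params) {η : ℝ} (hη : η < 0) (f : Phase) :
    synth p η (coeff p η f) = f := by
  refine phase_ext fun k => ?_
  rw [synth_apply, coeff_apply, coeff_apply, norm_wave_neg, phase_neg]
  nth_rewrite 3 [eq_smul_add_smul_star (waveBracket_bdVec p (norm_wave_pos k) hη) (f.1 k)]
  congr 2
  rw [← neg_inj, ← waveBracket_star_star, star_star, neg_neg]

theorem coeff_synth (p : Params) {η : ℝ} (hη : η < 0) (c : Wave →₀ ℂ) :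
    coeff p η (synth p η c) = c := by
  ext1 k
  rw [coeff_apply, synth_apply, waveBracket_add, waveBracket_smul, waveBracket_smul,
    waveBracket_bdVec p (norm_wave_pos k) hη, waveBracket_star_right_self]
  ring

/-! ### Classical evolution -/

theorem isTrajectory_synth (p : Params) (c : Wave →₀ ℂ) :
    IsTrajectory p (fun η => synth p η c) := by
  intro η hη k
  have h1 := hasDerivAt_bdAmp p (norm_wave_pos k) hη
  have h2 := hasDerivAt_bdMom p (norm_wave_pos k) hη
  simp only [synth_apply, bdVec, Prod.fst_add, Prod.snd_add, Prod.smul_fst, Prod.smul_snd,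
    star_fst, star_snd, smul_eq_mul]
  constructor
  · refine ((h1.const_mul (c k)).add (h1.star.const_mul (conj (c (-k))))).congr_deriv ?_
    simp only [Complex.star_def, map_div₀, Complex.conj_ofReal]
    ring
  · refine ((h2.const_mul (c k)).add (h2.star.const_mul (conj (c (-k))))).congr_deriv ?_
    simp only [Complex.star_def, map_mul, map_neg, Complex.conj_ofReal]
    ring

theorem evolvesTo_synth (p : Params) (η₀ η₁ : ℝ) (c : Wave →₀ ℂ) :
    EvolvesTo p η₀ η₁ (synth p η₀ c) (synth p η₁ c) :=
  ⟨_, isTrajectory_synth p c, rfl, rfl⟩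

/-- The Bunch–Davies coefficients are conserved. -/
theorem coeff_trajectory (p : Params) {c : ℝ → Phase} (hc : IsTrajectory p c) {η₀ η₁ : ℝ}
    (h₀ : η₀ < 0) (h₁ : η₁ < 0) : coeff p η₁ (c η₁) = coeff p η₀ (c η₀) := by
  ext1 k
  rw [coeff_apply, coeff_apply]
  have hder : ∀ η ∈ Set.Iio (0 : ℝ), HasDerivAt
      (fun η => waveBracket (bdVec p ‖k.1‖ η) ((c η).1 k)) 0 η := by
    intro η hη
    have h1 := hasDerivAt_bdAmp p (norm_wave_pos k) hη
    have h2 := hasDerivAt_bdMom p (norm_wave_pos k) hη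
    obtain ⟨h3, h4⟩ := hc η hη k
    refine (((h1.star.mul h4).sub (h2.star.mul h3)).const_mul Complex.I).congr_deriv ?_
    simp only [Complex.star_def, map_mul, map_neg, map_div₀, Complex.conj_ofReal]
    ring
  exact isOpen_Iio.is_const_of_deriv_eq_zero isPreconnected_Iio
    (fun η hη => (hder η hη).differentiableAt.differentiableWithinAt)
    (fun η hη => (hder η hη).deriv) h₁ h₀

/-- Conservation of the coefficients gives uniqueness, and the explicit superposition of modes gives
existence, so no general theorem on differential equations is needed. In Bunch–Davies coefficients
the evolution is the identity. -/
theorem evolvesTo_iff (p : Params) {η₀ η₁ : ℝ} (h₀ : η₀ < 0) (h₁ : η₁ < 0) (f g : Phase) :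
    EvolvesTo p η₀ η₁ f g ↔ g = synth p η₁ (coeff p η₀ f) := by
  constructor
  · rintro ⟨c, hc, rfl, rfl⟩
    rw [← coeff_trajectory p hc h₀ h₁, synth_coeff p h₁]
  · rintro rfl
    nth_rewrite 1 [← synth_coeff p h₀ f]
    exact evolvesTo_synth p η₀ η₁ _

theorem existsUnique_evolvesTo (p : Params) {η₀ η₁ : ℝ} (h₀ : η₀ < 0) (h₁ : η₁ < 0) (f : Phase) :
    ∃! g, EvolvesTo p η₀ η₁ f g := by
  simp only [evolvesTo_iff p h₀ h₁]
  exact existsUnique_eq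

theorem evolve_synth (p : Params) {η₀ η₁ : ℝ} (h₀ : η₀ < 0) (h₁ : η₁ < 0) (c : Wave →₀ ℂ) :
    evolve p η₀ η₁ (synth p η₀ c) = synth p η₁ c := by
  have h := Classical.epsilon_spec (p := EvolvesTo p η₀ η₁ (synth p η₀ c))
    ⟨_, evolvesTo_synth p η₀ η₁ c⟩
  rw [evolvesTo_iff p h₀ h₁, coeff_synth p h₀] at h
  exact h

/-! ### Fock vacua -/

/-- The Gaussian `exp(-‖c‖² / 2)`. -/
def gaussian (c : Wave →₀ ℂ) : ℂ := Complex.exp (-((∑ᶠ k, ‖c k‖ ^ 2 : ℝ) : ℂ) / 2)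

theorem fockVacuum_single (v : Wave → ℂ × ℂ) (f : Phase) :
    fockVacuum (fun k => Finsupp.single k (v k)) f =
      Complex.exp (-((∑ᶠ k, ‖waveBracket (v k) (f.1 k)‖ ^ 2 : ℝ) : ℂ) / 2) := by
  simp only [fockVacuum, bracket_single]

theorem BD_eq_gaussian (p : Params) (η : ℝ) (f : Phase) : BD p η f = gaussian (coeff p η f) :=
  fockVacuum_single (fun k => bdVec p ‖k.1‖ η) f

theorem BD_synth (p : Params) {η : ℝ} (hη : η < 0) (c : Wave →₀ ℂ) :
    BD p η (synth p η c) = gaussian c := by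
  rw [BD_eq_gaussian, coeff_synth p hη]

/-- Each vacuum is the same Gaussian in the coefficients belonging to its time, and the dynamics
preserves these coefficients. -/
theorem evolveState_BD (p : Params) {η₀ η₁ : ℝ} (h₀ : η₀ < 0) (h₁ : η₁ < 0) :
    evolveState p η₀ η₁ (BD p η₀) = BD p η₁ := by
  funext f
  rw [evolveState, ← synth_coeff p h₁ f, evolve_synth p h₁ h₀, BD_synth p h₀, BD_synth p h₁]

theorem finsum_eq_pair {g : Wave → ℝ} {k k' : Wave} (hne : k ≠ k')
    (h : ∀ q, q ≠ k → q ≠ k' → g q = 0) : ∑ᶠ q, g q = g k + g k' := by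
  classical
  rw [finsum_eq_sum_of_support_subset (s := {k, k'}) g, Finset.sum_pair hne]
  intro q hq
  by_contra hcon
  simp at hcon
  exact hq (h q hcon.1 hcon.2)

theorem gaussian_inj_of_finsum {a b : ℝ}
    (h : Complex.exp (-(a : ℂ) / 2) = Complex.exp (-(b : ℂ) / 2)) : a = b := by
  have h : Real.exp (-a / 2) = Real.exp (-b / 2) := by exact_mod_cast h
  have := Real.exp_injective h
  linarith

theorem gaussian_mapDomain (e : Wave ≃ Wave) (c : Wave →₀ ℂ) :
    gaussian (Finsupp.equivMapDomain e c) = gaussian c := by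
  simp only [gaussian, Finsupp.equivMapDomain_apply]
  rw [finsum_comp_equiv e.symm (f := fun k => ‖c k‖ ^ 2)]

/-! ### Spatial transformations of the coefficients -/

theorem coeff_translate (p : Params) (η : ℝ) (a : Space) (f : Phase) (k : Wave) :
    coeff p η (translate a f) k = planeWave k a * coeff p η f k := by
  rw [coeff_apply, coeff_apply, ← waveBracket_smul]
  rfl

theorem norm_planeWave (k : Wave) (a : Space) : ‖planeWave k a‖ = 1 := by
  rw [planeWave, mul_comm, Complex.norm_exp_ofReal_mul_I]

theorem BD_translate (p : Params) (η : ℝ) (a : Space) (f : Phase) :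
    BD p η (translate a f) = BD p η f := by
  simp only [BD_eq_gaussian, gaussian, coeff_translate, norm_mul, norm_planeWave, one_mul]

theorem coeff_rotate (p : Params) (η : ℝ) (R : Space ≃ₗᵢ[ℝ] Space) (f : Phase) :
    coeff p η (rotate R f) = Finsupp.equivMapDomain (waveRot R.symm) (coeff p η f) := by
  ext1 k
  rw [Finsupp.equivMapDomain_apply, coeff_apply, coeff_apply]
  have : ‖((waveRot R.symm).symm k).1‖ = ‖k.1‖ := R.norm_map k.1
  rw [this]
  rfl

theorem BD_rotate (p : Params) (η : ℝ) (R : Space ≃ₗᵢ[ℝ] Space) (f : Phase) :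
    BD p η (rotate R f) = BD p η f := by
  rw [BD_eq_gaussian, BD_eq_gaussian, coeff_rotate, gaussian_mapDomain]

theorem bdVec_scale (p : Params) {κ η : ℝ} (hκ : 0 < κ) (hη : η < 0) (r : ℝ) :
    bdVec p (Real.exp (-r) * κ) (Real.exp r * η) =
      ((Real.exp (3 / 2 * r) : ℂ) * bdAmp p κ η, (Real.exp (-(3 / 2) * r) : ℂ) * bdMom p κ η) := by
  rw [bdVec, bdAmp_scale p hκ hη, bdMom_scale p hκ hη]

/-- The factors e^{3r/2} and e^{-3r/2} acquired by amplitude and momentum under (κ, η) ↦ (e^{-r}κ,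
e^r η) are exactly undone by the weights in `dilateC`. -/
theorem dilate_synth (p : Params) {η : ℝ} (hη : η < 0) (r : ℝ) (c : Wave →₀ ℂ) :
    dilate r (synth p (Real.exp r * η) c) =
      synth p η (Finsupp.equivMapDomain (waveScale r) c) := by
  refine phase_ext fun k => ?_
  have hneg : (waveScale r).symm (-k) = -((waveScale r).symm k) := by
    ext1
    change Real.exp (-r) • (-k.1) = -(Real.exp (-r) • k.1)
    rw [smul_neg]
  have hnorm : ‖((waveScale r).symm k).1‖ = Real.exp (-r) * ‖k.1‖ := by
    change ‖Real.exp (-r) • k.1‖ = _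
    rw [norm_smul, Real.norm_eq_abs, Real.abs_exp]
  have h : ((Real.exp (-(3 / 2) * r) : ℝ) : ℂ) * (Real.exp (3 / 2 * r) : ℝ) = 1 := by
    rw [← Complex.ofReal_mul, ← Real.exp_add]
    norm_num
  change dilateC r (synth p (Real.exp r * η) c).1 k = _
  rw [synth_apply]
  simp only [dilateC, Finsupp.mapRange_apply, Finsupp.equivMapDomain_apply, synth_apply, hnorm,
    hneg, bdVec_scale p (norm_wave_pos k) hη]
  generalize c ((waveScale r).symm k) = x
  generalize c (-(waveScale r).symm k) = y
  generalize Real.exp (-(3 / 2) * r) = s at *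
  generalize Real.exp (3 / 2 * r) = t at *
  ext
  · simp only [bdVec, Prod.fst_add, Prod.smul_fst, star_fst, smul_eq_mul, map_mul,
      Complex.conj_ofReal]
    linear_combination (x * bdAmp p ‖k.1‖ η + conj y * conj (bdAmp p ‖k.1‖ η)) * h
  · simp only [bdVec, Prod.snd_add, Prod.smul_snd, star_snd, smul_eq_mul, map_mul,
      Complex.conj_ofReal]
    linear_combination (x * bdMom p ‖k.1‖ η + conj y * conj (bdMom p ‖k.1‖ η)) * h

/-- The flow of the Killing field permutes the Bunch–Davies coefficients. -/
theorem killingFlow_synth (p : Params) {η : ℝ} (hη : η < 0) (l : ℝ) (c : Wave →₀ ℂ) :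
    killingFlow p η l (synth p η c) =
      synth p η (Finsupp.equivMapDomain (waveScale (-(p.H * l))) c) := by
  have h : Real.exp (-(p.H * l)) * η < 0 := mul_neg_of_pos_of_neg (Real.exp_pos _) hη
  rw [killingFlow, evolve_synth p hη h, dilate_synth p hη]

/-- Translations multiply the coefficients by phases; rotations and the Killing flow permute them.
The Gaussian depends only on their ℓ² norm. -/
theorem pdSInvariantAt_BD (p : Params) {η : ℝ} (hη : η < 0) : PdSInvariantAt p η (BD p η) := by
  refine ⟨BD_translate p η, fun R _ f => BD_rotate p η R f, fun l f => ?_⟩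
  rw [← synth_coeff p hη f, killingFlow_synth p hη, BD_synth p hη, BD_synth p hη,
    gaussian_mapDomain]

/-! ## Gaussian states -/

/-- The inner product of finitely supported sequences. -/
def overlap {ι : Type*} (a b : ι →₀ ℂ) : ℂ := a.sum fun k z => conj z * b k

theorem overlap_eq_sum {ι : Type*} {a : ι →₀ ℂ} {T : Finset ι} (h : a.support ⊆ T) (b : ι →₀ ℂ) :
    overlap a b = ∑ k ∈ T, conj (a k) * b k :=
  Finsupp.sum_of_support_subset _ h _ (by simp)

open scoped ComplexOrder in
-- Entrywise powers are iterated Hadamard products, so this is the Schur product theorem; the zeroth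
-- power is the rank-one matrix of ones.
theorem posSemidef_pow {n : ℕ} {K : Matrix (Fin n) (Fin n) ℂ} (hK : K.PosSemidef) (m : ℕ) :
    (Matrix.of fun i j => K i j ^ m : Matrix (Fin n) (Fin n) ℂ).PosSemidef := by
  induction m with
  | zero =>
    have h := Matrix.posSemidef_conjTranspose_mul_self
      (Matrix.of fun _ _ => 1 : Matrix Unit (Fin n) ℂ)
    convert h using 1
    ext i j
    simp [Matrix.mul_apply]
  | succ m ih =>
    have e : (Matrix.of fun i j => K i j ^ (m + 1) : Matrix (Fin n) (Fin n) ℂ) =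
        (Matrix.of fun i j => K i j ^ m : Matrix (Fin n) (Fin n) ℂ).hadamard K := by
      ext i j
      simp [Matrix.hadamard_apply, pow_succ]
    rw [e]
    exact ih.hadamard hK

open scoped ComplexOrder in
/-- The entrywise exponential of a positive semidefinite matrix is positive semidefinite. -/
theorem sum_exp_nonneg {n : ℕ} {K : Matrix (Fin n) (Fin n) ℂ} (hK : K.PosSemidef)
    (c : Fin n → ℂ) : 0 ≤ ∑ i, ∑ j, conj (c i) * c j * Complex.exp (K i j) := by
  have h : HasSum (fun m : ℕ => ∑ i, ∑ j, conj (c i) * c j * (K i j ^ m / m.factorial))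
      (∑ i, ∑ j, conj (c i) * c j * Complex.exp (K i j)) := by
    refine hasSum_sum fun i _ => hasSum_sum fun j _ => HasSum.mul_left _ ?_
    rw [Complex.exp_eq_exp_ℂ]
    exact NormedSpace.expSeries_div_hasSum_exp (K i j)
  refine h.nonneg fun m => ?_
  have h1 := (posSemidef_pow hK m).dotProduct_mulVec_nonneg c
  have e : ∑ i, ∑ j, conj (c i) * c j * (K i j ^ m / m.factorial) =
      ((m.factorial : ℝ)⁻¹ : ℝ) * (star c ⬝ᵥ
        ((Matrix.of fun i j => K i j ^ m : Matrix (Fin n) (Fin n) ℂ).mulVec c)) := by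
    simp only [dotProduct, Matrix.mulVec, Finset.mul_sum, Matrix.of_apply, Pi.star_apply,
      Complex.star_def]
    refine Finset.sum_congr rfl fun i _ => Finset.sum_congr rfl fun j _ => ?_
    push_cast
    ring
  rw [e]
  exact mul_nonneg (by rw [Complex.zero_le_real]; positivity) h1

open scoped ComplexOrder in
/-- A Gaussian functional with the overlaps of coherent states as its kernel is a state. -/
theorem isState_of_overlap {V ι : Type*} [AddCommGroup V] {Ω : V → V → ℝ} {χ : V → ℂ}
    (A : V → ι →₀ ℂ) (hA : ∀ f g, A (f - g) = A f - A g)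
    (hΩ : ∀ f g, Ω f g = 2 * (overlap (A f) (A g)).im)
    (hχ : ∀ f, χ f = Complex.exp (-overlap (A f) (A f) / 2)) : IsState Ω χ := by
  classical
  refine ⟨?_, fun n f c => ?_⟩
  · have h0 : A 0 = 0 := by
      have := hA 0 0
      rwa [sub_self, sub_self] at this
    rw [hχ, h0]
    simp [overlap]
  set T : Finset ι := Finset.univ.biUnion fun i => (A (f i)).support with hT
  have hsub : ∀ i, (A (f i)).support ⊆ T := fun i =>
    Finset.subset_biUnion_of_mem (fun i => (A (f i)).support) (Finset.mem_univ i)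
  set K : Matrix (Fin n) (Fin n) ℂ := Matrix.of fun i j => overlap (A (f i)) (A (f j)) with hKd
  have hK : K.PosSemidef := by
    have h := Matrix.posSemidef_conjTranspose_mul_self
      (Matrix.of fun k i => A (f i) k.1 : Matrix T (Fin n) ℂ)
    convert h using 1
    ext i j
    simp only [hKd, Matrix.of_apply, overlap_eq_sum (hsub i), Matrix.mul_apply,
      Matrix.conjTranspose_apply, Complex.star_def]
    exact (Finset.sum_coe_sort T fun k => conj (A (f i) k) * A (f j) k).symm
  have hherm : ∀ i j, conj (K i j) = K j i := fun i j => hK.isHermitian.apply j i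
  -- The Weyl phase and the Gaussian combine into a coherent-state overlap: two factors depending on
  -- one index each, which are absorbed into the coefficients `c`, times the entrywise exponential
  -- of a Gram matrix.
  have hker : ∀ i j, Complex.exp (Complex.I / 2 * (Ω (f i) (f j) : ℂ)) * χ (f j - f i) =
      Complex.exp (-K i i / 2) * Complex.exp (-K j j / 2) * Complex.exp (K i j) := by
    intro i j
    have hs : (A (f j) - A (f i)).support ⊆ T := (Finsupp.support_sub).trans
      (Finset.union_subset (hsub j) (hsub i))
    have h1 : overlap (A (f j - f i)) (A (f j - f i)) = K j j - K j i - K i j + K i i := by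
      rw [hA, overlap_eq_sum hs]
      simp only [hKd, Matrix.of_apply, overlap_eq_sum (hsub _), ← Finset.sum_sub_distrib,
        ← Finset.sum_add_distrib, Finsupp.sub_apply, map_sub]
      exact Finset.sum_congr rfl fun k _ => by ring
    have h2 : ((Ω (f i) (f j) : ℝ) : ℂ) = -Complex.I * (K i j - K j i) := by
      rw [hΩ, ← hherm i j, Complex.sub_conj]
      simp only [hKd, Matrix.of_apply]
      push_cast
      linear_combination (2 * ((overlap (A (f i)) (A (f j))).im : ℂ)) * Complex.I_sq
    rw [hχ, h1, h2, ← Complex.exp_add, ← Complex.exp_add, ← Complex.exp_add]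
    congr 1
    linear_combination (-(K i j - K j i) / 2) * Complex.I_sq
  have hreal : ∀ i, conj (Complex.exp (-K i i / 2)) = Complex.exp (-K i i / 2) := fun i => by
    rw [← Complex.exp_conj, map_div₀, map_neg, hherm, map_ofNat]
  have hpos := sum_exp_nonneg hK fun i => c i * Complex.exp (-K i i / 2)
  have e : ∑ i, ∑ j, conj (c i) * c j *
      (Complex.exp (Complex.I / 2 * (Ω (f i) (f j) : ℂ)) * χ (f j - f i)) =
      ∑ i, ∑ j, conj (c i * Complex.exp (-K i i / 2)) * (c j * Complex.exp (-K j j / 2)) *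
        Complex.exp (K i j) := by
    refine Finset.sum_congr rfl fun i _ => Finset.sum_congr rfl fun j _ => ?_
    rw [hker, map_mul, hreal]
    ring
  rw [e]
  obtain ⟨h1, h2⟩ := Complex.le_def.1 hpos
  exact ⟨h1, h2.symm⟩

theorem overlap_eq_finsum {ι : Type*} (a b : ι →₀ ℂ) :
    overlap a b = ∑ᶠ k, conj (a k) * b k := by
  rw [overlap_eq_sum (Finset.Subset.refl _)]
  refine (finsum_eq_sum_of_support_subset _ fun k hk => ?_).symm
  rw [Finset.mem_coe, Finsupp.mem_support_iff]
  intro h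
  simp [h] at hk

theorem gaussian_eq (c : Wave →₀ ℂ) : gaussian c = Complex.exp (-overlap c c / 2) := by
  have h : ((∑ᶠ k, ‖c k‖ ^ 2 : ℝ) : ℂ) = overlap c c := by
    rw [overlap_eq_sum (Finset.Subset.refl _),
      finsum_eq_sum_of_support_subset (s := c.support) _ fun k hk => by
        rw [Finset.mem_coe, Finsupp.mem_support_iff]; intro h; simp [h] at hk]
    push_cast
    exact Finset.sum_congr rfl fun k _ => (Complex.conj_mul' _).symm
  rw [gaussian, h]

theorem waveBracket_smul_add {v : ℂ × ℂ} (hv : waveBracket v v = 1) (a b c d : ℂ) :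
    waveBracket (a • v + conj b • star v) (c • v + conj d • star v) =
      conj a * c - conj (conj b * d) := by
  have h2 : waveBracket (star v) (star v) = -1 := by rw [waveBracket_star_star, hv, map_one]
  simp only [waveBracket_add, waveBracket_add_left, waveBracket_smul, waveBracket_smul_left, hv, h2,
    waveBracket_star_right_self, waveBracket_star_left_self, map_mul, Complex.conj_conj]
  ring

/-- The part of the field along the conjugate modes contributes minus the complex conjugate of the
overlap, after the reindexing k ↦ -k. Together with `isState_of_overlap` this makes the Gaussian a
state. -/
theorem symp_synth (p : Params) {η : ℝ} (hη : η < 0) (c d : Wave →₀ ℂ) :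
    symp (synth p η c) (synth p η d) = 2 * (overlap c d).im := by
  have h0 : bracket (synth p η c).1 (synth p η d).1 =
      ∑ᶠ k, waveBracket ((synth p η c).1 k) ((synth p η d).1 k) := by
    rw [bracket, Finsupp.sum, Finset.mul_sum]
    refine (finsum_eq_sum_of_support_subset _ fun k hk => ?_).symm
    rw [Finset.mem_coe, Finsupp.mem_support_iff]
    intro h
    rw [Function.mem_support, h] at hk
    simp at hk
  have hfin : (Function.support fun k => conj (c k) * d k).Finite :=
    c.support.finite_toSet.subset fun k hk => by
      rw [Finset.mem_coe, Finsupp.mem_support_iff]; intro h; simp [h] at hk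
  have hfin' : (Function.support fun k => conj (conj (c (-k)) * d (-k))).Finite := by
    refine (hfin.preimage (waveNeg.injective.injOn)).subset fun k hk => ?_
    rw [Function.mem_support] at hk
    exact fun h => hk (by
      have h : conj (c (-k)) * d (-k) = 0 := h
      rw [h, map_zero])
  have h1 : bracket (synth p η c).1 (synth p η d).1 = overlap c d - conj (overlap c d) := by
    have e : ∀ k, waveBracket ((synth p η c).1 k) ((synth p η d).1 k) =
        conj (c k) * d k - conj (conj (c (-k)) * d (-k)) := fun k => by
      rw [synth_apply, synth_apply,
        waveBracket_smul_add (waveBracket_bdVec p (norm_wave_pos k) hη)]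
    rw [h0, finsum_congr e, finsum_sub_distrib hfin hfin', overlap_eq_finsum]
    congr 1
    exact (finsum_comp_equiv waveNeg (f := fun k => conj (conj (c k) * d k))).trans
      ((starRingEnd ℂ).toAddMonoidHom.map_finsum hfin).symm
  rw [symp, h1, Complex.sub_conj]
  simp

theorem coeff_sub (p : Params) (η : ℝ) (f g : Phase) :
    coeff p η (f - g) = coeff p η f - coeff p η g := by
  ext1 k
  rw [Finsupp.sub_apply, coeff_apply, coeff_apply, coeff_apply]
  change waveBracket _ (f.1 k - g.1 k) = _
  simp only [waveBracket, Prod.fst_sub, Prod.snd_sub]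
  ring

theorem coeff_add (p : Params) (η : ℝ) (f g : Phase) :
    coeff p η (f + g) = coeff p η f + coeff p η g := by
  ext1 k
  rw [Finsupp.add_apply, coeff_apply, coeff_apply, coeff_apply, ← waveBracket_add]
  rfl

theorem coeff_smul (p : Params) (η r : ℝ) (f : Phase) :
    coeff p η (r • f) = (r : ℂ) • coeff p η f := by
  ext1 k
  rw [Finsupp.smul_apply, coeff_apply, coeff_apply, smul_eq_mul, ← waveBracket_smul]
  congr 1

theorem isState_BD (p : Params) {η : ℝ} (hη : η < 0) : IsState symp (BD p η) := by
  refine isState_of_overlap (coeff p η) (coeff_sub p η) (fun f g => ?_) fun f => ?_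
  · rw [← symp_synth p hη, synth_coeff p hη, synth_coeff p hη]
  · rw [BD_eq_gaussian, gaussian_eq]

/-! ### Quadratures -/

theorem realPart_smul_bdMode (p : Params) (η : ℝ) (k : Wave) (z : ℂ) :
    realPart (z • bdMode p η k) = synth p η (Finsupp.single k z) := by
  classical
  rw [synth]
  congr 1
  ext1 q
  rw [bdMode_eq_single, Finsupp.smul_apply, Finsupp.onFinset_apply, Finsupp.single_apply,
    Finsupp.single_apply]
  by_cases h : k = q
  · rw [if_pos h, if_pos h, h]
  · rw [if_neg h, if_neg h, smul_zero, zero_smul]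

/-- The coefficient of the quadrature `a₁ X + a₂ P`. -/
def quadCoeff (a : ℝ × ℝ) : ℂ := (-Complex.I * a.1 + a.2) / (Real.sqrt 2 : ℂ)

theorem sqrt_two_sq : (Real.sqrt 2 : ℂ) ^ 2 = 2 := by
  exact_mod_cast Real.sq_sqrt (show (0 : ℝ) ≤ 2 by norm_num)

theorem conj_quadCoeff_mul (a b : ℝ × ℝ) : conj (quadCoeff a) * quadCoeff b =
    ((a.1 * b.1 + a.2 * b.2 : ℝ) + Complex.I * (a.1 * b.2 - a.2 * b.1 : ℝ)) / 2 := by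
  simp only [quadCoeff, map_div₀, map_add, map_mul, map_neg, Complex.conj_I, Complex.conj_ofReal]
  rw [div_mul_div_comm, ← pow_two, sqrt_two_sq]
  push_cast
  linear_combination (-(a.1 : ℂ) * b.1 / 2) * Complex.I_sq

theorem norm_quadCoeff_sq (a : ℝ × ℝ) : ‖quadCoeff a‖ ^ 2 = (a.1 ^ 2 + a.2 ^ 2) / 2 := by
  have h := conj_quadCoeff_mul a a
  rw [Complex.conj_mul', mul_comm a.1 a.2, sub_self, Complex.ofReal_zero, mul_zero, add_zero] at h
  have h : ‖quadCoeff a‖ ^ 2 = (a.1 * a.1 + a.2 * a.2) / 2 := by exact_mod_cast h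
  rw [h]
  ring

theorem coeff_quad (p : Params) {η : ℝ} (hη : η < 0) (k : Wave) (a : ℝ × ℝ) :
    coeff p η (quad p η k a) = Finsupp.single k (quadCoeff a) := by
  rw [quad, coeff_add, coeff_smul, coeff_smul, quadX, quadP, realPart_smul_bdMode,
    realPart_smul_bdMode, coeff_synth p hη, coeff_synth p hη, Finsupp.smul_single,
    Finsupp.smul_single, ← Finsupp.single_add, quadCoeff]
  congr 1
  simp only [smul_eq_mul]
  ring

theorem finsum_single_add_single (k : Wave) (x y : ℂ) :
    ∑ᶠ q, ‖(Finsupp.single k x + Finsupp.single (-k) y : Wave →₀ ℂ) q‖ ^ 2 =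
      ‖x‖ ^ 2 + ‖y‖ ^ 2 := by
  have hne := wave_neg_ne k
  rw [finsum_eq_pair hne.symm fun q h1 h2 => ?_]
  · simp [Finsupp.single_eq_of_ne hne, Finsupp.single_eq_of_ne hne.symm]
  · simp [Finsupp.single_eq_of_ne h1, Finsupp.single_eq_of_ne h2]

theorem BD_quad_add_quad (p : Params) {η : ℝ} (hη : η < 0) (k : Wave) (a b : ℝ × ℝ) :
    BD p η (quad p η k a + quad p η (-k) b) =
      Complex.exp (-(‖quadCoeff a‖ ^ 2 : ℝ) / 2) * Complex.exp (-(‖quadCoeff b‖ ^ 2 : ℝ) / 2) := by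
  rw [BD_eq_gaussian, coeff_add, coeff_quad p hη, coeff_quad p hη, gaussian,
    finsum_single_add_single, ← Complex.exp_add]
  congr 1
  push_cast
  ring

theorem isState_oneMode :
    IsState oneModeSymp fun a => Complex.exp (-(‖quadCoeff a‖ ^ 2 : ℝ) / 2) := by
  have hov : ∀ a b : ℝ × ℝ, overlap (Finsupp.single () (quadCoeff a))
      (Finsupp.single () (quadCoeff b)) = conj (quadCoeff a) * quadCoeff b := fun a b => by
    rw [overlap, Finsupp.sum_single_index (by simp), Finsupp.single_eq_same]
  refine isState_of_overlap (fun a => Finsupp.single () (quadCoeff a)) (fun a b => ?_)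
    (fun a b => ?_) fun a => ?_
  · rw [← Finsupp.single_sub]
    congr 1
    simp only [quadCoeff, Prod.fst_sub, Prod.snd_sub]
    push_cast
    ring
  · rw [hov, conj_quadCoeff_mul, oneModeSymp]
    simp only [Complex.div_ofNat_im, Complex.add_im, Complex.ofReal_im, Complex.mul_im,
      Complex.I_re, Complex.I_im, Complex.ofReal_re]
    ring
  · rw [hov, Complex.conj_mul']
    push_cast
    rfl

theorem continuous_oneMode :
    Continuous fun a : ℝ × ℝ => Complex.exp (-(‖quadCoeff a‖ ^ 2 : ℝ) / 2) := by
  simp only [norm_quadCoeff_sq]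
  fun_prop

/-- The reduced state is itself a product of two one-mode vacua, so neither mixtures nor limits are
needed. -/
theorem not_entangled_BD (p : Params) {η : ℝ} (hη : η < 0) (k : Wave) :
    ¬ Entangled p η k (BD p η) := by
  rw [Entangled, not_not]
  refine subset_closure (subset_convexHull ℝ _ ?_)
  exact ⟨_, _, isState_oneMode, continuous_oneMode, isState_oneMode, continuous_oneMode,
    funext fun ab => BD_quad_add_quad p hη k ab.1 ab.2⟩

/-! ### Dispersions in the vacuum -/

theorem BD_smul (p : Params) (η t : ℝ) (f : Phase) : BD p η (t • f) =
    Complex.exp (-(t ^ 2 * ∑ᶠ k, ‖coeff p η f k‖ ^ 2 : ℝ) / 2) := by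
  rw [BD_eq_gaussian, gaussian, coeff_smul]
  have h : ∀ k, ‖((t : ℂ) • coeff p η f) k‖ ^ 2 = t ^ 2 * ‖coeff p η f k‖ ^ 2 := fun k => by
    rw [Finsupp.smul_apply, norm_smul, mul_pow, Complex.norm_real, Real.norm_eq_abs, sq_abs]
  rw [finsum_congr h, ← mul_finsum]

theorem hasDerivAt_exp_neg_sq (S t : ℝ) :
    HasDerivAt (fun t : ℝ => Complex.exp (-(t ^ 2 * S : ℝ) / 2))
      (-(t * S : ℝ) * Complex.exp (-(t ^ 2 * S : ℝ) / 2)) t := by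
  have h1 : HasDerivAt (fun t : ℝ => t ^ 2 * S) (2 * t * S) t := by
    simpa using (hasDerivAt_pow 2 t).mul_const S
  refine ((h1.ofReal_comp.neg.div_const 2).cexp).congr_deriv ?_
  push_cast
  simp only [Pi.neg_apply]
  ring

theorem dispersion_BD (p : Params) (η : ℝ) (f : Phase) :
    dispersion (BD p η) f = ∑ᶠ k, ‖coeff p η f k‖ ^ 2 := by
  set S := ∑ᶠ k, ‖coeff p η f k‖ ^ 2 with hS
  have hfun : (fun t : ℝ => BD p η (t • f)) = fun t : ℝ => Complex.exp (-(t ^ 2 * S : ℝ) / 2) :=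
    funext fun t => BD_smul p η t f
  have h1 : deriv (fun t : ℝ => Complex.exp (-(t ^ 2 * S : ℝ) / 2)) =
      fun t : ℝ => -(t * S : ℝ) * Complex.exp (-(t ^ 2 * S : ℝ) / 2) :=
    funext fun t => (hasDerivAt_exp_neg_sq S t).deriv
  have h2 : HasDerivAt (fun t : ℝ => -((t * S : ℝ) : ℂ) * Complex.exp (-(t ^ 2 * S : ℝ) / 2))
      (-(S : ℂ)) 0 := by
    have h3 : HasDerivAt (fun t : ℝ => t * S) S 0 := by
      simpa using (hasDerivAt_id (0 : ℝ)).mul_const S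
    refine (h3.ofReal_comp.neg.mul (hasDerivAt_exp_neg_sq S 0)).congr_deriv ?_
    simp
  rw [dispersion, secondMoment, mean, hfun, iteratedDeriv_succ, iteratedDeriv_one, h1, h2.deriv]
  simp

/-- The quadratures at k and -k have disjoint coefficients of squared norms |a|²/2 and |b|²/2, so
every normalized combination has dispersion exactly 1/2. -/
theorem not_twoModeSqueezed_BD (p : Params) {η : ℝ} (hη : η < 0) (k : Wave) :
    ¬ TwoModeSqueezed p η k (BD p η) := by
  rintro ⟨a, b, hab, h⟩
  rw [dispersion_BD, coeff_add, coeff_quad p hη, coeff_quad p hη, finsum_single_add_single,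
    norm_quadCoeff_sq, norm_quadCoeff_sq] at h
  linarith

/-! ## Vacua at different times -/

theorem waveBracket_eq_bdAlpha (p : Params) (η₀ η₁ κ : ℝ) :
    waveBracket (bdVec p κ η₀) (bdVec p κ η₁) = bdAlpha p η₀ η₁ κ := rfl

theorem waveBracket_star_eq_bdBeta (p : Params) (η₀ η₁ κ : ℝ) :
    waveBracket (star (bdVec p κ η₀)) (bdVec p κ η₁) = -bdBeta p η₀ η₁ κ := by
  simp only [waveBracket, bdVec, star_fst, star_snd, Complex.conj_conj, bdBeta]
  ring

theorem bdMode_eq_iff (p : Params) {η₀ : ℝ} (h₀ : η₀ < 0) (η₁ : ℝ) (k : Wave) (x y : ℂ) :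
    bdMode p η₁ k = x • bdMode p η₀ k + y • conjC (bdMode p η₀ (-k)) ↔
      x = bdAlpha p η₀ η₁ ‖k.1‖ ∧ y = bdBeta p η₀ η₁ ‖k.1‖ := by
  have hv := waveBracket_bdVec p (norm_wave_pos k) h₀
  rw [bdMode_eq_single, bdMode_eq_single, bdMode_eq_single, conjC_single, wave_neg_neg,
    norm_wave_neg, Finsupp.smul_single, Finsupp.smul_single, ← Finsupp.single_add,
    (Finsupp.single_injective k).eq_iff]
  constructor
  · intro h
    have h2 : waveBracket (star (bdVec p ‖k.1‖ η₀)) (star (bdVec p ‖k.1‖ η₀)) = -1 := by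
      rw [waveBracket_star_star, hv, map_one]
    constructor
    · rw [← waveBracket_eq_bdAlpha, h, waveBracket_add, waveBracket_smul, waveBracket_smul, hv,
        waveBracket_star_right_self]
      ring
    · rw [← neg_inj, ← waveBracket_star_eq_bdBeta, h, waveBracket_add, waveBracket_smul,
        waveBracket_smul, h2, waveBracket_star_left_self]
      ring
  · rintro ⟨rfl, rfl⟩
    have h := eq_smul_add_smul_star hv (bdVec p ‖k.1‖ η₁)
    rwa [waveBracket_eq_bdAlpha, waveBracket_star_eq_bdBeta, neg_neg] at h

/-- The Bogoliubov transformation of the coefficients of a field. -/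
theorem coeff_synth_of_ne (p : Params) (η₀ η₁ : ℝ) (c : Wave →₀ ℂ) (k : Wave) :
    coeff p η₁ (synth p η₀ c) k = conj (bdAlpha p η₀ η₁ ‖k.1‖) * c k -
      conj (bdBeta p η₀ η₁ ‖k.1‖) * conj (c (-k)) := by
  rw [coeff_apply, synth_apply, waveBracket_add, waveBracket_smul, waveBracket_smul,
    ← conj_waveBracket, ← conj_waveBracket (star _), waveBracket_eq_bdAlpha,
    waveBracket_star_eq_bdBeta, map_neg]
  ring

/-- The quadratic form of `|BD, η₁⟩` on two Bunch–Davies coefficients at another time. -/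
theorem finsum_coeff_synth (p : Params) (η₀ η₁ : ℝ) (k : Wave) (x y : ℂ) :
    ∑ᶠ q, ‖coeff p η₁ (synth p η₀ (Finsupp.single k x + Finsupp.single (-k) y)) q‖ ^ 2 =
      (‖bdAlpha p η₀ η₁ ‖k.1‖‖ ^ 2 + ‖bdBeta p η₀ η₁ ‖k.1‖‖ ^ 2) * (‖x‖ ^ 2 + ‖y‖ ^ 2) -
        4 * (conj (bdAlpha p η₀ η₁ ‖k.1‖) * bdBeta p η₀ η₁ ‖k.1‖ * (x * y)).re := by
  have hne := wave_neg_ne k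
  have hk : (Finsupp.single k x + Finsupp.single (-k) y : Wave →₀ ℂ) k = x := by
    simp [Finsupp.single_eq_of_ne hne.symm]
  have hk' : (Finsupp.single k x + Finsupp.single (-k) y : Wave →₀ ℂ) (-k) = y := by
    simp [Finsupp.single_eq_of_ne hne]
  rw [finsum_eq_pair hne.symm fun q h1 h2 => ?_]
  · rw [coeff_synth_of_ne, coeff_synth_of_ne, wave_neg_neg, hk, hk', norm_wave_neg]
    generalize bdAlpha p η₀ η₁ ‖k.1‖ = α
    generalize bdBeta p η₀ η₁ ‖k.1‖ = β
    simp only [← Complex.normSq_eq_norm_sq, Complex.normSq_apply, Complex.sub_re, Complex.sub_im,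
      Complex.mul_re, Complex.mul_im, Complex.conj_re, Complex.conj_im]
    ring
  · have h1' : -q ≠ k := fun h => h2 (by rw [← h, wave_neg_neg])
    have h2' : -q ≠ -k := fun h => h1 (by rw [← wave_neg_neg q, h, wave_neg_neg])
    rw [coeff_synth_of_ne]
    simp [Finsupp.single_eq_of_ne h1, Finsupp.single_eq_of_ne h2, Finsupp.single_eq_of_ne h1',
      Finsupp.single_eq_of_ne h2']

theorem exists_wave (κ : ℝ) (hκ : 0 < κ) : ∃ k : Wave, ‖k.1‖ = κ := by
  obtain ⟨v, hv⟩ := exists_norm_eq Space hκ.le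
  exact ⟨⟨v, fun h => by rw [h, norm_zero] at hv; exact hκ.ne hv⟩, hv⟩

/-- On a field with the single coefficient 1 at time η₀ the two quadratic forms take the values |α|²
+ |β|² = 1 + 2|β|² and 1. -/
theorem BD_ne_BD (p : Params) {η₀ η₁ : ℝ} (h₀ : η₀ < 0) (h₁ : η₁ < 0) (hne : η₁ ≠ η₀) :
    BD p η₁ ≠ BD p η₀ := by
  intro h
  obtain ⟨k, hk⟩ := exists_wave 1 one_pos
  have h2 := congrFun h (synth p η₀ (Finsupp.single k 1 + Finsupp.single (-k) 0))
  rw [BD_eq_gaussian, BD_synth p h₀, gaussian, gaussian] at h2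
  have h3 := gaussian_inj_of_finsum h2
  rw [finsum_coeff_synth, finsum_single_add_single, hk] at h3
  have h4 := bdAlpha_sq_sub_bdBeta_sq p one_pos h₀ h₁
  have h5 : 0 < ‖bdBeta p η₀ η₁ 1‖ ^ 2 :=
    pow_pos (norm_pos_iff.2 (bdBeta_ne_zero p one_pos h₀ h₁ hne)) 2
  simp at h3
  linarith

/-! ### Oscillating phases and the failure of dilation invariance -/

theorem not_tendsto_exp {s : ℝ} (hs : s ≠ 0) (L : ℂ) :
    ¬ Tendsto (fun κ : ℝ => Complex.exp (Complex.I * (κ * s))) atTop (𝓝 L) := by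
  intro h
  -- A shift of κ by π/|s| changes the sign of the exponential. A limit would equal its own
  -- negative, hence be 0, although the modulus is constantly 1.
  have h1 := h.comp (tendsto_atTop_add_const_right atTop (Real.pi / |s|) tendsto_id)
  have h2 : ∀ κ : ℝ, Complex.exp (Complex.I * ((κ + Real.pi / |s| : ℝ) * s)) =
      -Complex.exp (Complex.I * (κ * s)) := by
    intro κ
    have e : Complex.exp (Complex.I * ((Real.pi / |s| : ℝ) * s)) = -1 := by
      rcases lt_or_gt_of_ne hs with hlt | hgt
      · rw [abs_of_neg hlt, ← Complex.ofReal_mul, show Real.pi / -s * s = -Real.pi by field_simp,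
          Complex.ofReal_neg, mul_neg, Complex.exp_neg, mul_comm, Complex.exp_pi_mul_I]
        norm_num
      · rw [abs_of_pos hgt, ← Complex.ofReal_mul, show Real.pi / s * s = Real.pi by field_simp,
          mul_comm, Complex.exp_pi_mul_I]
    rw [Complex.ofReal_add, add_mul, mul_add, Complex.exp_add, e, mul_neg_one]
  have h3 : Tendsto (fun κ : ℝ => Complex.exp (Complex.I * (κ * s))) atTop (𝓝 (-L)) := by
    refine h1.neg.congr fun κ => ?_
    simp only [Function.comp_apply, id_eq]
    rw [h2, neg_neg]
  have hL : L = 0 := self_eq_neg.1 (tendsto_nhds_unique h h3)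
  have h4 : Tendsto (fun κ : ℝ => ‖Complex.exp (Complex.I * (κ * s))‖) atTop (𝓝 1) := by
    refine tendsto_const_nhds.congr fun κ => ?_
    rw [← Complex.ofReal_mul, mul_comm, Complex.norm_exp_ofReal_mul_I]
  have h5 := tendsto_nhds_unique h.norm h4
  rw [hL, norm_zero] at h5
  exact zero_ne_one h5

theorem not_const_of_tendsto {g : ℝ → ℂ} {s : ℝ} (hs : s ≠ 0) {L : ℂ}
    (h : Tendsto (fun κ : ℝ => Complex.exp (Complex.I * (κ * s)) * g κ) atTop (𝓝 L)) {b : ℂ}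
    (hb : b ≠ 0) (hconst : ∀ κ, 0 < κ → g κ = b) : False := by
  refine not_tendsto_exp hs (L / b) ((h.div_const b).congr' ?_)
  filter_upwards [eventually_gt_atTop 0] with κ hκ
  rw [hconst κ hκ, mul_div_cancel_right₀ _ hb]

theorem not_bdBeta_const (p : Params) {η₀ η₁ : ℝ} (h₀ : η₀ < 0) (h₁ : η₁ < 0) (hne : η₁ ≠ η₀) :
    ¬ ∃ b : ℂ, ∀ κ : ℝ, 0 < κ → bdBeta p η₀ η₁ κ = b := by
  rintro ⟨b, hb⟩
  have h := tendsto_bdBeta p h₀ h₁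
  simp only [← Complex.ofReal_add] at h
  refine not_const_of_tendsto (by linarith) h ?_ hb
  rw [← hb 1 one_pos]
  exact bdBeta_ne_zero p one_pos h₀ h₁ hne

theorem bdBeta_limit_ne_zero (p : Params) {η₀ η₁ : ℝ} (h₀ : η₀ < 0) (h₁ : η₁ < 0)
    (hne : η₁ ≠ η₀) :
    -((p.V₀ / p.H ^ 2 : ℝ) : ℂ) * bdConst p ^ 2 * ((η₀ / η₁ - η₁ / η₀ : ℝ) : ℂ) ≠ 0 := by
  refine mul_ne_zero (mul_ne_zero (neg_ne_zero.2 ?_) (pow_ne_zero _ (bdConst_ne_zero p))) ?_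
  · exact_mod_cast (div_pos p.V₀_pos (pow_pos p.H_pos 2)).ne'
  · have h : η₀ / η₁ - η₁ / η₀ ≠ 0 := by
      have g0 := h₀.ne
      have g1 := h₁.ne
      rw [div_sub_div _ _ g1 g0]
      refine div_ne_zero ?_ (mul_ne_zero g1 g0)
      rw [show η₀ * η₀ - η₁ * η₁ = (η₀ - η₁) * (η₀ + η₁) by ring]
      exact mul_ne_zero (sub_ne_zero.2 hne.symm) (by linarith)
    exact_mod_cast h

theorem equivMapDomain_single_add (e : Wave ≃ Wave) (k k' : Wave) (x y : ℂ) :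
    Finsupp.equivMapDomain e (Finsupp.single k x + Finsupp.single k' y) =
      Finsupp.single (e k) x + Finsupp.single (e k') y := by
  rw [← Finsupp.equivMapDomain_single, ← Finsupp.equivMapDomain_single]
  ext1 q
  simp only [Finsupp.equivMapDomain_apply, Finsupp.add_apply]

/-- The Killing flow at η₀ moves coefficients at wave number 1 to wave number κ, so invariance would
make the quadratic form of the other vacuum, and with it ᾱβ, independent of κ. But ᾱβ is nonzero and
its phase oscillates asymptotically like e^{-2iκη₀}. The phase is essential, since the moduli of α
and β do converge. -/
theorem not_pdSInvariantAt_BD (p : Params) {η₀ η₁ : ℝ} (h₀ : η₀ < 0) (h₁ : η₁ < 0)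
    (hne : η₁ ≠ η₀) : ¬ PdSInvariantAt p η₀ (BD p η₁) := by
  rintro ⟨-, -, hinv⟩
  have hform : ∀ κ : ℝ, 0 < κ → ∀ x y : ℂ,
      (‖bdAlpha p η₀ η₁ κ‖ ^ 2 + ‖bdBeta p η₀ η₁ κ‖ ^ 2) * (‖x‖ ^ 2 + ‖y‖ ^ 2) -
        4 * (conj (bdAlpha p η₀ η₁ κ) * bdBeta p η₀ η₁ κ * (x * y)).re =
      (‖bdAlpha p η₀ η₁ 1‖ ^ 2 + ‖bdBeta p η₀ η₁ 1‖ ^ 2) * (‖x‖ ^ 2 + ‖y‖ ^ 2) -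
        4 * (conj (bdAlpha p η₀ η₁ 1) * bdBeta p η₀ η₁ 1 * (x * y)).re := by
    intro κ hκ x y
    obtain ⟨k, hk⟩ := exists_wave 1 one_pos
    -- The flow parameter -log κ / H rescales wave vectors by κ.
    have hl : -(p.H * (-(Real.log κ / p.H))) = Real.log κ := by
      have := p.H_pos.ne'
      field_simp
    have h := hinv (-(Real.log κ / p.H))
      (synth p η₀ (Finsupp.single k x + Finsupp.single (-k) y))
    rw [killingFlow_synth p h₀, hl, equivMapDomain_single_add, BD_eq_gaussian, BD_eq_gaussian,
      gaussian, gaussian] at h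
    have h := gaussian_inj_of_finsum h
    have hneg : waveScale (Real.log κ) (-k) = -(waveScale (Real.log κ) k) := by
      ext1
      change Real.exp (Real.log κ) • (-k.1) = -(Real.exp (Real.log κ) • k.1)
      rw [smul_neg]
    have hnorm : ‖(waveScale (Real.log κ) k).1‖ = κ := by
      change ‖Real.exp (Real.log κ) • k.1‖ = κ
      rw [norm_smul, Real.norm_eq_abs, Real.abs_exp, Real.exp_log hκ, hk, mul_one]
    rw [hneg, finsum_coeff_synth, finsum_coeff_synth, hnorm, hk] at h
    exact h
  have hconst : ∀ κ : ℝ, 0 < κ → conj (bdAlpha p η₀ η₁ κ) * bdBeta p η₀ η₁ κ =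
      conj (bdAlpha p η₀ η₁ 1) * bdBeta p η₀ η₁ 1 := by
    intro κ hκ
    -- The pair (1, 0) compares |α|² + |β|²; given this, (1, 1) and (1, i) compare the real and
    -- imaginary parts of ᾱβ.
    have h1 := hform κ hκ 1 0
    have h2 := hform κ hκ 1 1
    have h3 := hform κ hκ 1 Complex.I
    simp only [norm_one, norm_zero, Complex.norm_I, one_pow, mul_one, mul_zero, one_mul,
      Complex.zero_re, Complex.mul_I_re, ne_eq, OfNat.ofNat_ne_zero, not_false_eq_true, zero_pow,
      add_zero, sub_zero] at h1 h2 h3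
    apply Complex.ext <;> linarith
  have hne0 : conj (bdAlpha p η₀ η₁ 1) * bdBeta p η₀ η₁ 1 ≠ 0 := by
    refine mul_ne_zero ?_ (bdBeta_ne_zero p one_pos h₀ h₁ hne)
    rw [map_ne_zero]
    intro h
    have h4 := bdAlpha_sq_sub_bdBeta_sq p one_pos h₀ h₁
    rw [h, norm_zero] at h4
    nlinarith [sq_nonneg ‖bdBeta p η₀ η₁ 1‖]
  have hlim := ((Complex.continuous_conj.tendsto _).comp (tendsto_bdAlpha p h₀ h₁)).mul
    (tendsto_bdBeta p h₀ h₁)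
  refine not_const_of_tendsto (g := fun κ => conj (bdAlpha p η₀ η₁ κ) * bdBeta p η₀ η₁ κ)
    (s := 2 * η₀) (by linarith) (hlim.congr fun κ => ?_) hne0 hconst
  simp only [Function.comp_apply, map_mul, ← Complex.exp_conj, Complex.conj_I, map_sub,
    Complex.conj_ofReal]
  have e : Complex.exp (Complex.I * (κ * ((2 * η₀ : ℝ) : ℂ))) =
      Complex.exp (-Complex.I * (κ * (η₁ - η₀))) * Complex.exp (Complex.I * (κ * (η₀ + η₁))) := by
    rw [← Complex.exp_add]
    congr 1
    push_cast
    ring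
  rw [e]
  ring

/-! ### The Hadamard condition -/

theorem hadamardAt_BD (p : Params) {η : ℝ} (hη : η < 0) : HadamardAt p η (BD p η) := by
  refine ⟨fun k => bdVec p ‖k.1‖ η, isFockBasis_bdMode p hη, rfl, ?_⟩
  have h := (tendsto_bdMom_div p hη η hη).comp
    (tendsto_comap (f := fun k : Wave => ‖k.1‖) (x := atTop))
  rw [div_self (pow_ne_zero 2 hη.ne), Complex.ofReal_one] at h
  exact h

/-- Needed for uniqueness of limits as |k| → ∞; every positive number is the norm of some wave
vector. -/
instance comap_norm_wave_neBot : (comap (fun k : Wave => ‖k.1‖) atTop).NeBot := by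
  refine (atTop_neBot (α := ℝ)).comap_of_range_mem ?_
  filter_upwards [eventually_gt_atTop 0] with κ hκ using exists_wave κ hκ

/-- The modes of a translation invariant Fock vacuum are determined up to phases. -/
theorem modes_of_BD_eq (p : Params) {η : ℝ} (hη : η < 0) {v : Wave → ℂ × ℂ}
    (hv : ∀ k, waveBracket (v k) (v k) = 1)
    (h : BD p η = fockVacuum fun k => Finsupp.single k (v k)) (k : Wave) :
    ∃ z : ℂ, z ≠ 0 ∧ v k = z • bdVec p ‖k.1‖ η := by
  have hne := wave_neg_ne k
  have hu := waveBracket_bdVec p (norm_wave_pos k) hη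
  -- Each normalized `v q` is a Bogoliubov combination α_q u + β_q ū of the Bunch–Davies amplitudes
  -- u, with |α_q|² - |β_q|² = 1.
  have hdec : ∀ q : Wave, ‖waveBracket (bdVec p ‖q.1‖ η) (v q)‖ ^ 2 -
      ‖waveBracket (star (bdVec p ‖q.1‖ η)) (v q)‖ ^ 2 = 1 := by
    intro q
    have hq := waveBracket_bdVec p (norm_wave_pos q) hη
    have h1 := hv q
    have h2 : waveBracket (v q) (waveBracket (bdVec p ‖q.1‖ η) (v q) • bdVec p ‖q.1‖ η +
        (-waveBracket (star (bdVec p ‖q.1‖ η)) (v q)) • star (bdVec p ‖q.1‖ η)) = 1 := by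
      rw [← eq_smul_add_smul_star hq (v q)]
      exact h1
    rw [waveBracket_add, waveBracket_smul, waveBracket_smul, ← conj_waveBracket (bdVec p ‖q.1‖ η),
      ← conj_waveBracket (star _), neg_mul, Complex.mul_conj', Complex.mul_conj'] at h2
    exact_mod_cast (sub_eq_add_neg _ _).trans h2
  -- On the real field with single coefficient 1 at k, equality of the vacua reads 1 = |α_k|² +
  -- |β_{-k}|² = 1 + |β_k|² + |β_{-k}|², so β_k = 0.
  have h1 := congrFun h (synth p η (Finsupp.single k 1 + Finsupp.single (-k) 0))
  rw [BD_synth p hη, gaussian, fockVacuum_single] at h1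
  have h1 := gaussian_inj_of_finsum h1
  rw [finsum_single_add_single, finsum_eq_pair hne.symm fun q g1 g2 => ?_] at h1
  · have e1 : (synth p η (Finsupp.single k 1 + Finsupp.single (-k) 0)).1 k =
        bdVec p ‖k.1‖ η := by
      rw [synth_apply]
      simp [Finsupp.single_eq_of_ne hne]
    rw [phase_neg, e1, ← conj_waveBracket, ← conj_waveBracket (star _), RCLike.norm_conj,
      RCLike.norm_conj] at h1
    have d1 := hdec k
    have d2 := hdec (-k)
    rw [norm_wave_neg] at d2
    have hz : waveBracket (star (bdVec p ‖k.1‖ η)) (v k) = 0 := by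
      rw [← norm_eq_zero, ← sq_eq_zero_iff]
      simp only [norm_one, norm_zero] at h1
      nlinarith [sq_nonneg ‖waveBracket (star (bdVec p ‖k.1‖ η)) (v k)‖,
        sq_nonneg ‖waveBracket (star (bdVec p ‖k.1‖ η)) (v (-k))‖]
    refine ⟨waveBracket (bdVec p ‖k.1‖ η) (v k), fun h0 => ?_, ?_⟩
    · rw [h0, hz] at d1
      norm_num at d1
    · have h3 := eq_smul_add_smul_star hu (v k)
      rw [hz, neg_zero, zero_smul, add_zero] at h3
      exact h3
  · have g1' : -q ≠ k := fun h => g2 (by rw [← h, wave_neg_neg])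
    have : (synth p η (Finsupp.single k 1 + Finsupp.single (-k) 0)).1 q = 0 := by
      rw [synth_apply]
      simp [Finsupp.single_eq_of_ne g1, Finsupp.single_eq_of_ne g1']
    rw [this]
    simp [waveBracket]

/-- `HadamardAt` allows any choice of modes for the state, but by `modes_of_BD_eq` these differ from
the Bunch–Davies modes at η₁ only by a scalar, which cancels in the ratio p/e. The limit is then
η₀²/η₁², and equals 1 only for η₀ = η₁ as both times are negative. -/
theorem not_hadamardAt_BD (p : Params) {η₀ η₁ : ℝ} (h₀ : η₀ < 0) (h₁ : η₁ < 0) (hne : η₁ ≠ η₀) :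
    ¬ HadamardAt p η₀ (BD p η₁) := by
  rintro ⟨v, hfock, hBD, hlim⟩
  have hv : ∀ k, waveBracket (v k) (v k) = 1 := fun k => by
    have h := hfock.1 k
    rwa [bracket_single, Finsupp.single_eq_same] at h
  have hlim' := (tendsto_bdMom_div p h₁ η₀ h₀).comp
    (tendsto_comap (f := fun k : Wave => ‖k.1‖) (x := atTop))
  have heq := tendsto_nhds_unique (hlim.congr fun k => by
    obtain ⟨z, hz, hk⟩ := modes_of_BD_eq p h₁ hv hBD k
    rw [hk]
    simp only [bdVec, Prod.smul_fst, Prod.smul_snd, smul_eq_mul, Function.comp_apply]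
    rw [mul_left_comm, mul_div_mul_left _ _ hz]) hlim'
  have h1 : η₀ ^ 2 / η₁ ^ 2 = 1 := by exact_mod_cast heq.symm
  have h2 : η₀ ^ 2 = η₁ ^ 2 := (div_eq_one_iff_eq (pow_ne_zero 2 h₁.ne)).1 h1
  rcases sq_eq_sq_iff_eq_or_eq_neg.1 h2 with h3 | h3
  · exact hne h3.symm
  · linarith

end PdS

end

theorem mainTheorem1 (p : PdS.Params) (η₀ η₁ : ℝ) (h₀ : η₀ < 0) (h₁ : η₁ < 0) :
    -- the Bunch–Davies modes define a Fock vacuum, PdS invariant and Hadamard at its own time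
    PdS.IsFockBasis (PdS.bdMode p η₀) ∧
    PdS.IsState PdS.symp (PdS.BD p η₀) ∧
    PdS.PdSInvariantAt p η₀ (PdS.BD p η₀) ∧
    PdS.HadamardAt p η₀ (PdS.BD p η₀) ∧
    -- comparison of the vacua at different times
    (η₁ ≠ η₀ →
      PdS.BD p η₁ ≠ PdS.BD p η₀ ∧
      ¬ PdS.PdSInvariantAt p η₀ (PdS.BD p η₁) ∧
      ¬ PdS.HadamardAt p η₀ (PdS.BD p η₁) ∧
      ∃ α β : ℝ → ℂ,
        (∀ (k : PdS.Wave) (x y : ℂ),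
          PdS.bdMode p η₁ k =
              x • PdS.bdMode p η₀ k + y • PdS.conjC (PdS.bdMode p η₀ (-k)) ↔
            x = α ‖k.1‖ ∧ y = β ‖k.1‖) ∧
        (∀ κ : ℝ, 0 < κ → ‖α κ‖ ^ 2 - ‖β κ‖ ^ 2 = 1) ∧
        (∀ κ : ℝ, 0 < κ → β κ ≠ 0) ∧
        (¬ ∃ b : ℂ, ∀ κ : ℝ, 0 < κ → β κ = b) ∧
        ∃ b : ℂ, b ≠ 0 ∧
          Filter.Tendsto (fun κ : ℝ => Complex.exp (Complex.I * (κ * (η₀ + η₁))) * β κ)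
            Filter.atTop (nhds b)) ∧
    -- the classical dynamics is well posed, and time evolution connects the vacua
    (∀ f, ∃! g, PdS.EvolvesTo p η₀ η₁ f g) ∧
    PdS.evolveState p η₀ η₁ (PdS.BD p η₀) = PdS.BD p η₁ ∧
    -- no squeezing or entanglement between `k` and `-k`, initially or after the evolution
    (∀ k : PdS.Wave,
      ¬ PdS.TwoModeSqueezed p η₀ k (PdS.BD p η₀) ∧
      ¬ PdS.Entangled p η₀ k (PdS.BD p η₀) ∧
      ¬ PdS.TwoModeSqueezed p η₁ k (PdS.evolveState p η₀ η₁ (PdS.BD p η₀)) ∧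
      ¬ PdS.Entangled p η₁ k (PdS.evolveState p η₀ η₁ (PdS.BD p η₀))) := by
  refine ⟨PdS.isFockBasis_bdMode p h₀, PdS.isState_BD p h₀, PdS.pdSInvariantAt_BD p h₀,
    PdS.hadamardAt_BD p h₀, fun hne => ⟨PdS.BD_ne_BD p h₀ h₁ hne,
      PdS.not_pdSInvariantAt_BD p h₀ h₁ hne, PdS.not_hadamardAt_BD p h₀ h₁ hne,
      PdS.bdAlpha p η₀ η₁, PdS.bdBeta p η₀ η₁, PdS.bdMode_eq_iff p h₀ η₁,
      fun κ hκ => PdS.bdAlpha_sq_sub_bdBeta_sq p hκ h₀ h₁,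
      fun κ hκ => PdS.bdBeta_ne_zero p hκ h₀ h₁ hne, PdS.not_bdBeta_const p h₀ h₁ hne,
      _, PdS.bdBeta_limit_ne_zero p h₀ h₁ hne, PdS.tendsto_bdBeta p h₀ h₁⟩,
    PdS.existsUnique_evolvesTo p h₀ h₁, PdS.evolveState_BD p h₀ h₁, fun k => ?_⟩
  rw [PdS.evolveState_BD p h₀ h₁]
  exact ⟨PdS.not_twoModeSqueezed_BD p h₀ k, PdS.not_entangled_BD p h₀ k,
    PdS.not_twoModeSqueezed_BD p h₁ k, PdS.not_entangled_BD p h₁ k⟩
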